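/- Let $\mathbf w=(r_1,r_2,a,1)$ be positive integer weights for the coordinates $x_1,x_2,x_3,x_4$ of $\mathbb C^4$ such that $a$ divides $r_1+r_2$ and is coprime to both $r_1$ and $r_2$, $r_1\ge r_2$, and $n:=(r_1+r_2)/a-1\ge 2$. The weight of a nonzero power series is the least weighted degree of a monomial appearing in it. **Definitions.** A power series $f\in\mathbb C\{x_1,\dots,x_4\}$ defines a $cA_n$ singularity at the origin if the general hyperplane section $V(f)\cap\{\sum c_ix_i=0\}$ is, as a complex analytic germ at $\mathbf 0$, isomorphic to the surface $A_n$ singularity $V(y_1^2+y_2^2+y_3^{n+1})\subseteq\mathbb C^3$; it is isolated if $V(f)$ is smooth on a punctured neighbourhood of $\mathbf 0$. For positive integer weights $\mathbf w=(w_1,\dots,w_N)$, let $T$ be the geometric quotient of $\mathbb C^{N+1}\setminus V(x_1,\dots,x_N)$, with coordinates $(u,x_1,\dots,x_N)$, by the $\mathbb C^*$-action $\lambda\cdot(u,x_1,\dots,x_N)=(\lambda^{-1}u,\lambda^{w_1}x_1,\dots,\lambda^{w_N}x_N)$. The $\mathbf w$-blowup of $\mathbb C^N$ at $\mathbf 0$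 is the morphism $\varphi\colon T\to\mathbb C^N$, $[u,x_1,\dots,x_N]\mapsto(u^{w_1}x_1,\dots,u^{w_N}x_N)$, and the $\mathbf w$-blowup of an analytic subspace $Z\ni\mathbf 0$ is the restriction of $\varphi$ to the strict transform $\tilde Z$, i.e. the closure of $\varphi^{-1}(Z\setminus\{\mathbf 0\})$, mapping to $Z$. Two such blowups $\varphi\colon\tilde Z\to Z$ and $\varphi'\colon\tilde Z'\to Z'$ are locally analytically equivalent if there are open neighbourhoods $U\subseteq Z$ and $U'\subseteq Z'$ of the origins and biholomorphic maps $e\colon U\to U'$ and $E\colon\varphi^{-1}(U)\to\varphi'^{-1}(U')$ with $e\circ\varphi=\varphi'\circ E$. A weighted blowup is an $(r_1,r_2,a,1)$-Kawakita blowup if it is locally analytically equivalent to the $(r_1,r_2,a,1)$-blowup at $\mathbf 0$ of some $V(x_1x_2+g(x_3,x_4))\subseteq\mathbb C^4$ with an isolated $cA_m$ singularity at $\mathbf 0$, $m\ge 2$, where $g\in\mathbb C\{x_3,x_4\}$, $a$ divides $r_1+r_2$ and is coprime to both $r_1$ and $r_2$, $g$ has weight $r_1+r_2$, and the monomial $x_3^{(r_1+r_2)/a}$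 appears in $g$ with non-zero coefficient. (The last two conditions force $g$ to have multiplicity $(r_1+r_2)/a$, so that the singularity is $cA_m$ exactly for $m=(r_1+r_2)/a-1$.) **Proposition.** Let $f\in\mathbb C\{x_1,x_2,x_3,x_4\}$ define an isolated $cA_n$ singularity at the origin, with $n=(r_1+r_2)/a-1$ as above, and suppose that $f$ has $\mathbf w$-weight $r_1+r_2$. Then the $\mathbf w$-blowup of $V(f)\subseteq\mathbb C^4$ at $\mathbf 0$ is an $(r_1,r_2,a,1)$-Kawakita blowup. -/

import Mathlib

open Filter Topology

namespace Kawakita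

/-! ### Convergent power series in `n` complex variables -/

/-- The term of the power series `f` with exponent `m`, at the point `x`. -/
noncomputable def term {n : ℕ} (f : MvPowerSeries (Fin n) ℂ) (x : Fin n → ℂ) (m : Fin n →₀ ℕ) : ℂ :=
  MvPowerSeries.coeff m f * ∏ i, x i ^ m i

/-- `f ∈ ℂ{x₁, …, xₙ}`: the power series converges on a neighbourhood of the origin. -/
def IsConvergent {n : ℕ} (f : MvPowerSeries (Fin n) ℂ) : Prop :=
  ∀ᶠ x in 𝓝 (0 : Fin n → ℂ), Summable (term f x)

/-- The (open) domain of convergence of `f`. -/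
def convDomain {n : ℕ} (f : MvPowerSeries (Fin n) ℂ) : Set (Fin n → ℂ) :=
  interior {x | Summable (term f x)}

/-- The holomorphic function on `convDomain f` defined by `f`. -/
noncomputable def value {n : ℕ} (f : MvPowerSeries (Fin n) ℂ) (x : Fin n → ℂ) : ℂ :=
  ∑' m, term f x m

/-- The zero set `V(f)` in the domain of convergence of `f`. -/
def zeroLocus {n : ℕ} (f : MvPowerSeries (Fin n) ℂ) : Set (Fin n → ℂ) :=
  {x | x ∈ convDomain f ∧ value f x = 0}

/-! ### Singularities -/

/-- Contact equivalence at the origin: `g = u · (f ∘ φ)` near `0`, with `φ` a biholomorphic map germ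
`(ℂⁿ, 0) → (ℂⁿ, 0)` (with inverse `θ`) and `u` a unit. Equivalently, the complex analytic space
germs at `0` defined by `f` and `g` are isomorphic. -/
def ContactEquiv {n : ℕ} (f g : (Fin n → ℂ) → ℂ) : Prop :=
  ∃ (φ θ : (Fin n → ℂ) → (Fin n → ℂ)) (u : (Fin n → ℂ) → ℂ),
    AnalyticAt ℂ φ 0 ∧ AnalyticAt ℂ θ 0 ∧ φ 0 = 0 ∧ θ 0 = 0 ∧
    (∀ᶠ x in 𝓝 0, θ (φ x) = x) ∧ (∀ᶠ x in 𝓝 0, φ (θ x) = x) ∧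
    AnalyticAt ℂ u 0 ∧ u 0 ≠ 0 ∧ ∀ᶠ x in 𝓝 0, g x = u x * f (φ x)

/-- `F` defines a surface `Aₙ` singularity at the origin of `ℂ³`. -/
def IsSurfaceA (n : ℕ) (F : (Fin 3 → ℂ) → ℂ) : Prop :=
  ContactEquiv (fun y => y 0 ^ 2 + y 1 ^ 2 + y 2 ^ (n + 1)) F

/-- `V(f) ⊆ ℂ⁴` has a `cAₙ` singularity at the origin: the general hyperplane section is an `Aₙ`
singularity. Here the hyperplane is `∑ cᵢ xᵢ = 0`, with `c` outside the zero set of some non-zero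
polynomial `p`, and `L` is a linear isomorphism from `ℂ³` onto this hyperplane. -/
def IsCA (n : ℕ) (f : MvPowerSeries (Fin 4) ℂ) : Prop :=
  ∃ p : MvPolynomial (Fin 4) ℂ, p ≠ 0 ∧ ∀ c : Fin 4 → ℂ, MvPolynomial.eval c p ≠ 0 →
    ∃ L : (Fin 3 → ℂ) →ₗ[ℂ] (Fin 4 → ℂ), Function.Injective L ∧
      (∀ x, x ∈ LinearMap.range L ↔ ∑ i, c i * x i = 0) ∧
      IsSurfaceA n (fun y => value f (L y))

/-- `V(f)` is smooth on a punctured neighbourhood of the origin. -/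
def IsIsolated {n : ℕ} (f : MvPowerSeries (Fin n) ℂ) : Prop :=
  ∀ᶠ x in 𝓝[≠] (0 : Fin n → ℂ), value f x = 0 → fderiv ℂ (value f) x ≠ 0

/-! ### Reduced complex spaces

A reduced complex space is a topological space with its sheaf of holomorphic functions. The ambient
spaces below (`ℂⁿ` and the weighted blowup of `ℂⁿ`) are given with the predicate
"`h` is holomorphic near the point `p`", and analytic subsets carry the induced structure. -/

/-- `h`, defined on the subset `A` of `M`, is near `p` the restriction of a holomorphic function of
`M`, where `O H q` says that `H` is holomorphic near the point `q` of `M`. -/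
def HolAtOn {M : Type*} [TopologicalSpace M] (O : (M → ℂ) → M → Prop) (A : Set M)
    (h : A → ℂ) (p : A) : Prop :=
  ∃ H : M → ℂ, O H p ∧ ∀ᶠ q : A in 𝓝 p, H q = h q

/-- A homeomorphism between analytic subsets is biholomorphic: it identifies the germs of holomorphic
functions at corresponding points. -/
def IsBiholomorphic {M N : Type*} [TopologicalSpace M] [TopologicalSpace N]
    (O : (M → ℂ) → M → Prop) (O' : (N → ℂ) → N → Prop) {A : Set M} {B : Set N}
    (e : A ≃ₜ B) : Prop :=
  ∀ (p : A) (h : B → ℂ), HolAtOn O' B h (e p) ↔ HolAtOn O A (h ∘ e) p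

/-! ### Weighted blowups -/

/-- `ℂⁿ⁺¹ ∖ V(x₁, …, xₙ)`, with coordinates `(u, x₁, …, xₙ)`. -/
abbrev BlowupCover (n : ℕ) : Type := {p : ℂ × (Fin n → ℂ) // p.2 ≠ 0}

/-- The orbit relation of the action `λ · (u, x) = (λ⁻¹ u, λ ^ w₁ x₁, …, λ ^ wₙ xₙ)` of `ℂ*`. -/
def blowupSetoid {n : ℕ} (w : Fin n → ℕ) : Setoid (BlowupCover n) where
  r p q := ∃ l : ℂ, l ≠ 0 ∧ q.1.1 = l⁻¹ * p.1.1 ∧ ∀ i, q.1.2 i = l ^ w i * p.1.2 i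
  iseqv :=
    { refl := fun p => ⟨1, one_ne_zero, by simp, by simp⟩
      symm := by
        rintro p q ⟨l, hl, h1, h2⟩
        refine ⟨l⁻¹, inv_ne_zero hl, ?_, fun i => ?_⟩
        · rw [h1]; field_simp
        · rw [h2, inv_pow]; field_simp
      trans := by
        rintro p q r ⟨l, hl, h1, h2⟩ ⟨k, hk, h3, h4⟩
        refine ⟨k * l, mul_ne_zero hk hl, ?_, fun i => ?_⟩
        · rw [h3, h1, mul_inv]; ring
        · rw [h4, h2, mul_pow]; ring }

/-- The `w`-blowup `T` of `ℂⁿ` at the origin, as the geometric quotient by the action of `ℂ*`. -/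
def Blowup {n : ℕ} (w : Fin n → ℕ) : Type := Quotient (blowupSetoid w)

/-- `T` carries the quotient topology. -/
instance {n : ℕ} (w : Fin n → ℕ) : TopologicalSpace (Blowup w) :=
  inferInstanceAs (TopologicalSpace (Quotient (blowupSetoid w)))

/-- The point `[u, x₁, …, xₙ]` of `T`. -/
def Blowup.mk {n : ℕ} (w : Fin n → ℕ) (p : BlowupCover n) : Blowup w :=
  Quotient.mk (blowupSetoid w) p

/-- The morphism `T → ℂⁿ`, `[u, x₁, …, xₙ] ↦ (u ^ w₁ x₁, …, u ^ wₙ xₙ)`. -/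
def Blowup.proj {n : ℕ} (w : Fin n → ℕ) : Blowup w → (Fin n → ℂ) :=
  Quotient.lift (fun p : BlowupCover n => fun i => p.1.1 ^ w i * p.1.2 i) (by
    rintro p q ⟨l, hl, h1, h2⟩
    funext i
    simp only [h1, h2, mul_pow, inv_pow]
    field_simp)

/-- `H` is holomorphic near the point `q` of `T`: its pullback to `ℂⁿ⁺¹ ∖ V(x₁, …, xₙ)` is
holomorphic along the orbit `q`. (The pullback is extended by `0` to `ℂⁿ⁺¹`.) -/
def Blowup.HolAt {n : ℕ} (w : Fin n → ℕ) (H : Blowup w → ℂ) (q : Blowup w) : Prop :=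
  ∀ p : BlowupCover n, Blowup.mk w p = q →
    AnalyticAt ℂ (Function.extend Subtype.val (H ∘ Blowup.mk w) 0) p.1

/-- The strict transform in `T` of an analytic subset `Z` of an open subset of `ℂⁿ`: the closure of
the preimage of `Z ∖ {0}`, taken over that open subset. -/
def strictTransform {n : ℕ} (w : Fin n → ℕ) (Z : Set (Fin n → ℂ)) : Set (Blowup w) :=
  closure (Blowup.proj w ⁻¹' (Z \ {0})) ∩ Blowup.proj w ⁻¹' Z

/-- The `w`-blowup of `Z` at the origin, restricted to the part over the open subset `Z ∩ U`. -/
def blowdown {n : ℕ} (w : Fin n → ℕ) (Z U : Set (Fin n → ℂ)) :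
    ↥(strictTransform w Z ∩ Blowup.proj w ⁻¹' U) → ↥(Z ∩ U) :=
  fun q => ⟨Blowup.proj w q.1, q.2.1.2, q.2.2⟩

/-- The `w`-blowup of `Z ⊆ ℂⁿ` and the `w'`-blowup of `Z' ⊆ ℂᵐ`, both at the origin, are locally
analytically equivalent. -/
def LocallyEquivalent {n m : ℕ} (w : Fin n → ℕ) (Z : Set (Fin n → ℂ))
    (w' : Fin m → ℕ) (Z' : Set (Fin m → ℂ)) : Prop :=
  ∃ (U : Set (Fin n → ℂ)) (U' : Set (Fin m → ℂ)), IsOpen U ∧ IsOpen U' ∧ 0 ∈ U ∧ 0 ∈ U' ∧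
    ∃ (e : ↥(Z ∩ U) ≃ₜ ↥(Z' ∩ U'))
      (E : ↥(strictTransform w Z ∩ Blowup.proj w ⁻¹' U) ≃ₜ
        ↥(strictTransform w' Z' ∩ Blowup.proj w' ⁻¹' U')),
      IsBiholomorphic (AnalyticAt ℂ) (AnalyticAt ℂ) e ∧
      IsBiholomorphic (Blowup.HolAt w) (Blowup.HolAt w') E ∧
      ∀ q, e (blowdown w Z U q) = blowdown w' Z' U' (E q)

/-- The power series `g` in four variables involves only `x₃` and `x₄`, i.e. `g ∈ ℂ[[x₃, x₄]]`. -/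
def OnlyLastTwo (g : MvPowerSeries (Fin 4) ℂ) : Prop :=
  ∀ m : Fin 4 →₀ ℕ, m 0 ≠ 0 ∨ m 1 ≠ 0 → MvPowerSeries.coeff m g = 0

/-- The `w`-blowup of `Z` at the origin is an `(r₁, r₂, a, 1)`-Kawakita blowup: it is locally
analytically equivalent to the `(r₁, r₂, a, 1)`-blowup of some `V(x₁ x₂ + g(x₃, x₄)) ⊆ ℂ⁴` with an
isolated singularity at the origin such that `a` divides `r₁ + r₂` and is coprime to `r₁` and `r₂`,
`g` has weight `r₁ + r₂`, and `x₃ ^ ((r₁ + r₂) / a)` appears in `g`. The last two conditions force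
`g` to have multiplicity `(r₁ + r₂) / a`, so this is a `cAₙ` singularity with `n + 1 = (r₁ + r₂) / a`;
`n ≥ 2` is required. -/
def IsKawakitaBlowup (r₁ r₂ a : ℕ) {n : ℕ} (w : Fin n → ℕ) (Z : Set (Fin n → ℂ)) : Prop :=
  0 < r₁ ∧ 0 < r₂ ∧ 0 < a ∧ a ∣ r₁ + r₂ ∧ Nat.Coprime a r₁ ∧ Nat.Coprime a r₂ ∧
  2 + 1 ≤ (r₁ + r₂) / a ∧
  ∃ g : MvPowerSeries (Fin 4) ℂ, IsConvergent g ∧ OnlyLastTwo g ∧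
    MvPowerSeries.weightedOrder ![r₁, r₂, a, 1] g = ((r₁ + r₂ : ℕ) : ℕ∞) ∧
    MvPowerSeries.coeff (Finsupp.single 2 ((r₁ + r₂) / a)) g ≠ 0 ∧
    IsIsolated (MvPowerSeries.X 0 * MvPowerSeries.X 1 + g) ∧
    LocallyEquivalent w Z ![r₁, r₂, a, 1]
      (zeroLocus (MvPowerSeries.X 0 * MvPowerSeries.X 1 + g))

end Kawakita

/-! In the code the coordinates `x₁, …, x₄` carry the indices `0, …, 3`, and `w = (r₁, r₂, a, 1)`.

Up to local equivalence, the `w`-blowup of `V(f)` depends only on `V(f)` modulo biholomorphic germs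
`ψ` whose `i`-th component has weight at least `w i`. Such a germ lifts to the blowup by `(u, x) ↦
(u, u⁻ʷ ψ(uʷ x))`, which extends analytically over `u = 0`, and its inverse is again of this kind
(`IsWeightMap.inv`, `BiholGerm.locallyEquivalent`). It therefore suffices to bring `f` to the form
`x₀ x₁ + g(x₂, x₃)` by weight-compatible coordinates.

From `n ≥ 2` and `r₂ ≤ r₁` one gets `3a ≤ r₁ + r₂ ≤ 2r₁`, so `a < r₁`. The weight of `f` then kills
every entry of the Hessian at `0` outside row `0`, column `0` and the entry `(1, 1)`. The `cAₙ`
condition makes the Hessian of rank at least two (`IsCA.not_degenerate`), so some `j ≠ 0` has a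
nonzero `(0, j)` minor. Such a `j` can be chosen of weight `r₂`, except when `r₂ < a` and `x₀ x₂`
occurs without `x₀ x₁` and `x₀ x₃`. In that case the auxiliary weights `(n, 1, 2, 1)` show that
splitting off `x₀ x₂` leaves a series of order at least `n + 2`, which is not `cAₙ`
(`IsCA.false_of_lt`). Otherwise a parametrised Morse lemma, each step of which respects the weights
(`exists_splitting`), gives `x₀ x₁ + G(x₂, x₃)`.

Every monomial of `G` has weight at least `(n + 1) a`, hence degree at least `n + 1`. The order of
`G` is exactly `n + 1` by `IsCA.not_order_ge`. A linear substitution adding a multiple of `x₂` to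
`x₃`, allowed since `1 ≤ a`, makes `x₂ ^ (n + 1)` appear (`exists_normal_form`).

The `Aₙ` hypothesis enters only through an inequality (`IsSurfaceA.exists_coord_bound`): in `Aₙ`
coordinates `y` of the section, `|y₀|`, `|y₁|` and `|y₂|ⁿ` are bounded by a multiple of the
gradient. -/

namespace Kawakita

/-! ### Words and monomials -/

/-- The exponent of the monomial spelled by a word in the variables. -/
noncomputable def wordContent {n k : ℕ} (s : Fin k → Fin n) : Fin n →₀ ℕ :=
  ∑ j, Finsupp.single (s j) 1

lemma prod_pow_add {n : ℕ} (x : Fin n → ℂ) (m m' : Fin n →₀ ℕ) :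
    ∏ i, x i ^ (m + m') i = (∏ i, x i ^ m i) * ∏ i, x i ^ m' i := by
  simp [pow_add, Finset.prod_mul_distrib]

lemma prod_pow_single {n : ℕ} (x : Fin n → ℂ) (i : Fin n) (k : ℕ) :
    ∏ j, x j ^ (Finsupp.single i k) j = x i ^ k := by
  rw [Finset.prod_eq_single i] <;> simp +contextual [eq_comm]

lemma prod_pow_wordContent {n k : ℕ} (x : Fin n → ℂ) (s : Fin k → Fin n) :
    ∏ i, x i ^ wordContent s i = ∏ j, x (s j) := by
  simp only [wordContent, Finsupp.finsetSum_apply, ← Finset.prod_pow_eq_pow_sum]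
  rw [Finset.prod_comm]
  refine Finset.prod_congr rfl fun j _ => ?_
  rw [prod_pow_single, pow_one]

lemma degree_wordContent {n k : ℕ} (s : Fin k → Fin n) : (wordContent s).degree = k := by
  simp [wordContent, map_sum]

lemma exists_wordContent_eq {n : ℕ} : ∀ (k : ℕ) (m : Fin n →₀ ℕ), m.degree = k →
    ∃ s : Fin k → Fin n, wordContent s = m
  | 0, m, h => ⟨Fin.elim0, by
      rw [Finsupp.degree_eq_zero_iff] at h
      simp [wordContent, h]⟩
  | k + 1, m, h => by
      have hm : m ≠ 0 := by rintro rfl; simp at h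
      obtain ⟨i, hi⟩ := Finsupp.ne_iff.mp hm
      obtain ⟨m', rfl⟩ : ∃ m', m = Finsupp.single i 1 + m' := by
        refine ⟨m - Finsupp.single i 1, (add_tsub_cancel_of_le ?_).symm⟩
        rw [Finsupp.single_le_iff]
        exact Nat.one_le_iff_ne_zero.mpr hi
      obtain ⟨s, rfl⟩ := exists_wordContent_eq k m' (by
        simp only [map_add, Finsupp.degree_single] at h; omega)
      exact ⟨Fin.cons i s, by simp [wordContent, Fin.sum_univ_succ]⟩

/-- The exponents of a given degree. -/
noncomputable def exponents (n k : ℕ) : Finset (Fin n →₀ ℕ) :=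
  Finset.univ.image (wordContent : (Fin k → Fin n) → _)

lemma mem_exponents {n k : ℕ} {m : Fin n →₀ ℕ} : m ∈ exponents n k ↔ m.degree = k := by
  simp only [exponents, Finset.mem_image, Finset.mem_univ, true_and]
  refine ⟨?_, exists_wordContent_eq k m⟩
  rintro ⟨s, rfl⟩
  exact degree_wordContent s

lemma coe_exponents (n k : ℕ) :
    (exponents n k : Set (Fin n →₀ ℕ)) = Finsupp.degree ⁻¹' {k} := by
  ext m; simp [mem_exponents]

lemma hasSum_exponents {n : ℕ} {E : Type*} [AddCommGroup E] [UniformSpace E]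
    [IsUniformAddGroup E] [CompleteSpace E] [T2Space E]
    {u : (Fin n →₀ ℕ) → E} {v : E} (h : HasSum u v) :
    HasSum (fun k => ∑ m ∈ exponents n k, u m) v := by
  have := h.tsum_fiberwise Finsupp.degree
  convert! this using 2 with k
  rw [← coe_exponents]
  exact (Finset.tsum_subtype' (exponents n k) u).symm

lemma summable_of_exponents {n : ℕ} {u : (Fin n →₀ ℕ) → ℝ} (hu : ∀ m, 0 ≤ u m)
    (h : Summable fun k => ∑ m ∈ exponents n k, u m) : Summable u := by
  refine (summable_partition (s := fun k => (exponents n k : Set (Fin n →₀ ℕ))) hu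
    (fun m => ⟨m.degree, mem_exponents.mpr rfl, fun k hk => (mem_exponents.mp hk).symm⟩)).mpr
    ⟨fun k => ?_, ?_⟩
  · exact (exponents n k).summable u
  · refine h.congr fun k => ?_
    exact (Finset.tsum_subtype' (exponents n k) u).symm

/-! ### Convergent series and analytic germs -/

lemma norm_term_le {n : ℕ} (f : MvPowerSeries (Fin n) ℂ) {x : Fin n → ℂ} {ρ : ℝ}
    (hx : ‖x‖ ≤ ρ) (m : Fin n →₀ ℕ) :
    ‖term f x m‖ ≤ ‖MvPowerSeries.coeff m f‖ * ρ ^ m.degree := by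
  rw [term, norm_mul, norm_prod, Finsupp.degree_eq_sum, ← Finset.prod_pow_eq_pow_sum]
  gcongr with i
  rw [norm_pow]
  gcongr
  exact (norm_le_pi_norm x i).trans hx

/-- Summability in `ℂ` is absolute, so convergence at one diagonal point `(ρ, …, ρ)` with `ρ > 0` is
already the required bound. -/
lemma IsConvergent.exists_summable {n : ℕ} {f : MvPowerSeries (Fin n) ℂ} (hf : IsConvergent f) :
    ∃ ρ : ℝ, 0 < ρ ∧ Summable fun m => ‖MvPowerSeries.coeff m f‖ * ρ ^ m.degree := by
  have hc : Tendsto (fun t : ℝ => fun _ : Fin n => (t : ℂ)) (𝓝[>] 0) (𝓝 0) := by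
    have : ContinuousAt (fun t : ℝ => fun _ : Fin n => (t : ℂ)) 0 := by fun_prop
    have h2 := this.tendsto
    simp only [Complex.ofReal_zero] at h2
    exact h2.mono_left nhdsWithin_le_nhds
  obtain ⟨ρ, hs, hρ⟩ := ((hc.eventually hf).and self_mem_nhdsWithin).exists
  refine ⟨ρ, hρ, ?_⟩
  refine hs.norm.congr fun m => ?_
  rw [term, norm_mul, Finset.prod_pow_eq_pow_sum, ← Finsupp.degree_eq_sum, norm_pow,
    Complex.norm_real, Real.norm_of_nonneg (le_of_lt hρ)]

lemma isConvergent_of_summable {n : ℕ} {f : MvPowerSeries (Fin n) ℂ} {ρ : ℝ} (hρ : 0 < ρ)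
    (h : Summable fun m => ‖MvPowerSeries.coeff m f‖ * ρ ^ m.degree) : IsConvergent f := by
  filter_upwards [Metric.closedBall_mem_nhds (0 : Fin n → ℂ) hρ] with x hx
  exact Summable.of_norm_bounded h (norm_term_le f (by simpa using hx))

/-- A monomial as a multilinear map. -/
noncomputable def wordMultilinear {n k : ℕ} (s : Fin k → Fin n) :
    ContinuousMultilinearMap ℂ (fun _ : Fin k => Fin n → ℂ) ℂ :=
  (ContinuousMultilinearMap.mkPiAlgebra ℂ (Fin k) ℂ).compContinuousLinearMap
    fun j => ContinuousLinearMap.proj (s j)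

lemma wordMultilinear_apply {n k : ℕ} (s : Fin k → Fin n) (x : Fin n → ℂ) :
    wordMultilinear s (fun _ => x) = ∏ i, x i ^ wordContent s i := by
  simp [wordMultilinear, prod_pow_wordContent]

lemma norm_wordMultilinear_le {n k : ℕ} (s : Fin k → Fin n) : ‖wordMultilinear s‖ ≤ 1 := by
  refine (ContinuousMultilinearMap.norm_compContinuousLinearMap_le _ _).trans ?_
  rw [ContinuousMultilinearMap.norm_mkPiAlgebra, one_mul]
  refine Finset.prod_le_one (fun _ _ => norm_nonneg _) fun j _ => ?_
  exact ContinuousLinearMap.opNorm_le_bound _ zero_le_one fun x => by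
    simpa using norm_le_pi_norm x (s j)

lemma analyticAt_value {n : ℕ} {f : MvPowerSeries (Fin n) ℂ} (hf : IsConvergent f) :
    AnalyticAt ℂ (value f) 0 := by
  obtain ⟨ρ, hρ, hs⟩ := hf.exists_summable
  have hw : ∀ k (m : exponents n k), ∃ s : Fin k → Fin n, wordContent s = m.1 :=
    fun k m => exists_wordContent_eq k m.1 (mem_exponents.mp m.2)
  -- One spelling per exponent is enough: the multilinear maps need not be symmetric, only correct
  -- on the diagonal.
  choose s hs' using hw
  let p : FormalMultilinearSeries ℂ (Fin n → ℂ) ℂ := fun k =>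
    ∑ m : exponents n k, MvPowerSeries.coeff m.1 f • wordMultilinear (s k m)
  have hp : ∀ k (x : Fin n → ℂ), p k (fun _ => x) = ∑ m ∈ exponents n k, term f x m := by
    intro k x
    rw [← Finset.sum_coe_sort]
    simp only [p, sum_apply, smul_apply,
      wordMultilinear_apply, hs', smul_eq_mul, term]
  have hpn : ∀ k, ‖p k‖ ≤ ∑ m ∈ exponents n k, ‖MvPowerSeries.coeff m f‖ := by
    intro k
    rw [← Finset.sum_coe_sort]
    refine (norm_sum_le _ _).trans (Finset.sum_le_sum fun m _ => ?_)
    rw [norm_smul]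
    exact mul_le_of_le_one_right (norm_nonneg _) (norm_wordMultilinear_le _)
  lift ρ to NNReal using hρ.le
  refine ⟨p, ρ, ?_, by simpa using hρ, ?_⟩
  · refine p.le_radius_of_summable ?_
    refine Summable.of_nonneg_of_le (fun k => by positivity) (fun k => ?_)
      (hasSum_exponents hs.hasSum).summable
    calc ‖p k‖ * (ρ : ℝ) ^ k ≤ (∑ m ∈ exponents n k, ‖MvPowerSeries.coeff m f‖) * (ρ : ℝ) ^ k := by
          gcongr; exact hpn k
      _ = _ := by
          rw [Finset.sum_mul]
          exact Finset.sum_congr rfl fun m hm => by rw [mem_exponents.mp hm]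
  · intro y hy
    simp only [hp, zero_add]
    refine hasSum_exponents (Summable.hasSum ?_)
    refine Summable.of_norm_bounded hs (norm_term_le f ?_)
    simp only [Metric.mem_eball, edist_zero_right] at hy
    have := ENNReal.toReal_mono (by simp) hy.le
    simpa using this

lemma IsConvergent.eventually_hasSum {n : ℕ} {f : MvPowerSeries (Fin n) ℂ} (hf : IsConvergent f) :
    ∀ᶠ x in 𝓝 0, HasSum (term f x) (value f x) :=
  Filter.Eventually.mono hf fun _ hx => hx.hasSum

lemma exists_series {n : ℕ} {F : (Fin n → ℂ) → ℂ} (hF : AnalyticAt ℂ F 0) :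
    ∃ f : MvPowerSeries (Fin n) ℂ, IsConvergent f ∧ value f =ᶠ[𝓝 0] F := by
  obtain ⟨p, r, hp⟩ := hF
  let e : Fin n → Fin n → ℂ := fun i => Pi.single i 1
  -- Expanding `p k (x, …, x)` in the standard basis gives one term per word. Words with the same
  -- content contribute to the same monomial.
  let f : MvPowerSeries (Fin n) ℂ := fun m =>
    ∑ s : Fin m.degree → Fin n with wordContent s = m, p m.degree (fun j => e (s j))
  have hf : ∀ k, ∀ m ∈ exponents n k, MvPowerSeries.coeff m f =
      ∑ s : Fin k → Fin n with wordContent s = m, p k (fun j => e (s j)) := by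
    intro k m hm
    obtain rfl := mem_exponents.mp hm
    rfl
  have hmaps : ∀ k, ∀ s ∈ (Finset.univ : Finset (Fin k → Fin n)), wordContent s ∈ exponents n k :=
    fun k s _ => mem_exponents.mpr (degree_wordContent s)
  have hpk : ∀ k x, p k (fun _ => x) = ∑ m ∈ exponents n k, term f x m := by
    intro k x
    have hx : x = ∑ i, x i • e i := by
      ext j; simp [e, Pi.single_apply]
    conv_lhs => rw [hx]
    rw [ContinuousMultilinearMap.map_sum, ← Finset.sum_fiberwise_of_maps_to (hmaps k)]
    refine Finset.sum_congr rfl fun m hm => ?_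
    rw [term, hf k m hm, Finset.sum_mul]
    refine Finset.sum_congr rfl fun s hs => ?_
    rw [ContinuousMultilinearMap.map_smul_univ, ← (Finset.mem_filter.mp hs).2,
      prod_pow_wordContent, smul_eq_mul, mul_comm]
  have hbound : ∀ k, ∑ m ∈ exponents n k, ‖MvPowerSeries.coeff m f‖ ≤ (n : ℝ) ^ k * ‖p k‖ := by
    intro k
    calc ∑ m ∈ exponents n k, ‖MvPowerSeries.coeff m f‖
        ≤ ∑ m ∈ exponents n k, ∑ s : Fin k → Fin n with wordContent s = m,
            ‖p k (fun j => e (s j))‖ := by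
          refine Finset.sum_le_sum fun m hm => ?_
          rw [hf k m hm]; exact norm_sum_le _ _
      _ = ∑ s : Fin k → Fin n, ‖p k (fun j => e (s j))‖ :=
          Finset.sum_fiberwise_of_maps_to (hmaps k) _
      _ ≤ ∑ s : Fin k → Fin n, ‖p k‖ := by
          refine Finset.sum_le_sum fun s _ => ((p k).le_opNorm _).trans ?_
          refine mul_le_of_le_one_right (norm_nonneg _) (Finset.prod_le_one
            (fun _ _ => norm_nonneg _) fun j _ => ?_)
          simp [e, Pi.norm_single]
      _ = _ := by simp
  -- There are `n ^ k` words of length `k`, so passing from norms of `p k` to coefficients costs a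
  -- factor `n` in the radius. Dividing by `n + 1` also covers `n = 0`.
  obtain ⟨ρ, hρ0, hρ⟩ : ∃ ρ : NNReal, 0 < ρ ∧ ((n : NNReal) * ρ : NNReal) < r := by
    obtain ⟨σ, hσ0, hσ⟩ := ENNReal.lt_iff_exists_nnreal_btwn.mp hp.r_pos
    refine ⟨σ / (n + 1), div_pos (by simpa using hσ0) (by positivity), lt_of_le_of_lt ?_ hσ⟩
    rw [ENNReal.coe_le_coe, mul_div_assoc', div_le_iff₀ (by positivity), mul_comm]
    gcongr
    simp
  have hsum : Summable fun m => ‖MvPowerSeries.coeff m f‖ * (ρ : ℝ) ^ m.degree := by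
    have h1 := p.summable_norm_mul_pow (hρ.trans_le hp.r_le)
    refine summable_of_exponents (fun m => by positivity)
      (Summable.of_nonneg_of_le (fun k => by positivity) (fun k => ?_) h1)
    calc ∑ m ∈ exponents n k, ‖MvPowerSeries.coeff m f‖ * (ρ : ℝ) ^ m.degree
        = (∑ m ∈ exponents n k, ‖MvPowerSeries.coeff m f‖) * (ρ : ℝ) ^ k := by
          rw [Finset.sum_mul]
          exact Finset.sum_congr rfl fun m hm => by rw [mem_exponents.mp hm]
      _ ≤ ((n : ℝ) ^ k * ‖p k‖) * (ρ : ℝ) ^ k := by gcongr; exact hbound k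
      _ = _ := by push_cast; ring
  have hconv : IsConvergent f := isConvergent_of_summable (by exact_mod_cast hρ0) hsum
  refine ⟨f, hconv, ?_⟩
  filter_upwards [hconv, Metric.eball_mem_nhds (0 : Fin n → ℂ) hp.r_pos] with x hx hxr
  have h1 := hasSum_exponents hx.hasSum
  have h2 := hp.hasSum hxr
  simp only [hpk, zero_add] at h2
  exact h1.unique h2

/-! ### Division by a coordinate and uniqueness of the series -/

lemma frequently_coord_ne {N : ℕ} (i : Fin N) (x : Fin N → ℂ) : ∃ᶠ y in 𝓝 x, y i ≠ 0 := by
  have hc : Tendsto (fun t : ℂ => x + t • (Pi.single i 1 : Fin N → ℂ)) (𝓝 0) (𝓝 x) := by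
    have : Continuous (fun t : ℂ => x + t • (Pi.single i 1 : Fin N → ℂ)) := by fun_prop
    simpa using this.tendsto 0
  intro h
  have h2 := hc.eventually h
  simp only [ne_eq, not_not, Pi.add_apply, Pi.smul_apply, Pi.single_eq_same, smul_eq_mul,
    mul_one] at h2
  have h3 : ∀ᶠ t : ℂ in 𝓝[≠] 0, x i + t = 0 ∧ t ≠ 0 :=
    (h2.filter_mono nhdsWithin_le_nhds).and self_mem_nhdsWithin
  have h4 : x i = 0 := by simpa using h2.self_of_nhds
  obtain ⟨t, ht, ht0⟩ := h3.exists
  rw [h4, zero_add] at ht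
  exact ht0 ht

lemma eq_of_frequently_eq {X Y : Type*} [TopologicalSpace X] [TopologicalSpace Y] [T2Space Y]
    {F G : X → Y} {x : X} (hF : ContinuousAt F x) (hG : ContinuousAt G x)
    (h : ∃ᶠ y in 𝓝 x, F y = G y) : F x = G x := by
  by_contra hne
  exact h ((hF.prodMk hG).eventually ((isClosed_diagonal.isOpen_compl).mem_nhds hne))

/-- Two analytic germs agreeing off a coordinate hyperplane agree. -/
lemma eventuallyEq_of_coord_ne {N : ℕ} {E : Type*} [NormedAddCommGroup E] [NormedSpace ℂ E]
    [CompleteSpace E] (i : Fin N) {F G : (Fin N → ℂ) → E}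
    {a : Fin N → ℂ} (hF : AnalyticAt ℂ F a) (hG : AnalyticAt ℂ G a)
    (h : ∀ᶠ x in 𝓝 a, x i ≠ 0 → F x = G x) : F =ᶠ[𝓝 a] G := by
  filter_upwards [hF.eventually_analyticAt, hG.eventually_analyticAt, h.eventually_nhds]
    with x hFx hGx hx
  exact eq_of_frequently_eq hFx.continuousAt hGx.continuousAt
    ((frequently_coord_ne i x).mp (hx.mono fun y hy hne => hy hne))

/-- The quotient by `X i` of the part of a series divisible by `X i`. -/
noncomputable def divCoord {n : ℕ} (i : Fin n) (f : MvPowerSeries (Fin n) ℂ) :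
    MvPowerSeries (Fin n) ℂ :=
  fun m => MvPowerSeries.coeff (m + Finsupp.single i 1) f

lemma coeff_divCoord {n : ℕ} (i : Fin n) (f : MvPowerSeries (Fin n) ℂ) (m : Fin n →₀ ℕ) :
    MvPowerSeries.coeff m (divCoord i f) = MvPowerSeries.coeff (m + Finsupp.single i 1) f := rfl

lemma isConvergent_divCoord {n : ℕ} (i : Fin n) {f : MvPowerSeries (Fin n) ℂ}
    (hf : IsConvergent f) : IsConvergent (divCoord i f) := by
  obtain ⟨ρ, hρ, hs⟩ := hf.exists_summable
  refine isConvergent_of_summable hρ ?_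
  have h1 := (hs.comp_injective (add_left_injective (Finsupp.single i 1))).mul_left ρ⁻¹
  refine h1.congr fun m => ?_
  simp only [Function.comp_apply, coeff_divCoord, map_add, Finsupp.degree_single, pow_add, pow_one]
  field_simp

/-- The part of a series consisting of the terms whose exponents satisfy `P`. -/
noncomputable def part {n : ℕ} (P : (Fin n →₀ ℕ) → Prop) (f : MvPowerSeries (Fin n) ℂ) :
    MvPowerSeries (Fin n) ℂ :=
  open Classical in fun m => if P m then MvPowerSeries.coeff m f else 0

open Classical in
lemma coeff_part {n : ℕ} (P : (Fin n →₀ ℕ) → Prop) (f : MvPowerSeries (Fin n) ℂ)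
    (m : Fin n →₀ ℕ) :
    MvPowerSeries.coeff m (part P f) = if P m then MvPowerSeries.coeff m f else 0 := rfl

open Classical in
lemma term_part {n : ℕ} (P : (Fin n →₀ ℕ) → Prop) (f : MvPowerSeries (Fin n) ℂ)
    (x : Fin n → ℂ) (m : Fin n →₀ ℕ) :
    term (part P f) x m = if P m then term f x m else 0 := by
  simp only [term, coeff_part, ite_mul, zero_mul]

lemma isConvergent_part {n : ℕ} (P : (Fin n →₀ ℕ) → Prop) {f : MvPowerSeries (Fin n) ℂ}
    (hf : IsConvergent f) : IsConvergent (part P f) := by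
  classical
  refine Filter.Eventually.mono hf fun x hx => Summable.of_norm_bounded hx.norm fun m => ?_
  rw [term_part]
  split_ifs <;> simp

lemma term_update_zero {n : ℕ} (i : Fin n) (f : MvPowerSeries (Fin n) ℂ) (x : Fin n → ℂ) :
    term f (Function.update x i 0) = term (part (fun m => m i = 0) f) x := by
  classical
  ext m
  rw [term_part]
  simp only [term]
  split_ifs with h
  · congr 1
    refine Finset.prod_congr rfl fun j _ => ?_
    rcases eq_or_ne j i with rfl | hj
    · simp [h]
    · simp [hj]
  · rw [Finset.prod_eq_zero (Finset.mem_univ i) (by simp [h]), mul_zero]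

lemma value_update_zero {n : ℕ} (i : Fin n) (f : MvPowerSeries (Fin n) ℂ) (x : Fin n → ℂ) :
    value f (Function.update x i 0) = value (part (fun m => m i = 0) f) x := by
  rw [value, term_update_zero, value]

/-- The terms are sorted according to whether `x i` occurs. Those containing it are reindexed by
removing one factor. -/
lemma value_eq_add_coord_mul {n : ℕ} (i : Fin n) {f : MvPowerSeries (Fin n) ℂ}
    (hf : IsConvergent f) :
    ∀ᶠ x in 𝓝 0, value f x =
      value f (Function.update x i 0) + x i * value (divCoord i f) x := by
  classical
  filter_upwards [hf, (isConvergent_divCoord i hf).eventually_hasSum,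
    (isConvergent_part (fun m => m i = 0) hf).eventually_hasSum] with x h1 h2 h3
  rw [value_update_zero]
  refine h1.hasSum.unique ?_
  have h4 : HasSum (fun m => if m i = 0 then 0 else term f x m)
      (x i * value (divCoord i f) x) := by
    rw [← Function.Injective.hasSum_iff (add_left_injective (Finsupp.single i 1))]
    · convert! h2.mul_left (x i) using 2 with m
      simp only [Function.comp_apply, term, coeff_divCoord, prod_pow_add, prod_pow_single]
      simp
      ring
    · intro m hm
      by_cases hmi : m i = 0
      · simp [hmi]
      · exact absurd ⟨m - Finsupp.single i 1, tsub_add_cancel_of_le (by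
          rw [Finsupp.single_le_iff]; exact Nat.one_le_iff_ne_zero.mpr hmi)⟩ hm
  convert! h3.add h4 using 2 with m
  rw [term_part]
  split_ifs <;> simp

lemma value_zero {n : ℕ} (f : MvPowerSeries (Fin n) ℂ) :
    value f 0 = MvPowerSeries.coeff 0 f := by
  rw [value, tsum_eq_single 0]
  · simp [term]
  · intro m hm
    obtain ⟨i, hi⟩ := Finsupp.ne_iff.mp hm
    rw [term, Finset.prod_eq_zero (Finset.mem_univ i), mul_zero]
    simpa using hi

lemma tendsto_update_zero {N : ℕ} (i : Fin N) :
    Tendsto (fun x : Fin N → ℂ => Function.update x i 0) (𝓝 0) (𝓝 0) := by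
  have : Continuous (fun x : Fin N → ℂ => Function.update x i 0) :=
    continuous_id.update i continuous_const
  simpa using this.tendsto 0

lemma value_divCoord_eventuallyEq {n : ℕ} (i : Fin n) {f : MvPowerSeries (Fin n) ℂ}
    (hf : IsConvergent f) {H : (Fin n → ℂ) → ℂ} (hH : AnalyticAt ℂ H 0)
    (h : ∀ᶠ x in 𝓝 0, value f x = x i * H x) :
    value (divCoord i f) =ᶠ[𝓝 0] H := by
  refine eventuallyEq_of_coord_ne i (analyticAt_value (isConvergent_divCoord i hf)) hH ?_
  filter_upwards [h, (tendsto_update_zero i).eventually h, value_eq_add_coord_mul i hf]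
    with x h1 h2 h3 hx
  simp only [Function.update_self, zero_mul] at h2
  rw [h2, zero_add, h1] at h3
  exact (mul_left_cancel₀ hx h3).symm

/-- Induction on the degree: the constant coefficient is the value at `0`, and for `m ≠ 0` one
divides by a coordinate occurring in `m`, the quotient again being the zero germ. -/
lemma coeff_eq_zero_of_value_eventuallyEq_zero {n : ℕ} : ∀ (k : ℕ) (f : MvPowerSeries (Fin n) ℂ),
    IsConvergent f → value f =ᶠ[𝓝 0] 0 → ∀ m : Fin n →₀ ℕ, m.degree = k →
    MvPowerSeries.coeff m f = 0
  | 0, f, hf, h, m, hm => by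
      rw [Finsupp.degree_eq_zero_iff] at hm
      rw [hm, ← value_zero]
      exact h.self_of_nhds
  | k + 1, f, hf, h, m, hm => by
      have hm0 : m ≠ 0 := by rintro rfl; simp at hm
      obtain ⟨i, hi⟩ := Finsupp.ne_iff.mp hm0
      obtain ⟨m', rfl⟩ : ∃ m', m = m' + Finsupp.single i 1 :=
        ⟨m - Finsupp.single i 1, (tsub_add_cancel_of_le (by
          rw [Finsupp.single_le_iff]; exact Nat.one_le_iff_ne_zero.mpr hi)).symm⟩
      rw [← coeff_divCoord]
      refine coeff_eq_zero_of_value_eventuallyEq_zero k _ (isConvergent_divCoord i hf)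
        (value_divCoord_eventuallyEq i hf analyticAt_const (by simpa using! h)) m' ?_
      simpa using hm

lemma eq_zero_of_value_eventuallyEq_zero {n : ℕ} {f : MvPowerSeries (Fin n) ℂ}
    (hf : IsConvergent f) (h : value f =ᶠ[𝓝 0] 0) : f = 0 := by
  ext m
  exact coeff_eq_zero_of_value_eventuallyEq_zero _ f hf h m rfl

/-- One factor `x i` is removed at a time. Vanishing on the hyperplane `x i = 0` accounts for the
exponents with `m i = 0`, and `divCoord` shifts the others down by one. -/
lemma coord_pow_dvd_iff {N : ℕ} (i : Fin N) (k : ℕ) : ∀ {f : MvPowerSeries (Fin N) ℂ},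
    IsConvergent f → ((∃ H : (Fin N → ℂ) → ℂ, AnalyticAt ℂ H 0 ∧
      ∀ᶠ x in 𝓝 0, value f x = x i ^ k * H x) ↔
      ∀ m : Fin N →₀ ℕ, m i < k → MvPowerSeries.coeff m f = 0) := by
  induction k with
  | zero =>
    intro f hf
    simp only [pow_zero, one_mul, not_lt_zero, false_imp_iff, implies_true, iff_true]
    exact ⟨value f, analyticAt_value hf, .of_forall fun _ => rfl⟩
  | succ k ih =>
    intro f hf
    have hz : (∀ᶠ x in 𝓝 0, value f (Function.update x i 0) = 0) ↔
        ∀ m : Fin N →₀ ℕ, m i = 0 → MvPowerSeries.coeff m f = 0 := by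
      classical
      simp only [value_update_zero]
      constructor
      · intro h m hm
        have := eq_zero_of_value_eventuallyEq_zero (isConvergent_part _ hf) h
        have h2 := congrArg (MvPowerSeries.coeff m) this
        simpa [coeff_part, hm] using h2
      · intro h
        have : part (fun m => m i = 0) f = 0 := by
          ext m
          simpa [coeff_part] using h m
        simp [this, value, term]
    have hd := ih (isConvergent_divCoord i hf)
    constructor
    · rintro ⟨H, hH, h⟩ m hm
      have h0 : ∀ᶠ x in 𝓝 0, value f (Function.update x i 0) = 0 := by
        filter_upwards [(tendsto_update_zero i).eventually h] with x hx
        simpa using hx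
      rcases Nat.eq_zero_or_pos (m i) with hmi | hmi
      · exact hz.mp h0 m hmi
      · obtain ⟨m', rfl⟩ : ∃ m', m = m' + Finsupp.single i 1 :=
          ⟨m - Finsupp.single i 1, (tsub_add_cancel_of_le (by
            rw [Finsupp.single_le_iff]; exact hmi)).symm⟩
        rw [← coeff_divCoord]
        refine hd.mp ⟨H, hH, ?_⟩ m' (by simpa using hm)
        refine value_divCoord_eventuallyEq i hf (H := fun x => x i ^ k * H x) ?_ ?_
        · exact (AnalyticAt.pow ((ContinuousLinearMap.proj (R := ℂ) i).analyticAt 0) k).mul hH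
        · filter_upwards [h] with x hx
          rw [hx, pow_succ]; ring
    · intro h
      obtain ⟨H, hH, h1⟩ := hd.mpr fun m hm => by
        rw [coeff_divCoord]
        exact h _ (by simpa using hm)
      refine ⟨H, hH, ?_⟩
      filter_upwards [h1, hz.mpr fun m hm => h m (by omega), value_eq_add_coord_mul i hf]
        with x h1 h2 h3
      rw [h3, h2, h1, pow_succ]; ring

/-! ### Weights of analytic germs -/

/-- The map `(u, x) ↦ (u ^ w₁ x₁, …, u ^ wₙ xₙ)`. -/
def dilate {n : ℕ} (w : Fin n → ℕ) (p : Fin (n + 1) → ℂ) : Fin n → ℂ :=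
  fun i => p 0 ^ w i * p i.succ

lemma analyticAt_coord {N : ℕ} (i : Fin N) (a : Fin N → ℂ) :
    AnalyticAt ℂ (fun x : Fin N → ℂ => x i) a :=
  (ContinuousLinearMap.proj (R := ℂ) (φ := fun _ : Fin N => ℂ) i).analyticAt a

lemma analyticAt_dilate {n : ℕ} (w : Fin n → ℕ) (p : Fin (n + 1) → ℂ) :
    AnalyticAt ℂ (dilate w) p :=
  AnalyticAt.pi fun i => ((analyticAt_coord 0 p).pow _).mul (analyticAt_coord i.succ p)

lemma dilate_zero {n : ℕ} (w : Fin n → ℕ) : dilate w 0 = 0 := by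
  ext i; simp [dilate]

lemma tendsto_dilate {n : ℕ} (w : Fin n → ℕ) : Tendsto (dilate w) (𝓝 0) (𝓝 0) := by
  simpa [dilate_zero] using (analyticAt_dilate w 0).continuousAt.tendsto

/-- The analytic germ `F` has `w`-weight at least `k`. -/
def HasWeight {n : ℕ} (w : Fin n → ℕ) (k : ℕ) (F : (Fin n → ℂ) → ℂ) : Prop :=
  ∃ H : (Fin (n + 1) → ℂ) → ℂ, AnalyticAt ℂ H 0 ∧
    ∀ᶠ p in 𝓝 0, F (dilate w p) = p 0 ^ k * H p

open Classical in
/-- The series in `u, x` obtained from `f` by the substitution `x ↦ (u ^ w₁ x₁, …, u ^ wₙ xₙ)`. -/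
noncomputable def dilateSeries {n : ℕ} (w : Fin n → ℕ) (f : MvPowerSeries (Fin n) ℂ) :
    MvPowerSeries (Fin (n + 1)) ℂ :=
  fun M => if M 0 = Finsupp.weight w M.tail then MvPowerSeries.coeff M.tail f else 0

open Classical in
lemma coeff_dilateSeries {n : ℕ} (w : Fin n → ℕ) (f : MvPowerSeries (Fin n) ℂ)
    (M : Fin (n + 1) →₀ ℕ) :
    MvPowerSeries.coeff M (dilateSeries w f) =
      if M 0 = Finsupp.weight w M.tail then MvPowerSeries.coeff M.tail f else 0 := rfl

/-- Substitution turns the monomial `x ^ m` into `u ^ (weight m) x ^ m`. The map `m ↦ (weight m, m)`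
is injective and its range carries all nonzero coefficients, so the two families of terms agree up
to zeros. -/
lemma hasSum_dilateSeries_iff {n : ℕ} (w : Fin n → ℕ) (f : MvPowerSeries (Fin n) ℂ)
    (p : Fin (n + 1) → ℂ) (v : ℂ) :
    HasSum (term (dilateSeries w f) p) v ↔ HasSum (term f (dilate w p)) v := by
  have hinj : Function.Injective fun m : Fin n →₀ ℕ => Finsupp.cons (Finsupp.weight w m) m := by
    intro m m' h
    simpa using congrArg Finsupp.tail h
  rw [← hinj.hasSum_iff]
  · have : term (dilateSeries w f) p ∘ (fun m : Fin n →₀ ℕ => Finsupp.cons (Finsupp.weight w m) m)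
        = term f (dilate w p) := by
      ext m
      simp only [Function.comp_apply, term, coeff_dilateSeries, Finsupp.cons_zero,
        Finsupp.tail_cons, if_true, Fin.prod_univ_succ, Finsupp.cons_succ, dilate, mul_pow,
        Finset.prod_mul_distrib]
      rw [Finsupp.weight_apply, Finsupp.sum_fintype _ _ (by simp), ← Finset.prod_pow_eq_pow_sum]
      simp only [← pow_mul, smul_eq_mul, mul_comm (w _)]
    rw [this]
  · intro M hM
    rw [term, coeff_dilateSeries, if_neg, zero_mul]
    intro h
    exact hM ⟨M.tail, by simp only [← h]; exact Finsupp.cons_tail M⟩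

lemma isConvergent_dilateSeries {n : ℕ} (w : Fin n → ℕ) {f : MvPowerSeries (Fin n) ℂ}
    (hf : IsConvergent f) : IsConvergent (dilateSeries w f) :=
  ((tendsto_dilate w).eventually hf).mono fun p hp =>
    ((hasSum_dilateSeries_iff w f p _).mpr hp.hasSum).summable

lemma value_dilateSeries {n : ℕ} (w : Fin n → ℕ) {f : MvPowerSeries (Fin n) ℂ}
    (hf : IsConvergent f) : ∀ᶠ p in 𝓝 0, value (dilateSeries w f) p = value f (dilate w p) :=
  ((tendsto_dilate w).eventually hf).mono fun p hp =>
    ((hasSum_dilateSeries_iff w f p _).mpr hp.hasSum).tsum_eq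

/-- The bridge between coefficients and germs. `HasWeight` is divisibility by `u ^ k` after
dilation, a form that behaves well under products, derivatives and composition. -/
lemma hasWeight_value_iff {n : ℕ} (w : Fin n → ℕ) (k : ℕ) {f : MvPowerSeries (Fin n) ℂ}
    (hf : IsConvergent f) : HasWeight w k (value f) ↔
      ∀ m : Fin n →₀ ℕ, Finsupp.weight w m < k → MvPowerSeries.coeff m f = 0 := by
  have h := coord_pow_dvd_iff 0 k (isConvergent_dilateSeries w hf)
  have h2 : HasWeight w k (value f) ↔ ∃ H : (Fin (n + 1) → ℂ) → ℂ, AnalyticAt ℂ H 0 ∧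
      ∀ᶠ x in 𝓝 0, value (dilateSeries w f) x = x 0 ^ k * H x := by
    refine exists_congr fun H => and_congr_right fun _ => ?_
    exact eventually_congr ((value_dilateSeries w hf).mono fun p hp => by rw [hp])
  rw [h2, h]
  constructor
  · intro h m hm
    have := h (Finsupp.cons (Finsupp.weight w m) m) (by simpa using hm)
    simpa [coeff_dilateSeries] using this
  · intro h M hM
    rw [coeff_dilateSeries]
    split_ifs with h'
    · exact h _ (h' ▸ hM)
    · rfl

/-! ### Partial derivatives -/

/-- The partial derivative with respect to the `i`-th coordinate. -/
noncomputable def pderiv {n : ℕ} (i : Fin n) (F : (Fin n → ℂ) → ℂ) (x : Fin n → ℂ) : ℂ :=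
  lineDeriv ℂ F x (Pi.single i 1)

lemma pderiv_eq_fderiv {n : ℕ} (i : Fin n) {F : (Fin n → ℂ) → ℂ} {x : Fin n → ℂ}
    (hF : DifferentiableAt ℂ F x) : pderiv i F x = fderiv ℂ F x (Pi.single i 1) :=
  hF.lineDeriv_eq_fderiv

lemma fderiv_apply_eq_sum_pderiv {n : ℕ} {F : (Fin n → ℂ) → ℂ} {x : Fin n → ℂ}
    (hF : DifferentiableAt ℂ F x) (v : Fin n → ℂ) :
    fderiv ℂ F x v = ∑ i, v i * pderiv i F x := by
  have hv : v = ∑ i, v i • (Pi.single i 1 : Fin n → ℂ) := by ext j; simp [Pi.single_apply]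
  conv_lhs => rw [hv]
  simp [pderiv_eq_fderiv _ hF]

lemma pderiv_congr {n : ℕ} (i : Fin n) {F G : (Fin n → ℂ) → ℂ} {a : Fin n → ℂ}
    (h : F =ᶠ[𝓝 a] G) : pderiv i F =ᶠ[𝓝 a] pderiv i G :=
  h.eventually_nhds.mono fun _ hx => Filter.EventuallyEq.lineDeriv_eq hx

lemma analyticAt_pderiv {n : ℕ} (i : Fin n) {F : (Fin n → ℂ) → ℂ} {a : Fin n → ℂ}
    (hF : AnalyticAt ℂ F a) : AnalyticAt ℂ (pderiv i F) a := by
  have h1 : AnalyticAt ℂ (fun x => fderiv ℂ F x (Pi.single i 1)) a :=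
    ((ContinuousLinearMap.apply ℂ ℂ (Pi.single i 1 : Fin n → ℂ)).analyticAt _).comp hF.fderiv
  exact h1.congr (hF.eventually_analyticAt.mono fun x hx =>
    (pderiv_eq_fderiv i hx.differentiableAt).symm)

lemma pderiv_add {n : ℕ} (i : Fin n) {F G : (Fin n → ℂ) → ℂ} {x : Fin n → ℂ}
    (hF : DifferentiableAt ℂ F x) (hG : DifferentiableAt ℂ G x) :
    pderiv i (fun y => F y + G y) x = pderiv i F x + pderiv i G x := by
  rw [pderiv_eq_fderiv i (hF.fun_add hG), pderiv_eq_fderiv i hF, pderiv_eq_fderiv i hG,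
    fderiv_fun_add hF hG]
  rfl

lemma pderiv_mul {n : ℕ} (i : Fin n) {F G : (Fin n → ℂ) → ℂ} {x : Fin n → ℂ}
    (hF : DifferentiableAt ℂ F x) (hG : DifferentiableAt ℂ G x) :
    pderiv i (fun y => F y * G y) x = F x * pderiv i G x + pderiv i F x * G x := by
  rw [pderiv_eq_fderiv i (hF.fun_mul hG), pderiv_eq_fderiv i hF, pderiv_eq_fderiv i hG,
    fderiv_fun_mul hF hG]
  simp [mul_comm]

lemma pderiv_coord {n : ℕ} (i j : Fin n) (x : Fin n → ℂ) :
    pderiv i (fun y => y j) x = if j = i then 1 else 0 := by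
  rw [pderiv_eq_fderiv i (analyticAt_coord j x).differentiableAt]
  have : fderiv ℂ (fun y : Fin n → ℂ => y j) x =
      ContinuousLinearMap.proj (R := ℂ) (φ := fun _ : Fin n => ℂ) j :=
    (ContinuousLinearMap.proj (R := ℂ) (φ := fun _ : Fin n => ℂ) j).fderiv
  rw [this]
  simp [Pi.single_apply]

lemma pderiv_coord_mul {n : ℕ} (i j : Fin n) {G : (Fin n → ℂ) → ℂ} {x : Fin n → ℂ}
    (hG : DifferentiableAt ℂ G x) :
    pderiv i (fun y => y j * G y) x = x j * pderiv i G x + if j = i then G x else 0 := by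
  rw [pderiv_mul i (analyticAt_coord j x).differentiableAt hG, pderiv_coord]
  split_ifs <;> simp

/-- If `σ` commutes with translation along the `i`-th axis, so does `F ↦ F ∘ σ` with `∂ᵢ`. -/
lemma pderiv_comp_of_translate {n : ℕ} (i : Fin n) (F : (Fin n → ℂ) → ℂ)
    {σ : (Fin n → ℂ) → Fin n → ℂ}
    (hσ : ∀ x (t : ℂ), σ (x + t • (Pi.single i 1 : Fin n → ℂ)) = σ x + t • Pi.single i 1)
    (x : Fin n → ℂ) : pderiv i (fun y => F (σ y)) x = pderiv i F (σ x) := by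
  simp only [pderiv, lineDeriv, hσ]

/-- If `G` does not depend on the `i`-th coordinate, then `∂ᵢ G = 0`. -/
lemma pderiv_eq_zero_of_invariant {n : ℕ} (i : Fin n) {G : (Fin n → ℂ) → ℂ}
    (hG : ∀ x (t : ℂ), G (x + t • (Pi.single i 1 : Fin n → ℂ)) = G x) (x : Fin n → ℂ) :
    pderiv i G x = 0 := by
  simp [pderiv, lineDeriv, hG]

/-! ### Algebra of weights -/

section Weight

variable {n : ℕ} {w : Fin n → ℕ} {k l : ℕ} {F G : (Fin n → ℂ) → ℂ}

lemma HasWeight.congr (hF : HasWeight w k F) (h : F =ᶠ[𝓝 0] G) : HasWeight w k G := by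
  obtain ⟨H, hH, h1⟩ := hF
  refine ⟨H, hH, ?_⟩
  filter_upwards [h1, (tendsto_dilate w).eventually h] with p hp1 hp2
  rw [← hp2, hp1]

lemma HasWeight.mono (hF : HasWeight w k F) (h : l ≤ k) : HasWeight w l F := by
  obtain ⟨H, hH, h1⟩ := hF
  refine ⟨fun p => p 0 ^ (k - l) * H p, ((analyticAt_coord 0 0).pow _).mul hH, ?_⟩
  filter_upwards [h1] with p hp
  rw [hp, ← mul_assoc, ← pow_add, Nat.add_sub_cancel' h]

lemma HasWeight.add (hF : HasWeight w k F) (hG : HasWeight w k G) :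
    HasWeight w k fun x => F x + G x := by
  obtain ⟨H, hH, h1⟩ := hF
  obtain ⟨K, hK, h2⟩ := hG
  refine ⟨_, hH.add hK, ?_⟩
  filter_upwards [h1, h2] with p hp1 hp2
  rw [hp1, hp2, Pi.add_apply]; ring

lemma HasWeight.mul (hF : HasWeight w k F) (hG : HasWeight w l G) :
    HasWeight w (k + l) fun x => F x * G x := by
  obtain ⟨H, hH, h1⟩ := hF
  obtain ⟨K, hK, h2⟩ := hG
  refine ⟨_, hH.mul hK, ?_⟩
  filter_upwards [h1, h2] with p hp1 hp2
  rw [hp1, hp2, Pi.mul_apply]; ring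

lemma hasWeight_of_analyticAt (hF : AnalyticAt ℂ F 0) : HasWeight w 0 F :=
  ⟨fun p => F (dilate w p),
    AnalyticAt.fun_comp (by rwa [dilate_zero]) (analyticAt_dilate w 0), by simp⟩

lemma hasWeight_coord (i : Fin n) : HasWeight w (w i) fun x => x i :=
  ⟨fun p => p i.succ, analyticAt_coord _ _, by simp [dilate]⟩

lemma hasWeight_zero : HasWeight w k fun _ => 0 :=
  ⟨fun _ => 0, analyticAt_const, by simp⟩

lemma HasWeight.apply_zero (hF : HasWeight w k F) (hk : 0 < k) : F 0 = 0 := by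
  obtain ⟨H, hH, h1⟩ := hF
  have := h1.self_of_nhds
  simpa [dilate_zero, hk.ne'] using this

lemma dilate_add_single (p : Fin (n + 1) → ℂ) (i : Fin n) (t : ℂ) :
    dilate w (p + t • (Pi.single i.succ 1 : Fin (n + 1) → ℂ)) =
      dilate w p + t • (p 0 ^ w i • (Pi.single i 1 : Fin n → ℂ)) := by
  ext j
  rcases eq_or_ne j i with rfl | hj
  · simp [dilate, mul_add, mul_comm t]
  · simp [dilate, hj]

lemma pderiv_comp_dilate {p : Fin (n + 1) → ℂ} (i : Fin n)
    (hF : DifferentiableAt ℂ F (dilate w p)) :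
    pderiv i.succ (fun q => F (dilate w q)) p = p 0 ^ w i * pderiv i F (dilate w p) := by
  have h1 : pderiv i.succ (fun q => F (dilate w q)) p =
      lineDeriv ℂ F (dilate w p) (p 0 ^ w i • (Pi.single i 1 : Fin n → ℂ)) := by
    simp only [pderiv, lineDeriv, dilate_add_single]
  rw [h1, hF.lineDeriv_eq_fderiv, map_smul, pderiv_eq_fderiv i hF, smul_eq_mul]

/-- The chain rule on the left produces `u ^ w i`; on the right `u ^ k` is constant in the direction
of differentiation. -/
lemma pderiv_of_comp_dilate {H : (Fin (n + 1) → ℂ) → ℂ} (i : Fin n) (hF : AnalyticAt ℂ F 0)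
    (hH : AnalyticAt ℂ H 0) (h : ∀ᶠ p in 𝓝 0, F (dilate w p) = p 0 ^ k * H p) :
    ∀ᶠ p in 𝓝 0, p 0 ^ w i * pderiv i F (dilate w p) = p 0 ^ k * pderiv i.succ H p := by
  filter_upwards [pderiv_congr i.succ h, (tendsto_dilate w).eventually hF.eventually_analyticAt,
    hH.eventually_analyticAt] with p hp hFp hHp
  rw [pderiv_comp_dilate i hFp.differentiableAt] at hp
  rw [hp, pderiv_mul _ ((analyticAt_coord 0 p).fun_pow k).differentiableAt hHp.differentiableAt,
    pderiv_eq_zero_of_invariant (G := fun y : Fin (n + 1) → ℂ => y 0 ^ k)]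
  · ring
  · intro x t
    simp [(Fin.succ_ne_zero i).symm]

lemma HasWeight.pderiv (hF : AnalyticAt ℂ F 0) (hw : HasWeight w k F) (i : Fin n) :
    HasWeight w (k - w i) (pderiv i F) := by
  -- The subtraction is truncated: for `k ≤ w i` the claim is weight `0`, which every analytic germ
  -- has. Otherwise `u ^ w i` is cancelled off `u = 0`.
  rcases le_total k (w i) with hk | hk
  · rw [Nat.sub_eq_zero_of_le hk]
    exact hasWeight_of_analyticAt (analyticAt_pderiv i hF)
  obtain ⟨H, hH, h1⟩ := hw
  refine ⟨Kawakita.pderiv i.succ H, analyticAt_pderiv _ hH, ?_⟩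
  refine eventuallyEq_of_coord_ne 0 (F := fun p => Kawakita.pderiv i F (dilate w p)) ?_ ?_ ?_
  · exact AnalyticAt.fun_comp (by rw [dilate_zero]; exact analyticAt_pderiv i hF)
      (analyticAt_dilate w 0)
  · exact ((analyticAt_coord 0 0).pow _).mul (analyticAt_pderiv _ hH)
  filter_upwards [pderiv_of_comp_dilate i hF hH h1] with p hp hp0
  refine mul_left_cancel₀ (pow_ne_zero (w i) hp0) ?_
  rw [hp, ← mul_assoc, ← pow_add, Nat.add_sub_cancel' hk]

/-- Division with remainder by a coordinate. -/
lemma exists_coord_division (i : Fin n) (hF : AnalyticAt ℂ F 0) :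
    ∃ P : (Fin n → ℂ) → ℂ, AnalyticAt ℂ P 0 ∧
      (∀ᶠ x in 𝓝 0, F x = F (Function.update x i 0) + x i * P x) ∧
      ∀ w k, HasWeight w k F → HasWeight w (k - w i) P := by
  obtain ⟨f, hf, hfF⟩ := exists_series hF
  refine ⟨value (divCoord i f), analyticAt_value (isConvergent_divCoord i hf), ?_, ?_⟩
  · filter_upwards [value_eq_add_coord_mul i hf, hfF, (tendsto_update_zero i).eventually hfF]
      with x h1 h2 h3
    rw [← h2, ← h3, h1]
  · intro w k h
    rw [hasWeight_value_iff w _ (isConvergent_divCoord i hf)]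
    intro m hm
    refine (hasWeight_value_iff w k hf).mp (h.congr hfF.symm) _ ?_
    rw [map_add, Finsupp.weight_single]
    simp only [smul_eq_mul, one_mul]
    omega

end Weight

/-! ### Biholomorphic germs -/

/-- `ψ` and `θ` are mutually inverse biholomorphic germs at the origin. -/
structure BiholGerm {n : ℕ} (ψ θ : (Fin n → ℂ) → Fin n → ℂ) : Prop where
  analytic : AnalyticAt ℂ ψ 0
  analytic_inv : AnalyticAt ℂ θ 0
  map_zero : ψ 0 = 0
  map_zero_inv : θ 0 = 0
  left_inv : ∀ᶠ x in 𝓝 0, θ (ψ x) = x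
  right_inv : ∀ᶠ x in 𝓝 0, ψ (θ x) = x

lemma tendsto_of_analyticAt {E F : Type*} [NormedAddCommGroup E] [NormedSpace ℂ E]
    [NormedAddCommGroup F] [NormedSpace ℂ F] {ψ : E → F}
    (h : AnalyticAt ℂ ψ 0) (h0 : ψ 0 = 0) : Tendsto ψ (𝓝 0) (𝓝 0) := by
  simpa [h0] using h.continuousAt.tendsto

namespace BiholGerm

variable {n : ℕ} {ψ θ ψ' θ' : (Fin n → ℂ) → Fin n → ℂ}

lemma tendsto (h : BiholGerm ψ θ) : Tendsto ψ (𝓝 0) (𝓝 0) :=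
  tendsto_of_analyticAt h.analytic h.map_zero

lemma symm (h : BiholGerm ψ θ) : BiholGerm θ ψ :=
  ⟨h.analytic_inv, h.analytic, h.map_zero_inv, h.map_zero, h.right_inv, h.left_inv⟩

lemma trans (h : BiholGerm ψ θ) (h' : BiholGerm ψ' θ') :
    BiholGerm (fun x => ψ' (ψ x)) (fun x => θ (θ' x)) where
  analytic := AnalyticAt.fun_comp (by rw [h.map_zero]; exact h'.analytic) h.analytic
  analytic_inv := AnalyticAt.fun_comp (by rw [h'.map_zero_inv]; exact h.analytic_inv) h'.analytic_inv
  map_zero := by rw [h.map_zero, h'.map_zero]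
  map_zero_inv := by rw [h'.map_zero_inv, h.map_zero_inv]
  left_inv := by
    filter_upwards [h.tendsto.eventually h'.left_inv, h.left_inv] with x h1 h2
    rw [h1, h2]
  right_inv := by
    filter_upwards [h'.symm.tendsto.eventually h.right_inv, h'.right_inv] with x h1 h2
    rw [h1, h2]

lemma eq_zero_of_fderiv (h : BiholGerm ψ θ) {v : Fin n → ℂ} (hv : fderiv ℂ ψ 0 v = 0) :
    v = 0 := by
  have h2 : fderiv ℂ (fun x => θ (ψ x)) 0 = ContinuousLinearMap.id ℂ _ := by
    rw [Filter.EventuallyEq.fderiv_eq (f₁ := fun x => θ (ψ x)) (f := id) h.left_inv, fderiv_id]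
  have h3 : fderiv ℂ (fun x => θ (ψ x)) 0 = (fderiv ℂ θ (ψ 0)).comp (fderiv ℂ ψ 0) :=
    fderiv_fun_comp 0 (by rw [h.map_zero]; exact h.analytic_inv.differentiableAt)
      h.analytic.differentiableAt
  have h4 := congrArg (fun T => T v) (h2.symm.trans h3)
  simpa [hv] using h4

end BiholGerm

/-- The analytic inverse function theorem. An injective endomorphism of a finite-dimensional space
is invertible, so injectivity of the derivative suffices. -/
lemma exists_biholGerm {n : ℕ} {ψ : (Fin n → ℂ) → Fin n → ℂ} (hψ : AnalyticAt ℂ ψ 0)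
    (h0 : ψ 0 = 0) (hinj : ∀ v, fderiv ℂ ψ 0 v = 0 → v = 0) : ∃ θ, BiholGerm ψ θ := by
  let e : (Fin n → ℂ) ≃L[ℂ] (Fin n → ℂ) :=
    (LinearEquiv.ofInjectiveEndo (fderiv ℂ ψ 0 : (Fin n → ℂ) →ₗ[ℂ] (Fin n → ℂ))
      ((injective_iff_map_eq_zero _).mpr hinj)).toContinuousLinearEquiv
  have he : (e : (Fin n → ℂ) →L[ℂ] (Fin n → ℂ)) = fderiv ℂ ψ 0 := by
    ext v; rfl
  have hd : HasStrictFDerivAt ψ (e : (Fin n → ℂ) →L[ℂ] (Fin n → ℂ)) 0 := by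
    rw [he]; exact hψ.hasStrictFDerivAt
  let R := hd.toOpenPartialHomeomorph ψ
  have hR : (R : (Fin n → ℂ) → Fin n → ℂ) = ψ := hd.toOpenPartialHomeomorph_coe
  have hs : (0 : Fin n → ℂ) ∈ R.source := hd.mem_toOpenPartialHomeomorph_source
  have ht : (0 : Fin n → ℂ) ∈ R.target := by
    have := R.map_source hs
    rwa [hR, h0] at this
  have hR0 : R 0 = 0 := by rw [hR, h0]
  refine ⟨R.symm, hψ, ?_, h0, ?_, ?_, ?_⟩
  · have := R.analyticAt_symm' (i := e) hs (by rw [hR]; exact hψ) (by rw [hR, he])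
    rwa [hR0] at this
  · conv_lhs => rw [← hR0]
    exact R.left_inv hs
  · filter_upwards [R.eventually_left_inverse hs] with x hx
    rwa [hR] at hx
  · filter_upwards [R.eventually_right_inverse ht] with x hx
    rwa [hR] at hx

/-! ### Weight-compatible maps and their lifts through the dilation. -/

/-- The `i`-th component of `ψ` has weight at least `w i`, for all `i`. -/
def IsWeightMap {n : ℕ} (w : Fin n → ℕ) (ψ : (Fin n → ℂ) → Fin n → ℂ) : Prop :=
  ∀ i, HasWeight w (w i) fun x => ψ x i

lemma fderiv_apply_coord {n m : ℕ} {ψ : (Fin n → ℂ) → Fin m → ℂ} {x : Fin n → ℂ}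
    (hψ : DifferentiableAt ℂ ψ x) (v : Fin n → ℂ) (i : Fin m) :
    fderiv ℂ ψ x v i = fderiv ℂ (fun y => ψ y i) x v := by
  rw [fderiv_apply (hψ) i]
  rfl

lemma AnalyticAt.coord {n m : ℕ} {ψ : (Fin n → ℂ) → Fin m → ℂ} {x : Fin n → ℂ}
    (hψ : AnalyticAt ℂ ψ x) (i : Fin m) : AnalyticAt ℂ (fun y => ψ y i) x :=
  AnalyticAt.fun_comp (analyticAt_coord i _) hψ

/-- A map compatible with the weights lifts through the dilation. -/
lemma IsWeightMap.exists_lift {n : ℕ} {w : Fin n → ℕ} {ψ : (Fin n → ℂ) → Fin n → ℂ}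
    (h : IsWeightMap w ψ) (h0 : ψ 0 = 0) :
    ∃ Ψ : (Fin (n + 1) → ℂ) → Fin (n + 1) → ℂ, AnalyticAt ℂ Ψ 0 ∧ Ψ 0 = 0 ∧
      (∀ p, Ψ p 0 = p 0) ∧ ∀ᶠ p in 𝓝 0, ψ (dilate w p) = dilate w (Ψ p) := by
  choose H hH h1 using h
  refine ⟨fun p => Fin.cons (p 0) fun i => H i p, ?_, ?_, fun p => rfl, ?_⟩
  · refine AnalyticAt.pi fun j => ?_
    refine Fin.cases ?_ (fun i => ?_) j
    · exact analyticAt_coord 0 0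
    · exact hH i
  -- Dilation collapses the `u`-axis to `0`, where `ψ` vanishes. Hence `t ^ w i * H i = 0` along
  -- that axis, and `H i 0 = 0` by continuity.
  · have hline : ∀ t : ℂ, dilate w (Pi.single 0 t) = 0 := by
      intro t; ext i; simp [dilate]
    have hc : Tendsto (fun t : ℂ => (Pi.single 0 t : Fin (n + 1) → ℂ)) (𝓝 0) (𝓝 0) := by
      have : Continuous (fun t : ℂ => (Pi.single 0 t : Fin (n + 1) → ℂ)) :=
        continuous_single (A := fun _ : Fin (n + 1) => ℂ) 0
      simpa using this.tendsto 0
    ext j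
    refine Fin.cases rfl (fun i => ?_) j
    change H i 0 = 0
    have h2 : ∀ᶠ t : ℂ in 𝓝 0, 0 = t ^ w i * H i (Pi.single 0 t) := by
      filter_upwards [hc.eventually (h1 i)] with t ht
      simpa [hline, h0] using ht
    have h3 : ContinuousAt (fun t : ℂ => H i (Pi.single 0 t)) 0 := by
      refine ContinuousAt.comp' ?_ ?_
      · simpa using (hH i).continuousAt
      · simpa [ContinuousAt] using hc
    have h4 : (fun t : ℂ => H i (Pi.single 0 t)) 0 = (fun _ : ℂ => (0 : ℂ)) 0 := by
      refine eq_of_frequently_eq h3 continuousAt_const ?_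
      have : ∀ᶠ t : ℂ in 𝓝[≠] 0, H i (Pi.single 0 t) = 0 := by
        filter_upwards [h2.filter_mono nhdsWithin_le_nhds, self_mem_nhdsWithin] with t ht ht0
        exact (mul_eq_zero.mp ht.symm).resolve_left (pow_ne_zero _ ht0)
      exact this.frequently.filter_mono nhdsWithin_le_nhds
    simpa using h4
  · filter_upwards [Filter.eventually_all.mpr h1] with p hp
    ext i
    rw [hp i]
    simp [dilate]

lemma HasWeight.comp {n : ℕ} {w : Fin n → ℕ} {k : ℕ} {F : (Fin n → ℂ) → ℂ}
    {ψ : (Fin n → ℂ) → Fin n → ℂ} (hF : HasWeight w k F) (hψ : IsWeightMap w ψ) (h0 : ψ 0 = 0) :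
    HasWeight w k fun x => F (ψ x) := by
  obtain ⟨Ψ, hΨ, hΨ0, hp0, hp⟩ := hψ.exists_lift h0
  obtain ⟨H, hH, h1⟩ := hF
  refine ⟨fun p => H (Ψ p), AnalyticAt.fun_comp (by rwa [hΨ0]) hΨ, ?_⟩
  filter_upwards [hp, (tendsto_of_analyticAt hΨ hΨ0).eventually h1] with p h2 h3
  rw [h2, h3, hp0]

lemma IsWeightMap.comp {n : ℕ} {w : Fin n → ℕ} {ψ ψ' : (Fin n → ℂ) → Fin n → ℂ}
    (h' : IsWeightMap w ψ') (h : IsWeightMap w ψ) (h0 : ψ 0 = 0) :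
    IsWeightMap w fun x => ψ' (ψ x) :=
  fun i => (h' i).comp h h0

/-- The inverse of a weight-compatible biholomorphic germ is weight-compatible. -/
lemma IsWeightMap.inv {n : ℕ} {w : Fin n → ℕ} {ψ θ : (Fin n → ℂ) → Fin n → ℂ}
    (hψ : IsWeightMap w ψ) (hb : BiholGerm ψ θ) : IsWeightMap w θ := by
  obtain ⟨Ψ, hΨ, hΨ0, hp0, hp⟩ := hψ.exists_lift hb.map_zero
  let J : Matrix (Fin n) (Fin n) ℂ := fun i j => pderiv j (fun x => ψ x i) 0
  let M : (Fin (n + 1) → ℂ) → Matrix (Fin n) (Fin n) ℂ :=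
    fun p i j => pderiv j.succ (fun q => Ψ q i.succ) p
  have hJ : J.det ≠ 0 := by
    intro hdet
    obtain ⟨v, hv, hv0⟩ := Matrix.exists_mulVec_eq_zero_iff.mpr hdet
    have h1 : fderiv ℂ ψ 0 v = 0 := by
      ext i
      rw [fderiv_apply_coord hb.analytic.differentiableAt, fderiv_apply_eq_sum_pderiv
        (AnalyticAt.coord hb.analytic i).differentiableAt]
      have := congrFun hv0 i
      simpa [Matrix.mulVec, dotProduct, J, mul_comm] using this
    exact hv (hb.eq_zero_of_fderiv h1)
  -- On the punctured `u`-axis the `x`-block of the Jacobian of `Ψ` is the Jacobian of `ψ` at `0`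
  -- conjugated by `diag(u ^ w i)`, so its determinant is constant. Continuity carries this to `u =
  -- 0`, and `Ψ` is invertible there.
  have hM : ∀ᶠ p : Fin (n + 1) → ℂ in 𝓝 0, p 0 ≠ 0 → (∀ i : Fin n, p i.succ = 0) →
      (M p).det = J.det := by
    have h1 : ∀ i j : Fin n, ∀ᶠ p in 𝓝 0, p 0 ^ w j * pderiv j (fun x => ψ x i) (dilate w p) =
        p 0 ^ w i * pderiv j.succ (fun q => Ψ q i.succ) p := by
      intro i j
      refine pderiv_of_comp_dilate j (AnalyticAt.coord hb.analytic i) (AnalyticAt.coord hΨ _) ?_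
      filter_upwards [hp] with p h
      rw [h, dilate, hp0]
    filter_upwards [Filter.eventually_all.mpr fun i => Filter.eventually_all.mpr (h1 i)]
      with p h2 hp1 hp2
    have hd : dilate w p = 0 := by ext i; simp [dilate, hp2]
    have h3 : Matrix.diagonal (fun i => p 0 ^ w i) * M p =
        J * Matrix.diagonal (fun i => p 0 ^ w i) := by
      ext i j
      have := h2 i j
      rw [hd] at this
      rw [Matrix.diagonal_mul, Matrix.mul_diagonal, ← this, mul_comm]
    have h4 := congrArg Matrix.det h3
    rw [Matrix.det_mul, Matrix.det_mul, mul_comm, Matrix.det_diagonal] at h4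
    exact mul_right_cancel₀ (Finset.prod_ne_zero_iff.mpr fun i _ => pow_ne_zero _ hp1) h4
  have hM0 : (M 0).det ≠ 0 := by
    have hc : ContinuousAt (fun t : ℂ => (M (Pi.single 0 t)).det) 0 := by
      have h1 : ContinuousAt M 0 := continuousAt_pi.mpr fun i => continuousAt_pi.mpr fun j =>
        (analyticAt_pderiv j.succ (AnalyticAt.coord hΨ i.succ)).continuousAt
      have h2 : ContinuousAt (fun t : ℂ => M (Pi.single 0 t)) 0 := by
        refine ContinuousAt.comp' (by simpa using h1) ?_
        exact (continuous_single (A := fun _ : Fin (n + 1) => ℂ) 0).continuousAt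
      exact (continuous_id.matrix_det).continuousAt.comp' h2
    have hline : Tendsto (fun t : ℂ => (Pi.single 0 t : Fin (n + 1) → ℂ)) (𝓝 0) (𝓝 0) := by
      simpa using (continuous_single (A := fun _ : Fin (n + 1) => ℂ) 0).tendsto 0
    have h1 : (fun t : ℂ => (M (Pi.single 0 t)).det) 0 = (fun _ : ℂ => J.det) 0 := by
      refine eq_of_frequently_eq hc continuousAt_const ?_
      have : ∀ᶠ t : ℂ in 𝓝[≠] 0, (M (Pi.single 0 t)).det = J.det := by
        filter_upwards [(hline.eventually hM).filter_mono nhdsWithin_le_nhds,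
          self_mem_nhdsWithin] with t ht ht0
        exact ht (by simpa using ht0) (by simp)
      exact this.frequently.filter_mono nhdsWithin_le_nhds
    simp only [Pi.single_zero] at h1
    rw [h1]; exact hJ
  obtain ⟨Θ, hΘ⟩ := exists_biholGerm hΨ hΨ0 (by
    intro v hv
    have hv0 : v 0 = 0 := by
      have := congrFun hv 0
      rw [fderiv_apply_coord hΨ.differentiableAt] at this
      simp only [hp0] at this
      rw [fderiv_apply_eq_sum_pderiv (analyticAt_coord 0 0).differentiableAt] at this
      simpa [pderiv_coord] using this
    have hvs : (fun i : Fin n => v i.succ) = 0 := by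
      refine Matrix.eq_zero_of_mulVec_eq_zero hM0 ?_
      ext i
      have := congrFun hv i.succ
      rw [fderiv_apply_coord hΨ.differentiableAt, fderiv_apply_eq_sum_pderiv
        (AnalyticAt.coord hΨ _).differentiableAt, Fin.sum_univ_succ, hv0, zero_mul, zero_add]
        at this
      simpa [Matrix.mulVec, dotProduct, M, mul_comm] using this
    ext j
    exact Fin.cases hv0 (fun i => congrFun hvs i) j)
  -- The components of the inverse `Θ` of `Ψ` are the cofactors showing that `θ` has the right
  -- weights.
  intro i
  refine ⟨fun p => Θ p i.succ, AnalyticAt.coord hΘ.analytic_inv _, ?_⟩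
  filter_upwards [hΘ.right_inv, hΘ.symm.tendsto.eventually hp,
    hΘ.symm.tendsto.eventually ((tendsto_dilate w).eventually hb.left_inv)] with p h1 h2 h3
  rw [h1] at h2
  rw [h2] at h3
  rw [h3, dilate, ← hp0 (Θ p), h1]

/-! ### The splitting lemma -/

/-- Set two coordinates to zero. -/
def kill {n : ℕ} (i j : Fin n) (x : Fin n → ℂ) : Fin n → ℂ :=
  Function.update (Function.update x i 0) j 0

section Splitting

variable {n : ℕ} {i j : Fin n}

lemma analyticAt_update {ψ : (Fin n → ℂ) → Fin n → ℂ} {F : (Fin n → ℂ) → ℂ} {a : Fin n → ℂ}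
    (hψ : AnalyticAt ℂ ψ a) (hF : AnalyticAt ℂ F a) (i : Fin n) :
    AnalyticAt ℂ (fun x => Function.update (ψ x) i (F x)) a := by
  refine AnalyticAt.pi fun k => ?_
  rcases eq_or_ne k i with rfl | hk
  · simpa using hF
  · simpa [hk] using AnalyticAt.coord hψ k

lemma IsWeightMap.update {w : Fin n → ℕ} {ψ : (Fin n → ℂ) → Fin n → ℂ} {F : (Fin n → ℂ) → ℂ}
    (hψ : IsWeightMap w ψ) {i : Fin n} (hF : HasWeight w (w i) F) :
    IsWeightMap w fun x => Function.update (ψ x) i (F x) := by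
  intro k
  rcases eq_or_ne k i with rfl | hk
  · simpa using hF
  · simpa [hk] using hψ k

lemma isWeightMap_id (w : Fin n → ℕ) : IsWeightMap w fun x => x := fun i => hasWeight_coord i

lemma analyticAt_kill (i j : Fin n) (a : Fin n → ℂ) : AnalyticAt ℂ (kill i j) a :=
  analyticAt_update (analyticAt_update analyticAt_id analyticAt_const i) analyticAt_const j

lemma isWeightMap_kill (w : Fin n → ℕ) (i j : Fin n) : IsWeightMap w (kill i j) :=
  ((isWeightMap_id w).update hasWeight_zero).update hasWeight_zero

lemma kill_zero (i j : Fin n) : kill i j 0 = 0 := by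
  simp [kill]

lemma kill_comm (hij : i ≠ j) (x : Fin n → ℂ) : kill i j x = kill j i x :=
  Function.update_comm hij _ _ _

lemma kill_apply (i j k : Fin n) (x : Fin n → ℂ) :
    kill i j x k = if k = j then 0 else if k = i then 0 else x k := by
  simp [kill, Function.update_apply]

lemma kill_kill (i j : Fin n) (x : Fin n → ℂ) : kill i j (kill i j x) = kill i j x := by
  ext k; simp only [kill_apply]; split_ifs <;> rfl

lemma kill_congr {x y : Fin n → ℂ} (h : ∀ k, k ≠ i → k ≠ j → x k = y k) :
    kill i j x = kill i j y := by
  ext k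
  simp only [kill_apply]
  split_ifs with h1 h2
  · rfl
  · rfl
  · exact h k h2 h1

lemma kill_add_single_left (x : Fin n → ℂ) (t : ℂ) :
    kill i j (x + t • (Pi.single i 1 : Fin n → ℂ)) = kill i j x :=
  kill_congr fun k hk _ => by simp [hk]

lemma kill_add_single_right (x : Fin n → ℂ) (t : ℂ) :
    kill i j (x + t • (Pi.single j 1 : Fin n → ℂ)) = kill i j x :=
  kill_congr fun k _ hk => by simp [hk]

lemma pderiv_coord_mul_add_coord_mul (hij : i ≠ j) {R S : (Fin n → ℂ) → ℂ}
    (hR : DifferentiableAt ℂ R 0) (hS : DifferentiableAt ℂ S 0) :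
    pderiv i (fun x => x i * R x + x j * S x) 0 = R 0 ∧
      pderiv j (fun x => x i * R x + x j * S x) 0 = S 0 := by
  have h1 : DifferentiableAt ℂ (fun x : Fin n → ℂ => x i * R x) 0 :=
    (analyticAt_coord i 0).differentiableAt.fun_mul hR
  have h2 : DifferentiableAt ℂ (fun x : Fin n → ℂ => x j * S x) 0 :=
    (analyticAt_coord j 0).differentiableAt.fun_mul hS
  rw [pderiv_add i h1 h2, pderiv_add j h1 h2]
  simp [pderiv_coord_mul, hR, hS, hij, hij.symm]

/-- Second derivatives of a quadratic form in two of the coordinates. -/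
lemma pderiv_pderiv_quadratic (hij : i ≠ j) {F G A B C : (Fin n → ℂ) → ℂ}
    (hG : AnalyticAt ℂ (fun x => G (kill i j x)) 0)
    (hA : AnalyticAt ℂ A 0) (hB : AnalyticAt ℂ B 0) (hC : AnalyticAt ℂ C 0)
    (h : ∀ᶠ x in 𝓝 0, F x = G (kill i j x) +
      (x i * (x i * A x) + (x i * (x j * B x) + x j * (x j * C x)))) :
    pderiv i (pderiv i F) 0 = 2 * A 0 ∧ pderiv j (pderiv i F) 0 = B 0 := by
  have key : pderiv i F =ᶠ[𝓝 0] fun x =>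
      x i * (2 * A x + x i * pderiv i A x + x j * pderiv i B x) +
        x j * (B x + x j * pderiv i C x) := by
    filter_upwards [pderiv_congr i h, hG.eventually_analyticAt, hA.eventually_analyticAt,
      hB.eventually_analyticAt, hC.eventually_analyticAt] with x hx hGx hAx hBx hCx
    have hc : ∀ k, DifferentiableAt ℂ (fun y : Fin n → ℂ => y k) x :=
      fun k => (analyticAt_coord k x).differentiableAt
    have hGx := hGx.differentiableAt
    have hAx := hAx.differentiableAt
    have hBx := hBx.differentiableAt
    have hCx := hCx.differentiableAt
    rw [hx, pderiv_add i hGx (((hc i).fun_mul ((hc i).fun_mul hAx)).fun_add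
        (((hc i).fun_mul ((hc j).fun_mul hBx)).fun_add ((hc j).fun_mul ((hc j).fun_mul hCx)))),
      pderiv_add i ((hc i).fun_mul ((hc i).fun_mul hAx))
        (((hc i).fun_mul ((hc j).fun_mul hBx)).fun_add ((hc j).fun_mul ((hc j).fun_mul hCx))),
      pderiv_add i ((hc i).fun_mul ((hc j).fun_mul hBx)) ((hc j).fun_mul ((hc j).fun_mul hCx)),
      pderiv_coord_mul i i ((hc i).fun_mul hAx), pderiv_coord_mul i i hAx,
      pderiv_coord_mul i i ((hc j).fun_mul hBx), pderiv_coord_mul i j hBx,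
      pderiv_coord_mul i j ((hc j).fun_mul hCx), pderiv_coord_mul i j hCx,
      pderiv_eq_zero_of_invariant i (fun y t => by rw [kill_add_single_left])]
    simp only [if_true, if_neg hij.symm]
    ring
  have ha := analyticAt_pderiv i hA
  have hb := analyticAt_pderiv i hB
  have hc := analyticAt_pderiv i hC
  have hi := analyticAt_coord i (0 : Fin n → ℂ)
  have hj := analyticAt_coord j (0 : Fin n → ℂ)
  have hR : AnalyticAt ℂ (fun x => 2 * A x + x i * pderiv i A x + x j * pderiv i B x) 0 :=
    ((analyticAt_const.fun_mul hA).fun_add (hi.fun_mul ha)).fun_add (hj.fun_mul hb)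
  have hS : AnalyticAt ℂ (fun x => B x + x j * pderiv i C x) 0 := hB.fun_add (hj.fun_mul hc)
  have := pderiv_coord_mul_add_coord_mul hij hR.differentiableAt hS.differentiableAt
  rw [(pderiv_congr i key).self_of_nhds, (pderiv_congr j key).self_of_nhds, this.1, this.2]
  simp

/-- On `x l = 0` this reads `∂ₗ F = R`, so a vanishing derivative there makes the quotient `R`
divisible by a further coordinate. -/
lemma pderiv_eq_of_division {l : Fin n} {F R : (Fin n → ℂ) → ℂ} (hF : AnalyticAt ℂ F 0)
    (hR : AnalyticAt ℂ R 0) (h : ∀ᶠ x in 𝓝 0, F x = F (Function.update x l 0) + x l * R x) :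
    ∀ᶠ x in 𝓝 0, pderiv l F x = x l * pderiv l R x + R x := by
  have hul : AnalyticAt ℂ (fun x : Fin n → ℂ => Function.update x l 0) 0 :=
    analyticAt_update analyticAt_id analyticAt_const l
  have hFl : AnalyticAt ℂ (fun x => F (Function.update x l 0)) 0 :=
    AnalyticAt.fun_comp (by simpa using hF) hul
  filter_upwards [pderiv_congr l h, hR.eventually_analyticAt, hFl.eventually_analyticAt]
    with x hx hRx hFx
  rw [hx, pderiv_add l hFx.differentiableAt
    ((analyticAt_coord l x).differentiableAt.fun_mul hRx.differentiableAt),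
    pderiv_coord_mul l l hRx.differentiableAt, pderiv_eq_zero_of_invariant l]
  · simp
  · intro y t
    congr 1
    ext m
    rcases eq_or_ne m l with rfl | hm <;> simp [*]

/-- Expansion to second order in two of the coordinates, along their common critical locus. -/
lemma exists_quadratic_expansion (hij : i ≠ j) {F : (Fin n → ℂ) → ℂ} (hF : AnalyticAt ℂ F 0)
    (hi : ∀ᶠ x in 𝓝 0, pderiv i F (kill i j x) = 0)
    (hj : ∀ᶠ x in 𝓝 0, pderiv j F (kill i j x) = 0) :
    ∃ A B C : (Fin n → ℂ) → ℂ, AnalyticAt ℂ A 0 ∧ AnalyticAt ℂ B 0 ∧ AnalyticAt ℂ C 0 ∧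
      (∀ w k, HasWeight w k F → HasWeight w (k - w j - w j) C) ∧
      ∀ᶠ x in 𝓝 0, F x = F (kill i j x) +
        (x i * (x i * A x) + (x i * (x j * B x) + x j * (x j * C x))) := by
  obtain ⟨P, hP, hFP, -⟩ := exists_coord_division i hF
  obtain ⟨A, hA, hPA, -⟩ := exists_coord_division i hP
  obtain ⟨B, hB, hPB, -⟩ := exists_coord_division j hP
  obtain ⟨Q, hQ, hFQ, hQw⟩ := exists_coord_division j hF
  obtain ⟨C, hC, hQC, hCw⟩ := exists_coord_division j hQ
  have hu : AnalyticAt ℂ (fun x : Fin n → ℂ => Function.update x i 0) 0 :=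
    analyticAt_update analyticAt_id analyticAt_const i
  have hu0 : Function.update (0 : Fin n → ℂ) i 0 = 0 := by simp
  have hui := tendsto_update_zero i
  have hk : Tendsto (kill i j) (𝓝 0) (𝓝 0) := tendsto_of_analyticAt (analyticAt_kill i j 0)
    (kill_zero i j)
  have hPi : ∀ᶠ x in 𝓝 0, P (kill i j x) = 0 := by
    filter_upwards [hi, hk.eventually (pderiv_eq_of_division hF hP hFP)] with x h1 h2
    rw [h1] at h2
    simpa [kill_apply] using h2.symm
  have hQj : ∀ᶠ x in 𝓝 0, Q (kill i j x) = 0 := by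
    filter_upwards [hj, hk.eventually (pderiv_eq_of_division hF hQ hFQ)] with x h1 h2
    rw [h1] at h2
    simpa [kill_apply] using h2.symm
  refine ⟨A, fun x => B (Function.update x i 0), fun x => C (Function.update x i 0), hA,
    AnalyticAt.fun_comp (by simpa using hB) hu, AnalyticAt.fun_comp (by simpa using hC) hu,
    fun w k hw => (hCw w _ (hQw w k hw)).comp ((isWeightMap_id w).update hasWeight_zero) hu0, ?_⟩
  filter_upwards [hFP, hPA, hui.eventually hPB, hui.eventually hFQ, hui.eventually hQC, hPi, hQj]
    with x h1 h2 h3 h4 h5 h6 h7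
  have e : Function.update (Function.update x i 0) j 0 = kill i j x := rfl
  have ej : Function.update x i 0 j = x j := by simp [hij.symm]
  rw [e, ej] at h3 h4 h5
  rw [h6] at h3
  rw [h7] at h5
  rw [h1, h2, h3, h4, h5]
  ring

lemma fderiv_update_apply {ψ : (Fin n → ℂ) → Fin n → ℂ} (hψ : AnalyticAt ℂ ψ 0)
    (v : Fin n → ℂ) (k : Fin n) {F : (Fin n → ℂ) → ℂ} (h : ∀ x, ψ x k = F x) :
    fderiv ℂ ψ 0 v k = fderiv ℂ F 0 v := by
  rw [fderiv_apply_coord hψ.differentiableAt]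
  congr 2
  ext x
  exact h x

lemma fderiv_coord (k : Fin n) (v : Fin n → ℂ) : fderiv ℂ (fun x : Fin n → ℂ => x k) 0 v = v k := by
  rw [fderiv_apply_eq_sum_pderiv (analyticAt_coord k 0).differentiableAt]
  simp [pderiv_coord]

lemma sum_eq_two (hij : i ≠ j) {v : Fin n → ℂ} (hv : ∀ k, k ≠ i → k ≠ j → v k = 0)
    (u : Fin n → ℂ) : ∑ k, v k * u k = v i * u i + v j * u j := by
  rw [← Finset.sum_subset (Finset.subset_univ {i, j}), Finset.sum_pair hij]
  intro k _ hk
  simp only [Finset.mem_insert, Finset.mem_singleton, not_or] at hk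
  rw [hv k hk.1 hk.2, zero_mul]

/-- A nonvanishing analytic germ has an analytic square root. -/
lemma exists_analyticAt_sqrt {D : (Fin n → ℂ) → ℂ} (hD : AnalyticAt ℂ D 0) (h0 : D 0 ≠ 0) :
    ∃ s : (Fin n → ℂ) → ℂ, AnalyticAt ℂ s 0 ∧ ∀ᶠ x in 𝓝 0, s x ^ 2 = D x := by
  obtain ⟨c, hc⟩ := IsAlgClosed.exists_pow_nat_eq (D 0) two_pos
  refine ⟨fun x => c * Complex.exp (Complex.log (D x / D 0) / 2), ?_, ?_⟩
  · have h1 : AnalyticAt ℂ (fun x => D x / D 0) 0 := hD.fun_div analyticAt_const h0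
    have h2 : AnalyticAt ℂ (fun x => Complex.log (D x / D 0)) 0 :=
      h1.clog (by simp [div_self h0])
    exact analyticAt_const.fun_mul (h2.fun_div analyticAt_const two_ne_zero).cexp
  · filter_upwards [hD.continuousAt.eventually_ne h0] with x hx
    rw [mul_pow, ← Complex.exp_nat_mul, Nat.cast_two, mul_div_cancel₀ _ two_ne_zero,
      Complex.exp_log (div_ne_zero hx h0), hc, mul_div_cancel₀ _ h0]

/-- The Morse lemma in two variables with parameters, compatible with weights. -/
lemma exists_morse_chart (hij : i ≠ j) {w : Fin n → ℕ} (hw : w j ≤ w i) {F : (Fin n → ℂ) → ℂ}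
    (hF : AnalyticAt ℂ F 0) (hFw : HasWeight w (w i + w j) F)
    (hi : ∀ᶠ x in 𝓝 0, pderiv i F (kill i j x) = 0)
    (hj : ∀ᶠ x in 𝓝 0, pderiv j F (kill i j x) = 0)
    (hdet : pderiv i (pderiv j F) 0 * pderiv j (pderiv i F) 0 -
      pderiv i (pderiv i F) 0 * pderiv j (pderiv j F) 0 ≠ 0) :
    ∃ ψ θ, BiholGerm ψ θ ∧ IsWeightMap w ψ ∧
      ∀ᶠ x in 𝓝 0, F x = ψ x i * ψ x j + F (kill i j (ψ x)) := by
  obtain ⟨A, B, C, hA, hB, hC, hCw, h⟩ := exists_quadratic_expansion hij hF hi hj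
  have hFk : AnalyticAt ℂ (fun x => F (kill i j x)) 0 :=
    AnalyticAt.fun_comp (by rwa [kill_zero]) (analyticAt_kill i j 0)
  have hquad := pderiv_pderiv_quadratic hij hFk hA hB hC h
  have hquad' := pderiv_pderiv_quadratic hij.symm (F := F) (G := F) (A := C) (B := B) (C := A)
    (by simpa only [kill_comm hij.symm] using hFk) hC hB hA
    (h.mono fun x hx => by rw [hx, kill_comm hij]; ring)
  rw [hquad.1, hquad.2, hquad'.1, hquad'.2] at hdet
  replace hCw := hCw w _ hFw
  obtain ⟨s, hs, hs2, hBs⟩ : ∃ s : (Fin n → ℂ) → ℂ, AnalyticAt ℂ s 0 ∧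
      (∀ᶠ x in 𝓝 0, s x ^ 2 = B x ^ 2 - 4 * A x * C x) ∧ B 0 + s 0 ≠ 0 := by
    have hD : AnalyticAt ℂ (fun x => B x ^ 2 - 4 * A x * C x) 0 := by fun_prop
    have hD0 : B 0 ^ 2 - 4 * A 0 * C 0 ≠ 0 := fun h0 => hdet (by rw [← h0]; ring)
    obtain ⟨s, hs, hs2⟩ := exists_analyticAt_sqrt hD hD0
    -- The sign of the square root is chosen so that `B + s` is a unit. If `B + s` and `B - s` both
    -- vanished at `0`, so would `s`, contradicting the nonzero discriminant.
    by_cases hBs : B 0 + s 0 = 0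
    · refine ⟨fun x => - s x, hs.fun_neg, hs2.mono fun x hx => by rw [neg_sq, hx], fun h0 => ?_⟩
      have hs0 : s 0 = 0 := by linear_combination (hBs - h0) / 2
      refine hD0 ?_
      rw [← hs2.self_of_nhds, hs0]; ring
    · exact ⟨s, hs, hs2, hBs⟩
  -- With `μ` a root of `μ² - B μ + A C = 0` and `κ = C / μ`, the form `A xᵢ² + B xᵢ xⱼ + C xⱼ²`
  -- factors as `(xᵢ + κ xⱼ)(A xᵢ + μ xⱼ)`. This factorisation respects the weights: `C`, hence `κ`,
  -- has weight at least `w i - w j`, and `A xᵢ` has weight at least `w i ≥ w j`.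
  set κ : (Fin n → ℂ) → ℂ := fun x => C x * (2 / (B x + s x)) with hκ
  set μ : (Fin n → ℂ) → ℂ := fun x => (B x + s x) / 2 with hμ
  have hinv : AnalyticAt ℂ (fun x => 2 / (B x + s x)) 0 :=
    analyticAt_const.fun_div (hB.fun_add hs) hBs
  have hκa : AnalyticAt ℂ κ 0 := hC.fun_mul hinv
  have hμa : AnalyticAt ℂ μ 0 := (hB.fun_add hs).fun_div analyticAt_const two_ne_zero
  have hne : ∀ᶠ x in 𝓝 0, B x + s x ≠ 0 := (hB.fun_add hs).continuousAt.eventually_ne hBs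
  -- The determinant of the two linear factors, equal to `s 0` because `μ + κ A = B` and `2 μ = B +
  -- s`.
  have hs0 : μ 0 - κ 0 * A 0 ≠ 0 := by
    have h1 : μ 0 - κ 0 * A 0 = s 0 := by
      simp only [hκ, hμ]
      field_simp
      linear_combination -hs2.self_of_nhds
    rw [h1]
    intro h0
    have := hs2.self_of_nhds
    rw [h0] at this
    exact hdet (by linear_combination -this)
  let Y : (Fin n → ℂ) → ℂ := fun x => x i + κ x * x j
  let Z : (Fin n → ℂ) → ℂ := fun x => A x * x i + μ x * x j
  let ψ : (Fin n → ℂ) → Fin n → ℂ := fun x => Function.update (Function.update x i (Y x)) j (Z x)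
  have hci := analyticAt_coord i (0 : Fin n → ℂ)
  have hcj := analyticAt_coord j (0 : Fin n → ℂ)
  have hYa : AnalyticAt ℂ Y 0 := hci.fun_add (hκa.fun_mul hcj)
  have hZa : AnalyticAt ℂ Z 0 := (hA.fun_mul hci).fun_add (hμa.fun_mul hcj)
  have hψ : AnalyticAt ℂ ψ 0 :=
    analyticAt_update (analyticAt_update analyticAt_id hYa i) hZa j
  have hψi : ∀ x, ψ x i = Y x := fun x => by simp [ψ, hij]
  have hψj : ∀ x, ψ x j = Z x := fun x => by simp [ψ]
  have hψk : ∀ k, k ≠ i → k ≠ j → ∀ x, ψ x k = x k := fun k h1 h2 x => by simp [ψ, h1, h2]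
  have hψw : IsWeightMap w ψ := by
    refine ((isWeightMap_id w).update ?_).update ?_
    · refine (hasWeight_coord i).add ?_
      refine (HasWeight.mul (k := w i - w j) (l := w j) ?_ (hasWeight_coord j)).mono (by omega)
      exact (hCw.mul (hasWeight_of_analyticAt hinv)).mono (by omega)
    · refine HasWeight.add ?_ ?_
      · exact ((hasWeight_of_analyticAt hA).mul (hasWeight_coord i)).mono (by omega)
      · exact ((hasWeight_of_analyticAt hμa).mul (hasWeight_coord j)).mono (by omega)
  obtain ⟨θ, hθ⟩ := exists_biholGerm hψ (by ext k; by_cases h1 : k = i <;> by_cases h2 : k = j <;>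
      simp_all [ψ, Y, Z]) (by
    intro v hv
    have hvk : ∀ k, k ≠ i → k ≠ j → v k = 0 := by
      intro k h1 h2
      have := fderiv_update_apply hψ v k (hψk k h1 h2)
      rw [hv, fderiv_coord] at this
      exact this.symm
    have hY : pderiv i Y 0 = 1 ∧ pderiv j Y 0 = κ 0 := by
      have := pderiv_coord_mul_add_coord_mul hij (R := fun _ => 1) (S := κ)
        (differentiableAt_const _) hκa.differentiableAt
      simpa only [mul_one, mul_comm _ (κ _)] using! this
    have hZ : pderiv i Z 0 = A 0 ∧ pderiv j Z 0 = μ 0 := by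
      have := pderiv_coord_mul_add_coord_mul hij hA.differentiableAt hμa.differentiableAt
      simpa only [mul_comm _ (A _), mul_comm _ (μ _)] using! this
    have h1 := fderiv_update_apply hψ v i hψi
    have h2 := fderiv_update_apply hψ v j hψj
    rw [hv, fderiv_apply_eq_sum_pderiv hYa.differentiableAt, sum_eq_two hij hvk, hY.1, hY.2] at h1
    rw [hv, fderiv_apply_eq_sum_pderiv hZa.differentiableAt, sum_eq_two hij hvk, hZ.1, hZ.2] at h2
    simp only [Pi.zero_apply] at h1 h2
    have hvj : v j = 0 := by
      have : v j * (μ 0 - κ 0 * A 0) = 0 := by linear_combination A 0 * h1 - h2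
      exact (mul_eq_zero.mp this).resolve_right hs0
    have hvi : v i = 0 := by rw [hvj] at h1; linear_combination -h1
    ext k
    by_cases hk1 : k = i
    · rw [hk1, hvi]; rfl
    by_cases hk2 : k = j
    · rw [hk2, hvj]; rfl
    exact hvk k hk1 hk2)
  refine ⟨ψ, θ, hθ, hψw, ?_⟩
  filter_upwards [h, hs2, hne] with x h1 h2 h3
  rw [h1, hψi, hψj, kill_congr (x := ψ x) (y := x) fun k hk1 hk2 => hψk k hk1 hk2 x]
  simp only [Y, Z, hκ, hμ]
  field_simp
  linear_combination (-x i * x j) * h2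

/-- The splitting lemma, compatible with weights. -/
theorem exists_splitting (hij : i ≠ j) {w : Fin n → ℕ} (hw : w j ≤ w i) (hwj : 0 < w j)
    {F : (Fin n → ℂ) → ℂ} (hF : AnalyticAt ℂ F 0) (hFw : HasWeight w (w i + w j) F)
    (hdet : pderiv i (pderiv j F) 0 * pderiv j (pderiv i F) 0 -
      pderiv i (pderiv i F) 0 * pderiv j (pderiv j F) 0 ≠ 0) :
    ∃ ψ θ, BiholGerm ψ θ ∧ IsWeightMap w ψ ∧ ∃ G : (Fin n → ℂ) → ℂ, AnalyticAt ℂ G 0 ∧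
      HasWeight w (w i + w j) G ∧ (∀ x, G (kill i j x) = G x) ∧
      ∀ᶠ x in 𝓝 0, F x = ψ x i * ψ x j + G (ψ x) := by
  have hFi := analyticAt_pderiv i hF
  have hFj := analyticAt_pderiv j hF
  have hFiw : HasWeight w (w j) (pderiv i F) := (hFw.pderiv hF i).mono (by omega)
  have hFjw : HasWeight w (w i) (pderiv j F) := (hFw.pderiv hF j).mono (by omega)
  -- The derivatives are exchanged because `∂ⱼ F` has weight `w i` and `∂ᵢ F` has weight `w j`; this
  -- makes `Φ` weight-compatible. Its inverse carries `x i = x j = 0` to the locus where both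
  -- derivatives vanish.
  let Φ : (Fin n → ℂ) → Fin n → ℂ := fun x =>
    Function.update (Function.update x i (pderiv j F x)) j (pderiv i F x)
  have hΦ : AnalyticAt ℂ Φ 0 := analyticAt_update (analyticAt_update analyticAt_id hFj i) hFi j
  have hΦi : ∀ x, Φ x i = pderiv j F x := fun x => by simp [Φ, hij]
  have hΦj : ∀ x, Φ x j = pderiv i F x := fun x => by simp [Φ]
  have hΦk : ∀ k, k ≠ i → k ≠ j → ∀ x, Φ x k = x k := fun k h1 h2 x => by simp [Φ, h1, h2]
  have hΦw : IsWeightMap w Φ := ((isWeightMap_id w).update hFjw).update hFiw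
  obtain ⟨θ, hθ⟩ := exists_biholGerm hΦ (by
      ext k
      have e1 := hFiw.apply_zero hwj
      have e2 := hFjw.apply_zero (hwj.trans_le hw)
      by_cases h1 : k = i <;> by_cases h2 : k = j <;> simp_all [Φ]) (by
    intro v hv
    have hvk : ∀ k, k ≠ i → k ≠ j → v k = 0 := by
      intro k h1 h2
      have := fderiv_update_apply hΦ v k (hΦk k h1 h2)
      rw [hv, fderiv_coord] at this
      exact this.symm
    have h1 := fderiv_update_apply hΦ v i hΦi
    have h2 := fderiv_update_apply hΦ v j hΦj
    rw [hv, fderiv_apply_eq_sum_pderiv hFj.differentiableAt, sum_eq_two hij hvk] at h1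
    rw [hv, fderiv_apply_eq_sum_pderiv hFi.differentiableAt, sum_eq_two hij hvk] at h2
    simp only [Pi.zero_apply] at h1 h2
    have hvi : v i = 0 := by
      refine (mul_eq_zero.mp (?_ : v i * _ = 0)).resolve_right hdet
      linear_combination -pderiv j (pderiv i F) 0 * h1 + pderiv j (pderiv j F) 0 * h2
    have hvj : v j = 0 := by
      refine (mul_eq_zero.mp (?_ : v j * _ = 0)).resolve_right hdet
      linear_combination pderiv i (pderiv i F) 0 * h1 - pderiv i (pderiv j F) 0 * h2
    ext k
    by_cases hk1 : k = i
    · rw [hk1, hvi]; rfl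
    by_cases hk2 : k = j
    · rw [hk2, hvj]; rfl
    exact hvk k hk1 hk2)
  have hθw : IsWeightMap w θ := hΦw.inv hθ
  have hθk : ∀ k, k ≠ i → k ≠ j → ∀ᶠ x in 𝓝 0, θ x k = x k := by
    intro k h1 h2
    filter_upwards [hθ.right_inv] with x hx
    rw [← hΦk k h1 h2 (θ x), hx]
  -- the shift moving the critical locus to `x i = x j = 0`
  let τ : Fin n → (Fin n → ℂ) → ℂ := fun k x => θ (kill i j x) k
  have hτ : ∀ k, AnalyticAt ℂ (τ k) 0 := fun k => AnalyticAt.coord (AnalyticAt.fun_comp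
    (by rw [kill_zero]; exact hθ.analytic_inv) (analyticAt_kill i j 0)) k
  have hτw : ∀ k, HasWeight w (w k) (τ k) := fun k =>
    (hθw k).comp (isWeightMap_kill w i j) (kill_zero i j)
  have hτ0 : ∀ k, τ k 0 = 0 := fun k => by simp [τ, kill_zero, hθ.map_zero_inv]
  let shift : ℂ → (Fin n → ℂ) → Fin n → ℂ := fun c x =>
    Function.update (Function.update x i (x i + c * τ i x)) j (x j + c * τ j x)
  have hshift : ∀ c, AnalyticAt ℂ (shift c) 0 := fun c =>
    analyticAt_update (analyticAt_update analyticAt_id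
      ((analyticAt_coord i 0).fun_add (analyticAt_const.fun_mul (hτ i))) i)
      ((analyticAt_coord j 0).fun_add (analyticAt_const.fun_mul (hτ j))) j
  have hshiftw : ∀ c, IsWeightMap w (shift c) := fun c => by
    refine ((isWeightMap_id w).update ?_).update ?_
    · exact (hasWeight_coord i).add
        (((hasWeight_of_analyticAt analyticAt_const).mul (hτw i)).mono (by omega))
    · exact (hasWeight_coord j).add
        (((hasWeight_of_analyticAt analyticAt_const).mul (hτw j)).mono (by omega))
  have hshiftk : ∀ c x, kill i j (shift c x) = kill i j x := fun c x =>
    kill_congr fun k h1 h2 => by simp [shift, h1, h2]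
  have hτshift : ∀ k c x, τ k (shift c x) = τ k x := fun k c x => by simp only [τ, hshiftk]
  have hcancel : ∀ c x, shift (-c) (shift c x) = x := by
    intro c x
    ext k
    simp only [shift] at hτshift ⊢
    by_cases h2 : k = j
    · subst h2; simp [hτshift]
    by_cases h1 : k = i
    · subst h1; simp [h2, hτshift]
    simp [h1, h2]
  have hshift0 : ∀ c, shift c 0 = 0 := by
    intro c
    ext k
    by_cases h1 : k = i <;> by_cases h2 : k = j <;> simp_all [shift]
  let σ := shift 1
  have hσ : BiholGerm σ (shift (-1)) := ⟨hshift 1, hshift (-1), hshift0 1, hshift0 (-1),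
    .of_forall fun x => hcancel 1 x, .of_forall fun x => by simpa using hcancel (-1) x⟩
  let F' : (Fin n → ℂ) → ℂ := fun x => F (σ x)
  have hF' : AnalyticAt ℂ F' 0 := AnalyticAt.fun_comp (by rwa [hσ.map_zero]) hσ.analytic
  have htr : ∀ k, (k = i ∨ k = j) → ∀ x (t : ℂ),
      σ (x + t • (Pi.single k 1 : Fin n → ℂ)) = σ x + t • Pi.single k 1 := by
    intro k hk x t
    have hkill : kill i j (x + t • (Pi.single k 1 : Fin n → ℂ)) = kill i j x := by
      rcases hk with rfl | rfl
      · exact kill_add_single_left x t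
      · exact kill_add_single_right x t
    ext l
    by_cases h2 : l = j
    · subst h2; simp only [σ, shift, τ, hkill]; simp; ring
    by_cases h1 : l = i
    · subst h1; simp only [σ, shift, τ, hkill]; simp [h2]; ring
    simp [σ, shift, h1, h2]
  have hpd : ∀ k, (k = i ∨ k = j) → ∀ H : (Fin n → ℂ) → ℂ,
      pderiv k (fun x => H (σ x)) = fun x => pderiv k H (σ x) := fun k hk H =>
    funext fun x => pderiv_comp_of_translate k H (htr k hk) x
  have hcrit : ∀ᶠ x in 𝓝 0, σ (kill i j x) = θ (kill i j x) := by
    have hk : Tendsto (kill i j) (𝓝 0) (𝓝 0) :=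
      tendsto_of_analyticAt (analyticAt_kill i j 0) (kill_zero i j)
    have hall : ∀ᶠ x in 𝓝 0, ∀ k, k ≠ i → k ≠ j → θ (kill i j x) k = kill i j x k :=
      Filter.eventually_all.mpr fun k => by
        by_cases h1 : k = i
        · simp [h1]
        by_cases h2 : k = j
        · simp [h2]
        filter_upwards [hk.eventually (hθk k h1 h2)] with x hx _ _ using hx
    filter_upwards [hall] with x hx
    ext k
    by_cases h2 : k = j
    · subst h2; simp [σ, shift, τ, kill_kill]; simp [kill_apply]
    by_cases h1 : k = i
    · subst h1; simp [σ, shift, τ, kill_kill, h2]; simp [kill_apply]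
    rw [hx k h1 h2]
    simp [σ, shift, h1, h2]
  have hkt : Tendsto (kill i j) (𝓝 0) (𝓝 0) :=
    tendsto_of_analyticAt (analyticAt_kill i j 0) (kill_zero i j)
  have hi' : ∀ᶠ x in 𝓝 0, pderiv i F' (kill i j x) = 0 := by
    filter_upwards [hcrit, hkt.eventually hθ.right_inv] with x h1 h2
    rw [hpd i (Or.inl rfl)]
    beta_reduce
    rw [h1, ← hΦj, h2]
    simp [kill_apply]
  have hj' : ∀ᶠ x in 𝓝 0, pderiv j F' (kill i j x) = 0 := by
    filter_upwards [hcrit, hkt.eventually hθ.right_inv] with x h1 h2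
    rw [hpd j (Or.inr rfl)]
    beta_reduce
    rw [h1, ← hΦi, h2]
    simp [kill_apply]
  have hF'w : HasWeight w (w i + w j) F' := hFw.comp (hshiftw 1) hσ.map_zero
  -- The shift commutes with translations along the axes `i` and `j` and fixes `0`, so `F'` has the
  -- same second derivatives in these directions as `F`.
  obtain ⟨ψ, ψ', hψ, hψw, h⟩ := exists_morse_chart hij hw hF' hF'w hi' hj' (by
    rw [hpd i (Or.inl rfl), hpd j (Or.inr rfl), hpd i (Or.inl rfl) (pderiv j F),
      hpd i (Or.inl rfl) (pderiv i F), hpd j (Or.inr rfl) (pderiv j F),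
      hpd j (Or.inr rfl) (pderiv i F)]
    simp only [hσ.map_zero]
    exact hdet)
  refine ⟨_, _, hσ.symm.trans hψ, hψw.comp (hshiftw (-1)) hσ.map_zero_inv,
    fun x => F' (kill i j x), AnalyticAt.fun_comp (by rwa [kill_zero]) (analyticAt_kill i j 0),
    hF'w.comp (isWeightMap_kill w i j) (kill_zero i j), fun x => by simp only [kill_kill], ?_⟩
  filter_upwards [hσ.symm.tendsto.eventually h] with x hx
  rw [← hx]
  change F x = F (shift 1 (shift (-1) x))
  have := hcancel (-1) x
  rw [neg_neg] at this
  rw [this]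

end Splitting

/-! ### Lifting weight-compatible biholomorphic maps to weighted blowups -/

section Lift

variable {n : ℕ} {w : Fin n → ℕ}

/-- The point `(u ^ w₁ x₁, …, u ^ wₙ xₙ)`. -/
def wsmul (w : Fin n → ℕ) (u : ℂ) (x : Fin n → ℂ) : Fin n → ℂ := fun i => u ^ w i * x i

lemma dilate_cons (u : ℂ) (x : Fin n → ℂ) : dilate w (Fin.cons u x) = wsmul w u x := rfl

lemma wsmul_wsmul (u v : ℂ) (x : Fin n → ℂ) : wsmul w u (wsmul w v x) = wsmul w (u * v) x := by
  ext i; simp [wsmul, mul_pow, mul_assoc]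

lemma wsmul_one (x : Fin n → ℂ) : wsmul w 1 x = x := by
  ext i; simp [wsmul]

lemma wsmul_zero_left (hw : ∀ i, 0 < w i) (x : Fin n → ℂ) : wsmul w 0 x = 0 := by
  ext i; simp [wsmul, (hw i).ne']

lemma wsmul_zero_right (u : ℂ) : wsmul w u 0 = 0 := by
  ext i; simp [wsmul]

lemma wsmul_ne_zero {u : ℂ} (hu : u ≠ 0) {x : Fin n → ℂ} (hx : x ≠ 0) : wsmul w u x ≠ 0 := by
  intro h
  apply hx
  rw [← wsmul_one (w := w) x, ← inv_mul_cancel₀ hu, ← wsmul_wsmul, h, wsmul_zero_right]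

lemma analyticAt_wsmul {E : Type*} [NormedAddCommGroup E] [NormedSpace ℂ E] {u : E → ℂ}
    {x : E → Fin n → ℂ} {a : E} (hu : AnalyticAt ℂ u a) (hx : AnalyticAt ℂ x a) :
    AnalyticAt ℂ (fun p => wsmul w (u p) (x p)) a :=
  AnalyticAt.pi fun i => (hu.fun_pow _).fun_mul ((analyticAt_coord i _).fun_comp hx)

lemma continuous_wsmul : Continuous fun p : ℂ × (Fin n → ℂ) => wsmul w p.1 p.2 :=
  continuous_pi fun i => (continuous_fst.pow _).mul ((continuous_apply i).comp continuous_snd)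

/-- The lift `(u, x) ↦ u⁻ʷ ψ(uʷ x)` of a weight-compatible map `ψ`, extended to `u = 0` by
continuity. -/
noncomputable def lift (w : Fin n → ℕ) (ψ : (Fin n → ℂ) → Fin n → ℂ) (p : ℂ × (Fin n → ℂ)) :
    Fin n → ℂ :=
  open Classical in
  if p.1 = 0 then limUnder (𝓝[≠] 0) fun t : ℂ => wsmul w t⁻¹ (ψ (wsmul w t p.2))
  else wsmul w p.1⁻¹ (ψ (wsmul w p.1 p.2))

lemma lift_of_ne {ψ : (Fin n → ℂ) → Fin n → ℂ} {u : ℂ} (hu : u ≠ 0) (x : Fin n → ℂ) :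
    lift w ψ (u, x) = wsmul w u⁻¹ (ψ (wsmul w u x)) := by
  simp [lift, hu]

lemma analyticAt_lift_of_ne {ψ : (Fin n → ℂ) → Fin n → ℂ} {u : ℂ} {x : Fin n → ℂ} (hu : u ≠ 0)
    (hψ : AnalyticAt ℂ ψ (wsmul w u x)) : AnalyticAt ℂ (lift w ψ) (u, x) := by
  have h1 : AnalyticAt ℂ (fun p : ℂ × (Fin n → ℂ) => wsmul w p.1⁻¹ (ψ (wsmul w p.1 p.2)))
      (u, x) :=
    analyticAt_wsmul (analyticAt_fst.fun_inv hu)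
      (AnalyticAt.fun_comp hψ (analyticAt_wsmul analyticAt_fst analyticAt_snd))
  refine h1.congr ?_
  filter_upwards [continuousAt_fst.eventually_ne hu] with p hp
  exact (lift_of_ne hp p.2).symm

/-- The weight condition controls `ψ` only near the origin of `(u, x)`-space, whereas `x` is
arbitrary here. Acting by a small `l ≠ 0` moves `(0, x)` close to the origin, and acting by `l⁻¹` on
the result gives an analytic function `K` that agrees with the lift. -/
lemma analyticAt_lift_zero (hw : ∀ i, 0 < w i) {ψ : (Fin n → ℂ) → Fin n → ℂ}
    (hψ : IsWeightMap w ψ) (x : Fin n → ℂ) : AnalyticAt ℂ (lift w ψ) (0, x) := by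
  choose H hH h using hψ
  have hcons : ∀ l : ℂ, AnalyticAt ℂ (fun p : ℂ × (Fin n → ℂ) =>
      (Fin.cons (l⁻¹ * p.1) (wsmul w l p.2) : Fin (n + 1) → ℂ)) (0, x) := by
    intro l
    refine AnalyticAt.pi fun j => Fin.cases ?_ (fun i => ?_) j
    · exact analyticAt_const.fun_mul analyticAt_fst
    · exact (analyticAt_coord i _).fun_comp (analyticAt_wsmul analyticAt_const analyticAt_snd)
  have hlim : Tendsto (fun l : ℂ => (Fin.cons 0 (wsmul w l x) : Fin (n + 1) → ℂ)) (𝓝 0) (𝓝 0) := by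
    have hc : Continuous (fun l : ℂ => (Fin.cons 0 (wsmul w l x) : Fin (n + 1) → ℂ)) := by
      refine continuous_pi fun j => Fin.cases continuous_const (fun i => ?_) j
      exact (continuous_id.pow _).mul continuous_const
    have := hc.tendsto 0
    rw [wsmul_zero_left hw] at this
    convert! this using 2
    ext j
    exact Fin.cases rfl (fun i => rfl) j
  have hgood : ∀ᶠ p in 𝓝 (0 : Fin (n + 1) → ℂ), ∀ i, AnalyticAt ℂ (H i) p ∧
      ψ (dilate w p) i = p 0 ^ w i * H i p :=
    Filter.eventually_all.mpr fun i => (hH i).eventually_analyticAt.and (h i)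
  obtain ⟨l, hl, hl0⟩ := (((hlim.eventually hgood.eventually_nhds).filter_mono
    nhdsWithin_le_nhds).and (self_mem_nhdsWithin (s := {0}ᶜ))).exists
  replace hl0 : l ≠ 0 := hl0
  let K : ℂ × (Fin n → ℂ) → Fin n → ℂ := fun p =>
    wsmul w l⁻¹ fun i => H i (Fin.cons (l⁻¹ * p.1) (wsmul w l p.2))
  have hnear : ∀ᶠ p in 𝓝 ((0 : ℂ), x), ∀ i,
      AnalyticAt ℂ (H i) (Fin.cons (l⁻¹ * p.1) (wsmul w l p.2)) ∧
      ψ (wsmul w p.1 p.2) i = (l⁻¹ * p.1) ^ w i * H i (Fin.cons (l⁻¹ * p.1) (wsmul w l p.2)) := by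
    have := (hcons l).continuousAt.tendsto
    simp only [mul_zero] at this
    filter_upwards [this.eventually hl] with p hp i
    refine ⟨(hp i).1, ?_⟩
    have e := (hp i).2
    rw [dilate_cons, wsmul_wsmul, mul_right_comm, inv_mul_cancel₀ hl0, one_mul] at e
    exact e
  have hK : ∀ᶠ p in 𝓝 ((0 : ℂ), x), AnalyticAt ℂ K p := by
    filter_upwards [hnear] with p hp
    refine analyticAt_wsmul analyticAt_const (AnalyticAt.pi fun i => ?_)
    refine AnalyticAt.fun_comp (hp i).1 ?_
    refine AnalyticAt.pi fun j => Fin.cases ?_ (fun i => ?_) j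
    · exact analyticAt_const.fun_mul analyticAt_fst
    · exact (analyticAt_coord i _).fun_comp (analyticAt_wsmul analyticAt_const analyticAt_snd)
  have hKeq : ∀ᶠ p in 𝓝 ((0 : ℂ), x), p.1 ≠ 0 → wsmul w p.1⁻¹ (ψ (wsmul w p.1 p.2)) = K p := by
    filter_upwards [hnear] with p hp hp0
    ext i
    simp only [wsmul, K]
    have e := (hp i).2
    rw [e, ← mul_assoc, ← mul_pow, mul_comm l⁻¹ p.1, inv_mul_cancel_left₀ hp0]
  refine hK.self_of_nhds.congr ?_
  filter_upwards [hK, hKeq, hKeq.eventually_nhds] with p hp1 hp2 hp3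
  obtain ⟨u, y⟩ := p
  rcases eq_or_ne u 0 with rfl | hu
  · have ht : Tendsto (fun t : ℂ => (t, y)) (𝓝[≠] 0) (𝓝 ((0 : ℂ), y)) := by
      have : Continuous fun t : ℂ => (t, y) := by fun_prop
      exact (this.tendsto 0).mono_left nhdsWithin_le_nhds
    have h1 : Tendsto (fun t : ℂ => wsmul w t⁻¹ (ψ (wsmul w t y))) (𝓝[≠] 0) (𝓝 (K (0, y))) := by
      refine (hp1.continuousAt.tendsto.comp ht).congr' ?_
      filter_upwards [ht.eventually hp3, self_mem_nhdsWithin] with t h1 h2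
      exact (h1 h2).symm
    simp only [lift, if_true]
    exact h1.limUnder_eq.symm
  · rw [lift_of_ne hu]
    exact (hp2 hu).symm

lemma eq_of_eventually_line {Y : Type*} [TopologicalSpace Y] [T2Space Y] {F G : ℂ → Y}
    (hF : ContinuousAt F 0) (hG : ContinuousAt G 0) (h : ∀ᶠ t in 𝓝 0, t ≠ 0 → F t = G t) :
    F 0 = G 0 := by
  refine eq_of_frequently_eq hF hG ?_
  have : ∀ᶠ t in 𝓝[≠] (0 : ℂ), F t = G t := by
    filter_upwards [h.filter_mono nhdsWithin_le_nhds, self_mem_nhdsWithin] with t h1 h2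
    exact h1 h2
  exact this.frequently.filter_mono nhdsWithin_le_nhds

/-- The lift is equivariant. -/
lemma lift_smul (hw : ∀ i, 0 < w i) {ψ : (Fin n → ℂ) → Fin n → ℂ} (hψ : IsWeightMap w ψ)
    {l : ℂ} (hl : l ≠ 0) (u : ℂ) (x : Fin n → ℂ) :
    lift w ψ (l⁻¹ * u, wsmul w l x) = wsmul w l (lift w ψ (u, x)) := by
  have hne : ∀ t : ℂ, t ≠ 0 →
      lift w ψ (l⁻¹ * t, wsmul w l x) = wsmul w l (lift w ψ (t, x)) := by
    intro t ht
    rw [lift_of_ne ht, lift_of_ne (mul_ne_zero (inv_ne_zero hl) ht), wsmul_wsmul, wsmul_wsmul,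
      mul_inv, inv_inv, mul_right_comm, inv_mul_cancel₀ hl, one_mul]
  rcases eq_or_ne u 0 with rfl | hu
  · refine eq_of_eventually_line (F := fun t => lift w ψ (l⁻¹ * t, wsmul w l x))
      (G := fun t => wsmul w l (lift w ψ (t, x))) ?_ ?_ (.of_forall hne)
    · refine ContinuousAt.comp' (f := fun t : ℂ => (l⁻¹ * t, wsmul w l x)) ?_ (by fun_prop)
      rw [mul_zero]
      exact (analyticAt_lift_zero hw hψ _).continuousAt
    · have h1 : ContinuousAt (fun t : ℂ => lift w ψ (t, x)) 0 :=
        ContinuousAt.comp' (f := fun t : ℂ => (t, x))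
          (analyticAt_lift_zero hw hψ _).continuousAt (by fun_prop)
      have h2 : Continuous fun y : Fin n → ℂ => wsmul w l y :=
        continuous_wsmul.comp (by fun_prop : Continuous fun y : Fin n → ℂ => (l, y))
      exact h2.continuousAt.comp' h1
  · exact hne u hu

lemma lift_zero_right {θ : (Fin n → ℂ) → Fin n → ℂ} (hθ : θ 0 = 0) (u : ℂ) :
    lift w θ (u, 0) = 0 := by
  rcases eq_or_ne u 0 with rfl | hu
  · have : Tendsto (fun _ : ℂ => (0 : Fin n → ℂ)) (𝓝[≠] 0) (𝓝 0) := tendsto_const_nhds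
    simp only [lift, if_true, wsmul_zero_right, hθ]
    exact this.limUnder_eq
  · rw [lift_of_ne hu, wsmul_zero_right, hθ, wsmul_zero_right]

end Lift

/-- A weight-compatible biholomorphic map `ψ : U → U'` with inverse `θ` which maps `Z` to `Z'`. -/
structure LocalIso {n : ℕ} (w : Fin n → ℕ) (Z Z' U U' : Set (Fin n → ℂ))
    (ψ θ : (Fin n → ℂ) → Fin n → ℂ) : Prop where
  weight_pos : ∀ i, 0 < w i
  isOpen : IsOpen U
  isOpen' : IsOpen U'
  zero_mem : 0 ∈ U
  zero_mem' : 0 ∈ U'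
  map_zero : ψ 0 = 0
  map_zero' : θ 0 = 0
  mapsTo : Set.MapsTo ψ U U'
  mapsTo' : Set.MapsTo θ U' U
  left_inv : ∀ x ∈ U, θ (ψ x) = x
  right_inv : ∀ y ∈ U', ψ (θ y) = y
  analytic : ∀ x ∈ U, AnalyticAt ℂ ψ x
  analytic' : ∀ y ∈ U', AnalyticAt ℂ θ y
  weight : IsWeightMap w ψ
  weight' : IsWeightMap w θ
  map_mem : ∀ x ∈ U, x ∈ Z → ψ x ∈ Z'
  map_mem' : ∀ y ∈ U', y ∈ Z' → θ y ∈ Z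

/-- A homeomorphism between subsets given by maps of the ambient spaces. -/
def homeomorphOfMapsTo {M N : Type*} [TopologicalSpace M] [TopologicalSpace N] {A : Set M}
    {B : Set N} (f : M → N) (g : N → M) (hf : ∀ x ∈ A, ContinuousAt f x)
    (hg : ∀ y ∈ B, ContinuousAt g y) (hAB : Set.MapsTo f A B) (hBA : Set.MapsTo g B A)
    (hgf : ∀ x ∈ A, g (f x) = x) (hfg : ∀ y ∈ B, f (g y) = y) : A ≃ₜ B where
  toFun x := ⟨f x, hAB x.2⟩
  invFun y := ⟨g y, hBA y.2⟩
  left_inv x := Subtype.ext (hgf x x.2)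
  right_inv y := Subtype.ext (hfg y y.2)
  continuous_toFun := Continuous.subtype_mk (f := fun x : A => f x)
    (continuous_iff_continuousAt.mpr fun x => (hf x x.2).comp' continuousAt_subtype_val) _
  continuous_invFun := Continuous.subtype_mk (f := fun y : B => g y)
    (continuous_iff_continuousAt.mpr fun y => (hg y y.2).comp' continuousAt_subtype_val) _

lemma HolAtOn.comp_homeomorph {M N : Type*} [TopologicalSpace M] [TopologicalSpace N]
    {O : (M → ℂ) → M → Prop} {O' : (N → ℂ) → N → Prop} {A : Set M} {B : Set N} (e : A ≃ₜ B)
    (f : M → N) (hf : ∀ x : A, f x = e x)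
    (hO : ∀ (x : A) (H : N → ℂ), O' H (f x) → O (H ∘ f) x) {p : A} {h : B → ℂ}
    (hh : HolAtOn O' B h (e p)) : HolAtOn O A (h ∘ e) p := by
  obtain ⟨H, hH, h1⟩ := hh
  refine ⟨H ∘ f, hO p H (by rwa [hf]), ?_⟩
  filter_upwards [e.continuous.continuousAt.eventually h1] with q hq
  rw [Function.comp_apply, hf, hq, Function.comp_apply]

/-- Holomorphic functions on `A` and `B` are local restrictions of ambient ones, so it is enough
that ambient extensions of `e` and of its inverse pull ambient holomorphic functions back to such.
-/
lemma isBiholomorphic_of_extends {M N : Type*} [TopologicalSpace M] [TopologicalSpace N]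
    {O : (M → ℂ) → M → Prop} {O' : (N → ℂ) → N → Prop} {A : Set M} {B : Set N} (e : A ≃ₜ B)
    (f : M → N) (g : N → M) (hf : ∀ x : A, f x = e x) (hg : ∀ y : B, g y = e.symm y)
    (hO : ∀ (x : A) (H : N → ℂ), O' H (f x) → O (H ∘ f) x)
    (hO' : ∀ (y : B) (H : M → ℂ), O H (g y) → O' (H ∘ g) y) : IsBiholomorphic O O' e := by
  intro p h
  refine ⟨HolAtOn.comp_homeomorph e f hf hO, fun hh => ?_⟩
  have h2 : HolAtOn O A (h ∘ e) (e.symm (e p)) := by rwa [e.symm_apply_apply]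
  have := HolAtOn.comp_homeomorph e.symm g hg hO' h2
  convert! this using 1
  ext y
  simp

/-! ### The map induced on weighted blowups. -/

section BlowupMap

variable {n : ℕ} {w : Fin n → ℕ}

/-- The map of the cover of the weighted blowup lifting `ψ`. -/
noncomputable def coverMap (w : Fin n → ℕ) (ψ : (Fin n → ℂ) → Fin n → ℂ) (p : BlowupCover n) :
    BlowupCover n :=
  open Classical in
  if h : lift w ψ p.1 ≠ 0 then ⟨(p.1.1, lift w ψ p.1), h⟩ else p

lemma coverMap_of_ne {ψ : (Fin n → ℂ) → Fin n → ℂ} {p : BlowupCover n} (h : lift w ψ p.1 ≠ 0) :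
    coverMap w ψ p = ⟨(p.1.1, lift w ψ p.1), h⟩ := dif_pos h

lemma mk_eq_mk_iff (p q : BlowupCover n) : Blowup.mk w p = Blowup.mk w q ↔
    ∃ l : ℂ, l ≠ 0 ∧ q.1.1 = l⁻¹ * p.1.1 ∧ q.1.2 = wsmul w l p.1.2 := by
  refine Quotient.eq.trans (exists_congr fun l => ?_)
  simp [funext_iff, wsmul]

lemma mk_surjective : Function.Surjective (Blowup.mk w) := Quotient.mk_surjective

lemma proj_mk (p : BlowupCover n) : Blowup.proj w (Blowup.mk w p) = wsmul w p.1.1 p.1.2 := rfl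

lemma mk_coverMap_congr (hw : ∀ i, 0 < w i) {ψ : (Fin n → ℂ) → Fin n → ℂ} (hψ : IsWeightMap w ψ)
    {p q : BlowupCover n} (h : Blowup.mk w p = Blowup.mk w q) :
    Blowup.mk w (coverMap w ψ p) = Blowup.mk w (coverMap w ψ q) := by
  obtain ⟨l, hl, h1, h2⟩ := (mk_eq_mk_iff p q).mp h
  have hq : lift w ψ q.1 = wsmul w l (lift w ψ p.1) := by
    rw [← lift_smul hw hψ hl, ← h1, ← h2]
  -- Where the lift vanishes, `coverMap` is the identity by default, which is still compatible with
  -- orbits. Over the domain of a local isomorphism this case does not occur.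
  by_cases hp : lift w ψ p.1 = 0
  · have hq0 : lift w ψ q.1 = 0 := by rw [hq, hp, wsmul_zero_right]
    simpa [coverMap, hp, hq0] using h
  · rw [coverMap_of_ne hp, coverMap_of_ne (by rw [hq]; exact wsmul_ne_zero hl hp)]
    exact (mk_eq_mk_iff _ _).mpr ⟨l, hl, h1, hq⟩

open Classical in
/-- The map of weighted blowups lifting a weight-compatible map `ψ`. -/
noncomputable def blowupMap (w : Fin n → ℕ) (ψ : (Fin n → ℂ) → Fin n → ℂ) (q : Blowup w) :
    Blowup w :=
  Blowup.mk w (coverMap w ψ (Function.surjInv mk_surjective q))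

lemma blowupMap_mk (hw : ∀ i, 0 < w i) {ψ : (Fin n → ℂ) → Fin n → ℂ} (hψ : IsWeightMap w ψ)
    (p : BlowupCover n) : blowupMap w ψ (Blowup.mk w p) = Blowup.mk w (coverMap w ψ p) :=
  mk_coverMap_congr hw hψ (Function.surjInv_eq mk_surjective _)

lemma isQuotientMap_mk : IsQuotientMap (Blowup.mk w) :=
  isQuotientMap_quotient_mk' (s := blowupSetoid w)

lemma continuous_proj : Continuous (Blowup.proj w) := by
  rw [isQuotientMap_mk.continuous_iff]
  exact continuous_wsmul.comp continuous_subtype_val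

/-- The saturation of an open set is the union of its translates under `ℂ*`. Openness is what lets
continuity at a point of the blowup be checked on the cover. -/
lemma isOpenMap_mk : IsOpenMap (Blowup.mk w) := by
  intro V hV
  rw [← isQuotientMap_mk.isOpen_preimage]
  have : Blowup.mk w ⁻¹' (Blowup.mk w '' V) = ⋃ l : {l : ℂ // l ≠ 0},
      (fun p : BlowupCover n =>
        (⟨(l.1⁻¹ * p.1.1, wsmul w l.1 p.1.2), wsmul_ne_zero l.2 p.2⟩ : BlowupCover n)) ⁻¹' V := by
    ext p
    simp only [Set.mem_preimage, Set.mem_image, Set.mem_iUnion]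
    constructor
    · rintro ⟨q, hq, h⟩
      obtain ⟨l, hl, h1, h2⟩ := (mk_eq_mk_iff p q).mp h.symm
      refine ⟨⟨l, hl⟩, ?_⟩
      convert! hq using 1
      exact Subtype.ext (Prod.ext h1.symm h2.symm)
    · rintro ⟨l, hl⟩
      exact ⟨_, hl, ((mk_eq_mk_iff _ _).mpr ⟨l.1, l.2, rfl, rfl⟩).symm⟩
  rw [this]
  refine isOpen_iUnion fun l => hV.preimage ?_
  refine Continuous.subtype_mk ?_ _
  refine Continuous.prodMk (by fun_prop) ?_
  exact continuous_wsmul.comp (by fun_prop : Continuous fun p : BlowupCover n => (l.1, p.1.2))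

end BlowupMap

/-! ### Local isomorphisms acting on strict transforms. -/

namespace LocalIso

variable {n : ℕ} {w : Fin n → ℕ} {Z Z' U U' : Set (Fin n → ℂ)} {ψ θ : (Fin n → ℂ) → Fin n → ℂ}

lemma symm (h : LocalIso w Z Z' U U' ψ θ) : LocalIso w Z' Z U' U θ ψ :=
  ⟨h.weight_pos, h.isOpen', h.isOpen, h.zero_mem', h.zero_mem, h.map_zero', h.map_zero, h.mapsTo',
    h.mapsTo, h.right_inv, h.left_inv, h.analytic', h.analytic, h.weight', h.weight, h.map_mem',
    h.map_mem⟩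

lemma analyticAt_lift (h : LocalIso w Z Z' U U' ψ θ) {u : ℂ} {x : Fin n → ℂ}
    (hx : wsmul w u x ∈ U) : AnalyticAt ℂ (lift w ψ) (u, x) := by
  rcases eq_or_ne u 0 with rfl | hu
  · exact analyticAt_lift_zero h.weight_pos h.weight x
  · exact analyticAt_lift_of_ne hu (h.analytic _ hx)

lemma wsmul_lift (h : LocalIso w Z Z' U U' ψ θ) (u : ℂ) (x : Fin n → ℂ) :
    wsmul w u (lift w ψ (u, x)) = ψ (wsmul w u x) := by
  rcases eq_or_ne u 0 with rfl | hu
  · rw [wsmul_zero_left h.weight_pos, wsmul_zero_left h.weight_pos, h.map_zero]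
  · rw [lift_of_ne hu, wsmul_wsmul, mul_inv_cancel₀ hu, wsmul_one]

/-- A direct computation for `u ≠ 0`; the exceptional divisor `u = 0` follows by continuity. -/
lemma lift_lift (h : LocalIso w Z Z' U U' ψ θ) {u : ℂ} {x : Fin n → ℂ}
    (hx : wsmul w u x ∈ U) : lift w θ (u, lift w ψ (u, x)) = x := by
  have hne : ∀ t : ℂ, t ≠ 0 → wsmul w t x ∈ U → lift w θ (t, lift w ψ (t, x)) = x := by
    intro t ht hU
    rw [lift_of_ne ht, h.wsmul_lift, h.left_inv _ hU, wsmul_wsmul, inv_mul_cancel₀ ht, wsmul_one]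
  rcases eq_or_ne u 0 with rfl | hu
  · refine eq_of_eventually_line (F := fun t => lift w θ (t, lift w ψ (t, x)))
      (G := fun _ => x) ?_ continuousAt_const ?_
    · refine ContinuousAt.comp' (f := fun t : ℂ => (t, lift w ψ (t, x)))
        (analyticAt_lift_zero h.weight_pos h.weight' _).continuousAt ?_
      refine continuousAt_id.prodMk ?_
      exact ContinuousAt.comp' (f := fun t : ℂ => (t, x))
        (analyticAt_lift_zero h.weight_pos h.weight _).continuousAt (by fun_prop)
    · have hc : Continuous fun t : ℂ => wsmul w t x :=
        continuous_wsmul.comp (by fun_prop : Continuous fun t : ℂ => (t, x))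
      filter_upwards [hc.continuousAt.eventually (h.isOpen.mem_nhds hx)] with t h1 h2
      exact hne t h2 h1
  · exact hne u hu hx

/-- The lift of `θ` fixes `x = 0`, so it could not recover a nonzero `x` from `0`. Hence the lifted
map stays in the cover. -/
lemma lift_ne_zero (h : LocalIso w Z Z' U U' ψ θ) {u : ℂ} {x : Fin n → ℂ}
    (hx : wsmul w u x ∈ U) (hx0 : x ≠ 0) : lift w ψ (u, x) ≠ 0 := by
  intro h0
  have := h.lift_lift hx
  rw [h0, lift_zero_right h.map_zero'] at this
  exact hx0 this.symm

lemma blowupMap_mk (h : LocalIso w Z Z' U U' ψ θ) {p : BlowupCover n}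
    (hp : wsmul w p.1.1 p.1.2 ∈ U) : blowupMap w ψ (Blowup.mk w p) =
      Blowup.mk w ⟨(p.1.1, lift w ψ p.1), h.lift_ne_zero hp p.2⟩ := by
  rw [Kawakita.blowupMap_mk h.weight_pos h.weight, coverMap_of_ne (h.lift_ne_zero hp p.2)]

lemma proj_blowupMap (h : LocalIso w Z Z' U U' ψ θ) {q : Blowup w} (hq : Blowup.proj w q ∈ U) :
    Blowup.proj w (blowupMap w ψ q) = ψ (Blowup.proj w q) := by
  obtain ⟨p, rfl⟩ := mk_surjective q
  rw [h.blowupMap_mk hq, proj_mk, proj_mk, h.wsmul_lift]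

lemma blowupMap_blowupMap (h : LocalIso w Z Z' U U' ψ θ) {q : Blowup w}
    (hq : Blowup.proj w q ∈ U) : blowupMap w θ (blowupMap w ψ q) = q := by
  obtain ⟨p, rfl⟩ := mk_surjective q
  have h1 := h.proj_blowupMap hq
  rw [h.blowupMap_mk hq] at h1 ⊢
  rw [h.symm.blowupMap_mk (by rw [← proj_mk, h1]; exact h.mapsTo hq)]
  congr 1
  exact Subtype.ext (Prod.ext rfl (h.lift_lift hq))

lemma continuousAt_blowupMap (h : LocalIso w Z Z' U U' ψ θ) {q : Blowup w}
    (hq : Blowup.proj w q ∈ U) : ContinuousAt (blowupMap w ψ) q := by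
  obtain ⟨p, rfl⟩ := mk_surjective q
  have h1 : ContinuousAt (coverMap w ψ) p := by
    have hl : ContinuousAt (fun p : BlowupCover n => lift w ψ p.1) p :=
      ContinuousAt.comp' (h.analyticAt_lift hq).continuousAt continuousAt_subtype_val
    have hind : IsInducing (Subtype.val : BlowupCover n → ℂ × (Fin n → ℂ)) := .subtypeVal
    rw [hind.continuousAt_iff]
    refine ContinuousAt.congr (f := fun p : BlowupCover n => (p.1.1, lift w ψ p.1)) ?_ ?_
    · exact (continuous_fst.comp continuous_subtype_val).continuousAt.prodMk hl
    · filter_upwards [hl.eventually_ne (h.lift_ne_zero hq p.2)] with p' hp'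
      rw [Function.comp_apply, coverMap_of_ne hp']
  rw [ContinuousAt, ← isOpenMap_mk.map_nhds_eq isQuotientMap_mk.continuous.continuousAt,
    tendsto_map'_iff, Kawakita.blowupMap_mk h.weight_pos h.weight]
  have h2 : blowupMap w ψ ∘ Blowup.mk w = Blowup.mk w ∘ coverMap w ψ :=
    funext fun p => Kawakita.blowupMap_mk h.weight_pos h.weight p
  rw [h2]
  exact isQuotientMap_mk.continuous.continuousAt.comp h1

lemma holAt_comp_blowupMap (h : LocalIso w Z Z' U U' ψ θ) {q : Blowup w}
    (hq : Blowup.proj w q ∈ U) {H : Blowup w → ℂ} (hH : Blowup.HolAt w H (blowupMap w ψ q)) :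
    Blowup.HolAt w (H ∘ blowupMap w ψ) q := by
  rintro p rfl
  rw [h.blowupMap_mk hq] at hH
  have h1 := hH _ rfl
  have hl := h.analyticAt_lift hq
  have h2 : AnalyticAt ℂ (fun p : ℂ × (Fin n → ℂ) =>
      Function.extend Subtype.val (H ∘ Blowup.mk w) 0 (p.1, lift w ψ p)) p.1 :=
    AnalyticAt.fun_comp (f := fun p : ℂ × (Fin n → ℂ) => (p.1, lift w ψ p)) h1
      (analyticAt_fst.prod hl)
  refine h2.congr ?_
  filter_upwards [hl.continuousAt.eventually_ne (h.lift_ne_zero hq p.2),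
    continuousAt_snd.eventually_ne p.2] with p' h3 h4
  have e1 := Subtype.val_injective.extend_apply (H ∘ Blowup.mk w) 0
    (⟨(p'.1, lift w ψ p'), h3⟩ : BlowupCover n)
  have e2 := Subtype.val_injective.extend_apply ((H ∘ blowupMap w ψ) ∘ Blowup.mk w) 0
    (⟨p', h4⟩ : BlowupCover n)
  rw [e1]
  refine Eq.trans ?_ e2.symm
  simp only [Function.comp_apply, Kawakita.blowupMap_mk h.weight_pos h.weight]
  rw [coverMap_of_ne]

/-- Over `U` the map covers `ψ`, which sends `Z ∖ {0}` into `Z' ∖ {0}`; continuity passes this to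
closures. -/
lemma mapsTo_strictTransform (h : LocalIso w Z Z' U U' ψ θ) :
    Set.MapsTo (blowupMap w ψ) (strictTransform w Z ∩ Blowup.proj w ⁻¹' U)
      (strictTransform w Z' ∩ Blowup.proj w ⁻¹' U') := by
  rintro q ⟨⟨hcl, hZ⟩, hU⟩
  have hproj := h.proj_blowupMap hU
  refine ⟨⟨?_, ?_⟩, ?_⟩
  · rw [mem_closure_iff_nhds] at hcl ⊢
    intro W hW
    obtain ⟨s, ⟨hsW, hsU⟩, hs⟩ := hcl _ (Filter.inter_mem (h.continuousAt_blowupMap hU hW)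
      ((h.isOpen.preimage continuous_proj).mem_nhds hU))
    refine ⟨_, hsW, ?_⟩
    rw [Set.mem_preimage, h.proj_blowupMap hsU]
    refine ⟨h.map_mem _ hsU hs.1, fun h0 => hs.2 ?_⟩
    have := h.left_inv _ hsU
    rw [Set.mem_singleton_iff.mp h0, h.map_zero'] at this
    exact this.symm
  · rw [Set.mem_preimage, hproj]; exact h.map_mem _ hU hZ
  · rw [Set.mem_preimage, hproj]; exact h.mapsTo hU

theorem locallyEquivalent (h : LocalIso w Z Z' U U' ψ θ) : LocallyEquivalent w Z w Z' := by
  have hm : ∀ {Z Z' U U' ψ θ}, LocalIso w Z Z' U U' ψ θ → Set.MapsTo ψ (Z ∩ U) (Z' ∩ U') :=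
    fun h x hx => ⟨h.map_mem x hx.2 hx.1, h.mapsTo hx.2⟩
  refine ⟨U, U', h.isOpen, h.isOpen', h.zero_mem, h.zero_mem',
    homeomorphOfMapsTo ψ θ (fun x hx => (h.analytic x hx.2).continuousAt)
      (fun y hy => (h.analytic' y hy.2).continuousAt) (hm h) (hm h.symm)
      (fun x hx => h.left_inv x hx.2) (fun y hy => h.right_inv y hy.2),
    homeomorphOfMapsTo (blowupMap w ψ) (blowupMap w θ) (fun q hq => h.continuousAt_blowupMap hq.2)
      (fun q hq => h.symm.continuousAt_blowupMap hq.2) h.mapsTo_strictTransform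
      h.symm.mapsTo_strictTransform (fun q hq => h.blowupMap_blowupMap hq.2)
      (fun q hq => h.symm.blowupMap_blowupMap hq.2), ?_, ?_, ?_⟩
  · exact isBiholomorphic_of_extends _ ψ θ (fun _ => rfl) (fun _ => rfl)
      (fun x H hH => hH.comp (h.analytic x x.2.2)) (fun y H hH => hH.comp (h.analytic' y y.2.2))
  · exact isBiholomorphic_of_extends _ (blowupMap w ψ) (blowupMap w θ) (fun _ => rfl)
      (fun _ => rfl) (fun q H hH => h.holAt_comp_blowupMap q.2.2 hH)
      (fun q H hH => h.symm.holAt_comp_blowupMap q.2.2 hH)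
  · exact fun q => Subtype.ext (h.proj_blowupMap q.2.2).symm

end LocalIso

/-- A weight-compatible biholomorphic germ matching `Z` with `Z'` induces a local equivalence of
weighted blowups. -/
theorem BiholGerm.locallyEquivalent {n : ℕ} {w : Fin n → ℕ} (hw : ∀ i, 0 < w i)
    {ψ θ : (Fin n → ℂ) → Fin n → ℂ} (hb : BiholGerm ψ θ) (hψ : IsWeightMap w ψ)
    {Z Z' : Set (Fin n → ℂ)} (hZ : ∀ᶠ x in 𝓝 0, x ∈ Z ↔ ψ x ∈ Z') :
    LocallyEquivalent w Z w Z' := by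
  obtain ⟨V, hV, hVo, hV0⟩ := eventually_nhds_iff.mp
    (hb.analytic.eventually_analyticAt.and (hb.left_inv.and hZ))
  obtain ⟨V', hV', hVo', hV0'⟩ := eventually_nhds_iff.mp
    (hb.analytic_inv.eventually_analyticAt.and hb.right_inv)
  -- Cutting each neighbourhood down by the preimage of the other makes `ψ` and `θ` exact inverses
  -- between open sets, not only as germs.
  have h : LocalIso w Z Z' {x | x ∈ V ∧ ψ x ∈ V'} {y | y ∈ V' ∧ θ y ∈ V} ψ θ := {
    weight_pos := hw
    isOpen := ContinuousOn.isOpen_inter_preimage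
      (fun x hx => (hV x hx).1.continuousAt.continuousWithinAt) hVo hVo'
    isOpen' := ContinuousOn.isOpen_inter_preimage
      (fun x hx => (hV' x hx).1.continuousAt.continuousWithinAt) hVo' hVo
    zero_mem := ⟨hV0, by rwa [hb.map_zero]⟩
    zero_mem' := ⟨hV0', by rwa [hb.map_zero_inv]⟩
    map_zero := hb.map_zero
    map_zero' := hb.map_zero_inv
    mapsTo := fun x hx => ⟨hx.2, by rw [(hV x hx.1).2.1]; exact hx.1⟩
    mapsTo' := fun y hy => ⟨hy.2, by rw [(hV' y hy.1).2]; exact hy.1⟩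
    left_inv := fun x hx => (hV x hx.1).2.1
    right_inv := fun y hy => (hV' y hy.1).2
    analytic := fun x hx => (hV x hx.1).1
    analytic' := fun y hy => (hV' y hy.1).1
    weight := hψ
    weight' := hψ.inv hb
    map_mem := fun x hx => (hV x hx.1).2.2.mp
    map_mem' := fun y hy h => (hV _ hy.2).2.2.mpr (by rwa [(hV' y hy.1).2]) }
  exact h.locallyEquivalent

/-! ### Consequences of a hyperplane section being an `Aₙ` singularity -/

lemma norm_pderiv_le {n : ℕ} (i : Fin n) {F : (Fin n → ℂ) → ℂ} {x : Fin n → ℂ}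
    (hF : DifferentiableAt ℂ F x) : ‖pderiv i F x‖ ≤ ‖fderiv ℂ F x‖ := by
  rw [pderiv_eq_fderiv i hF]
  simpa [Pi.norm_single] using (fderiv ℂ F x).le_opNorm (Pi.single i 1)

lemma norm_fderiv_le_sum {n : ℕ} {F : (Fin n → ℂ) → ℂ} {x : Fin n → ℂ}
    (hF : DifferentiableAt ℂ F x) : ‖fderiv ℂ F x‖ ≤ ∑ i, ‖pderiv i F x‖ := by
  refine ContinuousLinearMap.opNorm_le_bound _ (Finset.sum_nonneg fun _ _ => norm_nonneg _)
    fun v => ?_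
  rw [fderiv_apply_eq_sum_pderiv hF, Finset.sum_mul]
  refine (norm_sum_le _ _).trans (Finset.sum_le_sum fun i _ => ?_)
  rw [norm_mul, mul_comm]
  gcongr
  exact norm_le_pi_norm v i

/-- The equation of the surface `Aₙ` singularity. -/
def surfaceA (n : ℕ) (y : Fin 3 → ℂ) : ℂ := y 0 ^ 2 + y 1 ^ 2 + y 2 ^ (n + 1)

lemma analyticAt_surfaceA (n : ℕ) (y : Fin 3 → ℂ) : AnalyticAt ℂ (surfaceA n) y :=
  (((analyticAt_coord 0 y).fun_pow 2).fun_add ((analyticAt_coord 1 y).fun_pow 2)).fun_add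
    ((analyticAt_coord 2 y).fun_pow (n + 1))

lemma pderiv_surfaceA (n : ℕ) (y : Fin 3 → ℂ) :
    pderiv 0 (surfaceA n) y = 2 * y 0 ∧ pderiv 1 (surfaceA n) y = 2 * y 1 ∧
      pderiv 2 (surfaceA n) y = (n + 1) * y 2 ^ n := by
  have h0 : ∀ (k : ℕ) (a c : ℂ), deriv (fun t : ℂ => (a + t) ^ k + c) 0 = k * a ^ (k - 1) := by
    intro k a c
    have h1 : HasDerivAt (fun t : ℂ => a + t) 1 0 := (hasDerivAt_id (0 : ℂ)).const_add a
    simpa using ((h1.fun_pow k).add_const c).deriv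
  refine ⟨?_, ?_, ?_⟩
  · have := h0 2 (y 0) (y 1 ^ 2 + y 2 ^ (n + 1))
    simpa [pderiv, lineDeriv, surfaceA, add_assoc] using this
  · have := h0 2 (y 1) (y 0 ^ 2 + y 2 ^ (n + 1))
    simpa [pderiv, lineDeriv, surfaceA, add_assoc, add_left_comm] using this
  · simp [pderiv, lineDeriv, surfaceA, add_comm]

/-- Euler's relation for the quasi-homogeneous polynomial, with coefficients `1/2`, `1/2`,
`1/(n+1)`. It allows the derivative of a unit multiplying the equation to be absorbed. -/
lemma norm_surfaceA_le (n : ℕ) (y : Fin 3 → ℂ) :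
    ‖surfaceA n y‖ ≤ 3 * ‖y‖ * ‖fderiv ℂ (surfaceA n) y‖ := by
  obtain ⟨h0, h1, h2⟩ := pderiv_surfaceA n y
  have hd := (analyticAt_surfaceA n y).differentiableAt
  have hn : (n : ℂ) + 1 ≠ 0 := by exact_mod_cast n.succ_ne_zero
  have e : surfaceA n y = y 0 / 2 * pderiv 0 (surfaceA n) y + y 1 / 2 * pderiv 1 (surfaceA n) y +
      y 2 / (n + 1) * pderiv 2 (surfaceA n) y := by
    rw [h0, h1, h2, surfaceA, pow_succ (y 2)]; field_simp
  have hle : ∀ (i : Fin 3) (a : ℂ), 1 ≤ ‖a‖ →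
      ‖y i / a * pderiv i (surfaceA n) y‖ ≤ ‖y‖ * ‖fderiv ℂ (surfaceA n) y‖ := by
    intro i a ha
    rw [norm_mul, norm_div]
    gcongr
    · exact (div_le_self (norm_nonneg _) ha).trans (norm_le_pi_norm y i)
    · exact norm_pderiv_le i hd
  have hn1 : 1 ≤ ‖(n : ℂ) + 1‖ := by
    have : ‖((n + 1 : ℕ) : ℂ)‖ = (n + 1 : ℕ) := Complex.norm_natCast _
    push_cast at this
    rw [this]; simp
  rw [e]
  calc _ ≤ _ := norm_add₃_le
    _ ≤ ‖y‖ * ‖fderiv ℂ (surfaceA n) y‖ + ‖y‖ * ‖fderiv ℂ (surfaceA n) y‖ +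
        ‖y‖ * ‖fderiv ℂ (surfaceA n) y‖ := by
      gcongr
      · exact hle 0 2 (by simp)
      · exact hle 1 2 (by simp)
      · exact hle 2 _ hn1
    _ = _ := by ring

/-- For a surface `Aₙ` singularity `F`, in suitable coordinates `φ`, the derivative of `F` dominates
that of the normal form. -/
lemma IsSurfaceA.exists_gradient_bound {n : ℕ} {F : (Fin 3 → ℂ) → ℂ} (h : IsSurfaceA n F) :
    ∃ φ θ, BiholGerm φ θ ∧ ∃ C : ℝ, ∀ᶠ x in 𝓝 0,
      ‖fderiv ℂ (surfaceA n) (φ x)‖ ≤ C * ‖fderiv ℂ F x‖ := by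
  obtain ⟨φ, θ, u, hφ, hθ, hφ0, hθ0, hθφ, hφθ, hu, hu0, hF⟩ := h
  have hb : BiholGerm φ θ := ⟨hφ, hθ, hφ0, hθ0, hθφ, hφθ⟩
  refine ⟨φ, θ, hb, ?_⟩
  have hAφ : AnalyticAt ℂ (fun x => surfaceA n (φ x)) 0 :=
    AnalyticAt.fun_comp (analyticAt_surfaceA n _) hφ
  have hFa : AnalyticAt ℂ F 0 :=
    (hu.fun_mul hAφ).congr (Filter.EventuallyEq.symm hF)
  let v : (Fin 3 → ℂ) → ℂ := fun z => (u (θ z))⁻¹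
  have huθ : AnalyticAt ℂ (fun z => u (θ z)) 0 := AnalyticAt.fun_comp (by rwa [hθ0]) hθ
  have hv : AnalyticAt ℂ v 0 := huθ.fun_inv (by rwa [hθ0])
  have hne : ∀ᶠ z in 𝓝 0, u (θ z) ≠ 0 := huθ.continuousAt.eventually_ne (by rwa [hθ0])
  have hA : ∀ᶠ z in 𝓝 0, surfaceA n z = v z * F (θ z) := by
    filter_upwards [hb.symm.tendsto.eventually hF, hφθ, hne] with z h1 h2 h3
    rw [h1, h2]
    change _ = (u (θ z))⁻¹ * (u (θ z) * surfaceA n z)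
    rw [inv_mul_cancel_left₀ h3]
  -- The product rule for `v · (F ∘ θ)`, with `F ∘ θ` rewritten as `u · surfaceA` so that the second
  -- summand is controlled by `norm_surfaceA_le`.
  have hder : ∀ᶠ z in 𝓝 0, fderiv ℂ (surfaceA n) z =
      v z • (fderiv ℂ F (θ z)).comp (fderiv ℂ θ z) + (u (θ z) * surfaceA n z) • fderiv ℂ v z := by
    filter_upwards [hA.eventually_nhds, hv.eventually_analyticAt, hθ.eventually_analyticAt, hA, hne,
      hb.symm.tendsto.eventually hFa.eventually_analyticAt] with z h1 h2 h3 h4 h5 h6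
    have hcomp : HasFDerivAt (fun z => F (θ z)) ((fderiv ℂ F (θ z)).comp (fderiv ℂ θ z)) z :=
      h6.differentiableAt.hasFDerivAt.comp z h3.differentiableAt.hasFDerivAt
    rw [Filter.EventuallyEq.fderiv_eq (f₁ := surfaceA n) (f := fun z => v z * F (θ z)) h1,
      (h2.differentiableAt.hasFDerivAt.fun_mul hcomp).fderiv, h4]
    congr 2
    change F (θ z) = u (θ z) * ((u (θ z))⁻¹ * F (θ z))
    rw [mul_inv_cancel_left₀ h5]
  obtain ⟨K, hK⟩ : ∃ K : ℝ, ∀ᶠ z in 𝓝 (0 : Fin 3 → ℂ), ‖v z‖ * ‖fderiv ℂ θ z‖ < K ∧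
      ‖u (θ z)‖ * ‖fderiv ℂ v z‖ < K := by
    have c1 : ContinuousAt (fun z => ‖v z‖ * ‖fderiv ℂ θ z‖) 0 :=
      hv.continuousAt.norm.mul hθ.fderiv.continuousAt.norm
    have c2 : ContinuousAt (fun z => ‖u (θ z)‖ * ‖fderiv ℂ v z‖) 0 :=
      huθ.continuousAt.norm.mul hv.fderiv.continuousAt.norm
    refine ⟨max (‖v 0‖ * ‖fderiv ℂ θ 0‖) (‖u (θ 0)‖ * ‖fderiv ℂ v 0‖) + 1, ?_⟩
    exact (c1.eventually_lt continuousAt_const (by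
      exact (le_max_left _ _).trans_lt (lt_add_one _))).and
      (c2.eventually_lt continuousAt_const (by
        exact (le_max_right _ _).trans_lt (lt_add_one _)))
  -- Close to the origin the second summand is at most half of the left-hand side; moving it over
  -- accounts for the factor `2` in `2 * K`.
  have hsmall : ∀ᶠ z in 𝓝 (0 : Fin 3 → ℂ), K * (3 * ‖z‖) < 1 / 2 := by
    have c : ContinuousAt (fun z : Fin 3 → ℂ => K * (3 * ‖z‖)) 0 := by fun_prop
    exact c.eventually_lt continuousAt_const (by simp)
  refine ⟨2 * K, ?_⟩
  have hfin : ∀ᶠ z in 𝓝 0, ‖fderiv ℂ (surfaceA n) z‖ ≤ 2 * K * ‖fderiv ℂ F (θ z)‖ := by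
    filter_upwards [hder, hK, hsmall] with z h1 h2 h3
    have e1 : ‖v z • (fderiv ℂ F (θ z)).comp (fderiv ℂ θ z)‖ ≤ K * ‖fderiv ℂ F (θ z)‖ := by
      rw [norm_smul]
      calc ‖v z‖ * ‖(fderiv ℂ F (θ z)).comp (fderiv ℂ θ z)‖
          ≤ ‖v z‖ * (‖fderiv ℂ F (θ z)‖ * ‖fderiv ℂ θ z‖) := by
            gcongr; exact ContinuousLinearMap.opNorm_comp_le _ _
        _ = (‖v z‖ * ‖fderiv ℂ θ z‖) * ‖fderiv ℂ F (θ z)‖ := by ring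
        _ ≤ _ := by gcongr; exact h2.1.le
    have e2 : ‖(u (θ z) * surfaceA n z) • fderiv ℂ v z‖ ≤
        1 / 2 * ‖fderiv ℂ (surfaceA n) z‖ := by
      rw [norm_smul, norm_mul]
      calc ‖u (θ z)‖ * ‖surfaceA n z‖ * ‖fderiv ℂ v z‖
          = (‖u (θ z)‖ * ‖fderiv ℂ v z‖) * ‖surfaceA n z‖ := by ring
        _ ≤ K * (3 * ‖z‖ * ‖fderiv ℂ (surfaceA n) z‖) := by
            gcongr
            · exact (by positivity : (0 : ℝ) ≤ ‖u (θ z)‖ * ‖fderiv ℂ v z‖).trans h2.2.le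
            · exact h2.2.le
            · exact norm_surfaceA_le n z
        _ = K * (3 * ‖z‖) * ‖fderiv ℂ (surfaceA n) z‖ := by ring
        _ ≤ _ := by gcongr
    have e3 := (congrArg norm h1).le.trans (norm_add_le _ _)
    linarith
  filter_upwards [hb.tendsto.eventually hfin, hθφ] with x h1 h2
  rwa [h2] at h1

/-- The partial derivatives of the normal form are `2 y₀`, `2 y₁` and `(n + 1) y₂ⁿ`. All later use
of the `Aₙ` condition goes through these three inequalities. -/
lemma IsSurfaceA.exists_coord_bound {n : ℕ} {F : (Fin 3 → ℂ) → ℂ} (h : IsSurfaceA n F) :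
    ∃ φ θ, BiholGerm φ θ ∧ ∃ C : ℝ, ∀ᶠ x in 𝓝 0, ‖φ x 0‖ ≤ C * ‖fderiv ℂ F x‖ ∧
      ‖φ x 1‖ ≤ C * ‖fderiv ℂ F x‖ ∧ ‖φ x 2‖ ^ n ≤ C * ‖fderiv ℂ F x‖ := by
  obtain ⟨φ, θ, hb, C, hC⟩ := h.exists_gradient_bound
  refine ⟨φ, θ, hb, C, ?_⟩
  filter_upwards [hC] with x hx
  obtain ⟨h0, h1, h2⟩ := pderiv_surfaceA n (φ x)
  have hd := (analyticAt_surfaceA n (φ x)).differentiableAt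
  have b0 := (norm_pderiv_le 0 hd).trans hx
  have b1 := (norm_pderiv_le 1 hd).trans hx
  have b2 := (norm_pderiv_le 2 hd).trans hx
  rw [h0, norm_mul, Complex.norm_two] at b0
  rw [h1, norm_mul, Complex.norm_two] at b1
  have hn1 : 1 ≤ ‖(n : ℂ) + 1‖ := by
    have : ‖((n + 1 : ℕ) : ℂ)‖ = (n + 1 : ℕ) := Complex.norm_natCast _
    push_cast at this
    rw [this]; simp
  rw [h2, norm_mul, norm_pow] at b2
  refine ⟨by linarith [norm_nonneg (φ x 0)], by linarith [norm_nonneg (φ x 1)], ?_⟩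
  exact (le_mul_of_one_le_left (by positivity) hn1).trans b2

lemma HasWeight.exists_norm_le {n k : ℕ} {F : (Fin n → ℂ) → ℂ}
    (h : HasWeight (fun _ => 1) k F) :
    ∃ C : ℝ, ∀ᶠ x in 𝓝 0, x ≠ 0 → ‖F x‖ ≤ C * ‖x‖ ^ k := by
  obtain ⟨H, hH, h1⟩ := h
  have h2 : ∀ᶠ p in 𝓝 0, ‖H p‖ < ‖H 0‖ + 1 :=
    hH.continuousAt.norm.eventually_lt continuousAt_const (lt_add_one _)
  obtain ⟨r, hr, hball⟩ := Metric.eventually_nhds_iff.mp (h1.and h2)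
  refine ⟨(‖H 0‖ + 1) * ((r / 2)⁻¹) ^ k, ?_⟩
  filter_upwards [Metric.ball_mem_nhds (0 : Fin n → ℂ) (show 0 < r / 2 * (r / 2) by positivity)]
    with x hx hx0
  rw [Metric.mem_ball, dist_zero_right] at hx
  have hxn : 0 < ‖x‖ := norm_pos_iff.mpr hx0
  -- Writing `x = u · (x / u)` with this `u` gives `‖x / u‖ = r / 2`, and `‖u‖ < r / 2` for small
  -- `x`. Thus `(u, x / u)` stays where `H` is bounded, and `‖u‖ ^ k` is a constant times `‖x‖ ^ k`.
  let u : ℂ := ((‖x‖ / (r / 2) : ℝ) : ℂ)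
  have hu : u ≠ 0 := by
    simp only [u, Complex.ofReal_ne_zero]; positivity
  have hun : ‖u‖ = ‖x‖ / (r / 2) := by
    simp only [u, Complex.norm_real]; exact Real.norm_of_nonneg (by positivity)
  let p : Fin (n + 1) → ℂ := Fin.cons u (u⁻¹ • x)
  have hp : dist p 0 < r := by
    rw [dist_zero_right]
    refine (pi_norm_lt_iff hr).mpr fun j => Fin.cases ?_ (fun i => ?_) j
    · change ‖u‖ < r
      rw [hun, div_lt_iff₀ (by positivity)]
      nlinarith
    · change ‖u⁻¹ * x i‖ < r
      rw [norm_mul, norm_inv, hun]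
      have : ‖x i‖ ≤ ‖x‖ := norm_le_pi_norm x i
      calc (‖x‖ / (r / 2))⁻¹ * ‖x i‖ ≤ (‖x‖ / (r / 2))⁻¹ * ‖x‖ := by gcongr
        _ = r / 2 := by field_simp
        _ < r := by linarith
  obtain ⟨e1, e2⟩ := hball hp
  have hd : dilate (fun _ => 1) p = x := by
    ext i
    simp [dilate, p, hu]
  rw [hd] at e1
  rw [e1, norm_mul, norm_pow]
  change ‖u‖ ^ k * _ ≤ _
  rw [hun, div_eq_mul_inv, mul_pow]
  calc ‖x‖ ^ k * (r / 2)⁻¹ ^ k * ‖H p‖ ≤ ‖x‖ ^ k * (r / 2)⁻¹ ^ k * (‖H 0‖ + 1) := by gcongr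
    _ = _ := by ring

/-! ### Rank of the Hessian and order of the split-off part. -/

lemma exists_eval_ne_zero {σ : Type*} {p : MvPolynomial σ ℂ} (hp : p ≠ 0) :
    ∃ c, MvPolynomial.eval c p ≠ 0 := by
  by_contra! h
  exact hp (MvPolynomial.funext fun c => by rw [h c, map_zero])

/-- The Hessian of a `cAₙ` singularity, `n ≥ 1`, has rank at least two. -/
lemma IsCA.not_degenerate {n : ℕ} {f : MvPowerSeries (Fin 4) ℂ} (hf : IsConvergent f)
    (h : IsCA n f) (hd : ∀ i, pderiv i (value f) 0 = 0) (l : (Fin 4 → ℂ) →ₗ[ℂ] ℂ)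
    (hl : ∀ x, l x = 0 → ∀ i, ∑ j, x j * pderiv j (pderiv i (value f)) 0 = 0) : False := by
  obtain ⟨p, hp, h⟩ := h
  obtain ⟨c, hc⟩ := exists_eval_ne_zero hp
  obtain ⟨L, -, -, hA⟩ := h c hc
  have hFa := analyticAt_value hf
  obtain ⟨φ, θ, hb, C, hC⟩ := hA.exists_coord_bound
  let Lc : (Fin 3 → ℂ) →L[ℂ] (Fin 4 → ℂ) := L.toContinuousLinearMap
  -- If the Hessian kills `L v`, the gradient of the section along `t • v` is `o(t)`. The coordinate
  -- bounds force the first two components of `φ (t • v)` to be `o(t)` too.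
  have key : ∀ v, (∀ i, ∑ j, L v j * pderiv j (pderiv i (value f)) 0 = 0) →
      fderiv ℂ φ 0 v 0 = 0 ∧ fderiv ℂ φ 0 v 1 = 0 := by
    intro v hv
    have ht : Tendsto (fun t : ℂ => t • v) (𝓝 0) (𝓝 0) := by
      have : Continuous fun t : ℂ => t • v := by fun_prop
      simpa using this.tendsto 0
    have htL : Tendsto (fun t : ℂ => t • L v) (𝓝 0) (𝓝 0) := by
      have : Continuous fun t : ℂ => t • L v := by fun_prop
      simpa using this.tendsto 0
    have hpi : ∀ i, (fun t : ℂ => pderiv i (value f) (t • L v)) =o[𝓝 0] fun t => t := by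
      intro i
      have h1 : HasDerivAt (fun t : ℂ => pderiv i (value f) (t • L v))
          (fderiv ℂ (pderiv i (value f)) 0 (L v)) 0 := by
        have h2 : HasFDerivAt (pderiv i (value f)) (fderiv ℂ (pderiv i (value f)) 0)
            ((0 : ℂ) • L v) := by
          rw [zero_smul]
          exact (analyticAt_pderiv i hFa).differentiableAt.hasFDerivAt
        have h3 : HasDerivAt (fun t : ℂ => t • L v) (L v) 0 := by
          simpa using (hasDerivAt_id (0 : ℂ)).smul_const (L v)
        exact h2.comp_hasDerivAt 0 h3
      rw [fderiv_apply_eq_sum_pderiv (analyticAt_pderiv i hFa).differentiableAt, hv i,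
        hasDerivAt_iff_isLittleO] at h1
      simpa [hd i] using h1
    have hgrad : (fun t : ℂ => fderiv ℂ (fun y => value f (L y)) (t • v)) =o[𝓝 0] fun t => t := by
      have h1 : (fun t : ℂ => ∑ i, ‖pderiv i (value f) (t • L v)‖) =o[𝓝 0] fun t => t :=
        Asymptotics.IsLittleO.fun_sum fun i _ => (hpi i).norm_left
      refine Asymptotics.IsBigO.trans_isLittleO (Asymptotics.IsBigO.of_bound ‖Lc‖ ?_) h1
      filter_upwards [htL.eventually hFa.eventually_analyticAt] with t hta
      have e : fderiv ℂ (fun y => value f (L y)) (t • v) =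
          (fderiv ℂ (value f) (t • L v)).comp Lc := by
        have h2 : HasFDerivAt (value f) (fderiv ℂ (value f) (t • L v)) (Lc (t • v)) := by
          rw [map_smul]; exact hta.differentiableAt.hasFDerivAt
        exact (h2.comp (t • v) Lc.hasFDerivAt).fderiv
      rw [e, Real.norm_of_nonneg (Finset.sum_nonneg fun _ _ => norm_nonneg _), mul_comm]
      exact (ContinuousLinearMap.opNorm_comp_le _ _).trans (by
        gcongr; exact norm_fderiv_le_sum hta.differentiableAt)
    have hcoord : ∀ k, (∀ᶠ x in 𝓝 0, ‖φ x k‖ ≤ C * ‖fderiv ℂ (fun y => value f (L y)) x‖) →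
        fderiv ℂ φ 0 v k = 0 := by
      intro k hk
      have h1 : (fun t : ℂ => φ (t • v) k) =o[𝓝 0] fun t => t := by
        refine Asymptotics.IsBigO.trans_isLittleO (Asymptotics.IsBigO.of_bound C ?_) hgrad
        exact ht.eventually hk
      have h2 : HasDerivAt (fun t : ℂ => φ (t • v) k) (fderiv ℂ φ 0 v k) 0 := by
        rw [fderiv_apply_coord hb.analytic.differentiableAt]
        have h3 : HasFDerivAt (fun x => φ x k) (fderiv ℂ (fun x => φ x k) 0) ((0 : ℂ) • v) := by
          rw [zero_smul]
          exact (AnalyticAt.coord hb.analytic k).differentiableAt.hasFDerivAt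
        have h4 : HasDerivAt (fun t : ℂ => t • v) v 0 := by
          simpa using (hasDerivAt_id (0 : ℂ)).smul_const v
        exact h3.comp_hasDerivAt 0 h4
      refine h2.unique ?_
      rw [hasDerivAt_iff_isLittleO]
      simpa [hb.map_zero] using h1
    exact ⟨hcoord 0 (hC.mono fun x hx => hx.1), hcoord 1 (hC.mono fun x hx => hx.2.1)⟩
  -- Two linear conditions on `ℂ³` leave a nonzero `v` whose image is killed by the Hessian and for
  -- which the third component of `dφ(v)` vanishes. Then `dφ(v) = 0`, which is impossible.
  let T : (Fin 3 → ℂ) →ₗ[ℂ] ℂ × ℂ := (l ∘ₗ L).prod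
    ((LinearMap.proj 2).comp (fderiv ℂ φ 0 : (Fin 3 → ℂ) →ₗ[ℂ] (Fin 3 → ℂ)))
  have hT : LinearMap.ker T ≠ ⊥ := LinearMap.ker_ne_bot_of_finrank_lt (by simp)
  obtain ⟨v, hv, hv0⟩ := (Submodule.ne_bot_iff _).mp hT
  have hv1 : l (L v) = 0 ∧ fderiv ℂ φ 0 v 2 = 0 := by
    simpa [T] using hv
  obtain ⟨e0, e1⟩ := key v (hl _ hv1.1)
  refine hv0 (hb.eq_zero_of_fderiv ?_)
  ext k
  fin_cases k
  · exact e0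
  · exact e1
  · exact hv1.2

/-- Near the origin, a hyperplane transverse to `{x₀ = x₁ = 0}` in the coordinates `θ⁻¹` contains
points `θ (0, 0, s, t)` with `t` arbitrarily small. -/
lemma exists_curve {ψ θ : (Fin 4 → ℂ) → Fin 4 → ℂ} (hb : BiholGerm ψ θ) (c : Fin 4 → ℂ)
    (hc : ∑ i, c i * fderiv ℂ θ 0 (Pi.single 2 1) i ≠ 0) :
    ∃ z : ℂ → Fin 4 → ℂ, Tendsto z (𝓝 0) (𝓝 0) ∧ ∀ᶠ t in 𝓝 0,
      z t 0 = 0 ∧ z t 1 = 0 ∧ z t 3 = t ∧ ∑ i, c i * θ (z t) i = 0 := by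
  let Q : (Fin 4 → ℂ) → ℂ := fun z => ∑ i, c i * θ (kill 0 1 z) i
  have hθk : AnalyticAt ℂ (fun z => θ (kill 0 1 z)) 0 :=
    AnalyticAt.fun_comp (by rw [kill_zero]; exact hb.analytic_inv) (analyticAt_kill 0 1 0)
  have hQ : AnalyticAt ℂ Q 0 :=
    Finset.univ.analyticAt_fun_sum fun i _ => analyticAt_const.fun_mul (AnalyticAt.coord hθk i)
  have hQd : fderiv ℂ Q 0 (Pi.single 2 1) = ∑ i, c i * fderiv ℂ θ 0 (Pi.single 2 1) i := by
    have h1 : HasDerivAt (fun t : ℂ => t • (Pi.single 2 1 : Fin 4 → ℂ)) (Pi.single 2 1) 0 := by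
      simpa using (hasDerivAt_id (0 : ℂ)).smul_const (Pi.single 2 1 : Fin 4 → ℂ)
    have hcoord : ∀ i, HasDerivAt (fun t : ℂ => θ (t • (Pi.single 2 1 : Fin 4 → ℂ)) i)
        (fderiv ℂ θ 0 (Pi.single 2 1) i) 0 := by
      intro i
      have h2 : HasFDerivAt θ (fderiv ℂ θ 0) ((0 : ℂ) • (Pi.single 2 1 : Fin 4 → ℂ)) := by
        rw [zero_smul]; exact hb.analytic_inv.differentiableAt.hasFDerivAt
      exact hasDerivAt_pi.mp (h2.comp_hasDerivAt 0 h1) i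
    have h3 : HasDerivAt (fun t : ℂ => Q (t • (Pi.single 2 1 : Fin 4 → ℂ)))
        (fderiv ℂ Q 0 (Pi.single 2 1)) 0 := by
      have h2 : HasFDerivAt Q (fderiv ℂ Q 0) ((0 : ℂ) • (Pi.single 2 1 : Fin 4 → ℂ)) := by
        rw [zero_smul]; exact hQ.differentiableAt.hasFDerivAt
      exact h2.comp_hasDerivAt 0 h1
    have h4 : HasDerivAt (fun t : ℂ => Q (t • (Pi.single 2 1 : Fin 4 → ℂ)))
        (∑ i, c i * fderiv ℂ θ 0 (Pi.single 2 1) i) 0 := by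
      have e : ∀ t : ℂ, kill 0 1 (t • (Pi.single 2 1 : Fin 4 → ℂ)) = t • Pi.single 2 1 := by
        intro t; ext k; fin_cases k <;> simp [kill_apply]
      simp only [Q, e]
      exact HasDerivAt.fun_sum fun i _ => (hcoord i).const_mul (c i)
    exact h3.unique h4
  -- By transversality `Q` can replace the coordinate of index `2`. Inverting along the last axis
  -- solves `Q = 0` with last coordinate `t`.
  let Φ : (Fin 4 → ℂ) → Fin 4 → ℂ := fun z => Function.update z 2 (Q z)
  have hΦ : AnalyticAt ℂ Φ 0 := analyticAt_update analyticAt_id hQ 2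
  have hΦk : ∀ k, k ≠ 2 → ∀ z, Φ z k = z k := fun k hk z => by simp [Φ, hk]
  have hΦ2 : ∀ z, Φ z 2 = Q z := fun z => by simp [Φ]
  obtain ⟨Ξ, hΞ⟩ := exists_biholGerm hΦ (by
      ext k
      by_cases hk : k = 2
      · subst hk; simp [hΦ2, Q, kill_zero, hb.map_zero_inv]
      · rw [hΦk k hk]) (by
    intro v hv
    have hvk : ∀ k, k ≠ 2 → v k = 0 := by
      intro k hk
      have := fderiv_update_apply hΦ v k (hΦk k hk)
      rw [hv, fderiv_coord] at this
      exact this.symm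
    have hv2 : v = v 2 • Pi.single 2 1 := by
      ext k
      by_cases hk : k = 2
      · subst hk; simp
      · rw [hvk k hk]; simp [hk]
    have h2 := fderiv_update_apply hΦ v 2 hΦ2
    rw [hv, hv2, map_smul, hQd] at h2
    simp only [Pi.zero_apply, smul_eq_mul] at h2
    rw [hv2, (mul_eq_zero.mp h2.symm).resolve_right hc, zero_smul])
  have hlin : Tendsto (fun t : ℂ => (Pi.single 3 t : Fin 4 → ℂ)) (𝓝 0) (𝓝 0) := by
    simpa using (continuous_single (A := fun _ : Fin 4 => ℂ) 3).tendsto 0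
  refine ⟨fun t => Ξ (Pi.single 3 t), hΞ.symm.tendsto.comp hlin, ?_⟩
  filter_upwards [hlin.eventually hΞ.right_inv] with t ht
  have hk : ∀ k, k ≠ 2 → Ξ (Pi.single 3 t) k = (Pi.single 3 t : Fin 4 → ℂ) k := by
    intro k hk
    rw [← hΦk k hk (Ξ (Pi.single 3 t)), ht]
  have h0 := hk 0 (by decide)
  have h1 := hk 1 (by decide)
  have h3 := hk 3 (by decide)
  simp only [ne_eq, Fin.reduceEq, not_false_eq_true, Pi.single_eq_of_ne] at h0 h1
  rw [Pi.single_eq_same] at h3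
  refine ⟨h0, h1, h3, ?_⟩
  have h2 := congrFun ht 2
  rw [hΦ2] at h2
  have e : kill 0 1 (Ξ (Pi.single 3 t)) = Ξ (Pi.single 3 t) := by
    ext k; fin_cases k <;> simp [kill_apply, h0, h1]
  simpa only [Q, e, ne_eq, Fin.reduceEq, not_false_eq_true, Pi.single_eq_of_ne] using h2

lemma pderiv_two_mul_add {G : (Fin 4 → ℂ) → ℂ} {z : Fin 4 → ℂ} (h0 : z 0 = 0) (h1 : z 1 = 0)
    (hG : DifferentiableAt ℂ G z) (k : Fin 4) :
    pderiv k (fun x => x 0 * x 1 + G x) z = pderiv k G z := by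
  have hc := fun i => (analyticAt_coord i z).differentiableAt
  rw [pderiv_add k ((hc 0).fun_mul (hc 1)) hG, pderiv_mul k (hc 0) (hc 1), h0, h1]
  ring

/-- A `cAₙ` singularity is not of the form `x₀ x₁ + G(x₂, x₃) = 0` with `G` of order at least
`n + 2`. -/
lemma IsCA.not_order_ge {n : ℕ} (hn : 1 ≤ n) {f : MvPowerSeries (Fin 4) ℂ} (h : IsCA n f)
    {ψ θ : (Fin 4 → ℂ) → Fin 4 → ℂ} (hb : BiholGerm ψ θ)
    {G : (Fin 4 → ℂ) → ℂ} (hG : AnalyticAt ℂ G 0) (hGw : HasWeight (fun _ => 1) (n + 2) G)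
    (hf : ∀ᶠ x in 𝓝 0, value f x = ψ x 0 * ψ x 1 + G (ψ x)) : False := by
  obtain ⟨p, hp, h⟩ := h
  let e : Fin 4 → ℂ := fderiv ℂ θ 0 (Pi.single 2 1)
  have he : e ≠ 0 := fun h0 => by
    have := congrFun (hb.symm.eq_zero_of_fderiv h0) 2
    simp at this
  -- The hyperplane must be general for the `cAₙ` condition and also transverse to `e`; the product
  -- of the two polynomials encodes both.
  obtain ⟨c, hc⟩ : ∃ c, MvPolynomial.eval c
      (p * ∑ i, MvPolynomial.C (e i) * MvPolynomial.X i) ≠ 0 := by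
    refine exists_eval_ne_zero (mul_ne_zero hp fun h0 => he ?_)
    ext k
    have := congrArg (MvPolynomial.eval (Pi.single k 1)) h0
    simpa [Pi.single_apply] using this
  simp only [map_mul, map_sum, MvPolynomial.eval_C, MvPolynomial.eval_X, mul_ne_zero_iff] at hc
  obtain ⟨L, hL, hLr, hA⟩ := h c hc.1
  obtain ⟨z, hz, hzc⟩ := exists_curve hb c (by simpa only [mul_comm] using hc.2)
  obtain ⟨R, hR⟩ := LinearMap.exists_leftInverse_of_injective L (LinearMap.ker_eq_bot.mpr hL)
  obtain ⟨φ, φ', hφ, C, hC⟩ := hA.exists_coord_bound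
  let Lc : (Fin 3 → ℂ) →L[ℂ] (Fin 4 → ℂ) := L.toContinuousLinearMap
  let Rc : (Fin 4 → ℂ) →L[ℂ] (Fin 3 → ℂ) := R.toContinuousLinearMap
  -- points of the hyperplane section along the curve
  let η : ℂ → Fin 3 → ℂ := fun t => R (θ (z t))
  have hη : Tendsto η (𝓝 0) (𝓝 0) := by
    have h1 : Tendsto Rc (𝓝 0) (𝓝 0) := by simpa using Rc.continuous.tendsto 0
    exact h1.comp (hb.symm.tendsto.comp hz)
  have hLη : ∀ᶠ t in 𝓝 0, L (η t) = θ (z t) := by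
    filter_upwards [hzc] with t ht
    obtain ⟨y, hy⟩ := (hLr (θ (z t))).mpr ht.2.2.2
    change L (R (θ (z t))) = _
    rw [← hy]
    exact congrArg L (congrArg (fun T => T y) hR)
  let ζ : ℂ → Fin 3 → ℂ := fun t => φ (η t)
  have hζ : Tendsto ζ (𝓝 0) (𝓝 0) := hφ.tendsto.comp hη
  have hψz : ∀ᶠ t in 𝓝 0, ψ (θ (z t)) = z t := hz.eventually hb.right_inv
  -- `z` is bounded by `ζ`
  have hzζ : z =O[𝓝 0] ζ := by
    have ha : AnalyticAt ℂ (fun y => ψ (Lc (φ' y))) 0 := by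
      refine AnalyticAt.fun_comp (g := ψ) (f := fun y => Lc (φ' y)) ?_ ?_
      · rw [hφ.map_zero_inv, map_zero]; exact hb.analytic
      · exact (Lc.analyticAt _).fun_comp hφ.analytic_inv
    have h1 : (fun y => ψ (Lc (φ' y))) =O[𝓝 0] fun y => y := by
      have := ha.differentiableAt.isBigO_sub
      simpa [hφ.map_zero_inv, hb.map_zero] using this
    refine (h1.comp_tendsto hζ).congr' ?_ .rfl
    filter_upwards [hη.eventually hφ.left_inv, hLη, hψz] with t h1 h2 h3
    simp only [Function.comp_apply, ζ, h1]
    change ψ (L (η t)) = z t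
    rw [h2, h3]
  have hzne : ∀ᶠ t in 𝓝 0, t ≠ 0 → z t ≠ 0 := by
    filter_upwards [hzc] with t ht ht0 h0
    exact ht0 (by rw [← ht.2.2.1, h0]; rfl)
  -- the gradient of the section is small
  have hgrad : ∃ K : ℝ, ∀ᶠ t in 𝓝 0, t ≠ 0 →
      ‖fderiv ℂ (fun y => value f (L y)) (η t)‖ ≤ K * ‖z t‖ ^ (n + 1) := by
    have hGk : ∀ k, ∃ Ck : ℝ, ∀ᶠ x in 𝓝 0, x ≠ 0 → ‖pderiv k G x‖ ≤ Ck * ‖x‖ ^ (n + 1) :=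
      fun k => ((hGw.pderiv hG k).mono (l := n + 1) (by omega)).exists_norm_le
    choose Ck hCk using hGk
    have hψθ : Tendsto (fun t => θ (z t)) (𝓝 0) (𝓝 0) := hb.symm.tendsto.comp hz
    refine ⟨(∑ k, Ck k) * ((‖fderiv ℂ ψ 0‖ + 1) * ‖Lc‖), ?_⟩
    have hbd : ∀ᶠ x in 𝓝 (0 : Fin 4 → ℂ), ‖fderiv ℂ ψ x‖ < ‖fderiv ℂ ψ 0‖ + 1 :=
      hb.analytic.fderiv.continuousAt.norm.eventually_lt continuousAt_const (lt_add_one _)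
    have hfd : ∀ᶠ x in 𝓝 0, value f =ᶠ[𝓝 x] fun x => ψ x 0 * ψ x 1 + G (ψ x) :=
      hf.eventually_nhds
    filter_upwards [hLη, hψz, hψθ.eventually hfd, hψθ.eventually hb.analytic.eventually_analyticAt,
      hz.eventually hG.eventually_analyticAt, hψθ.eventually hbd, hzc, hzne,
      hz.eventually (Filter.eventually_all.mpr hCk)] with t h1 h2 h3 h4 h5 h6 h7 h8 h9 ht
    let F₀ : (Fin 4 → ℂ) → ℂ := fun x => x 0 * x 1 + G x
    have hF₀ : DifferentiableAt ℂ F₀ (z t) :=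
      ((analyticAt_coord 0 _).differentiableAt.fun_mul
        (analyticAt_coord 1 _).differentiableAt).fun_add h5.differentiableAt
    have hd1 : HasFDerivAt (fun x => F₀ (ψ x)) ((fderiv ℂ F₀ (z t)).comp (fderiv ℂ ψ (θ (z t))))
        (θ (z t)) := by
      have : HasFDerivAt F₀ (fderiv ℂ F₀ (z t)) (ψ (θ (z t))) := by
        rw [h2]; exact hF₀.hasFDerivAt
      exact this.comp _ h4.differentiableAt.hasFDerivAt
    have hd2 : HasFDerivAt (value f) ((fderiv ℂ F₀ (z t)).comp (fderiv ℂ ψ (θ (z t))))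
        (Lc (η t)) := by
      change HasFDerivAt _ _ (L (η t))
      rw [h1]
      exact hd1.congr_of_eventuallyEq h3
    have hd3 : fderiv ℂ (fun y => value f (L y)) (η t) =
        ((fderiv ℂ F₀ (z t)).comp (fderiv ℂ ψ (θ (z t)))).comp Lc :=
      (hd2.comp (η t) Lc.hasFDerivAt).fderiv
    have hF₀n : ‖fderiv ℂ F₀ (z t)‖ ≤ (∑ k, Ck k) * ‖z t‖ ^ (n + 1) := by
      refine (norm_fderiv_le_sum hF₀).trans ?_
      rw [Finset.sum_mul]
      refine Finset.sum_le_sum fun k _ => ?_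
      rw [pderiv_two_mul_add h7.1 h7.2.1 h5.differentiableAt]
      exact h9 k (h8 ht)
    rw [hd3]
    calc _ ≤ ‖fderiv ℂ F₀ (z t)‖ * ‖fderiv ℂ ψ (θ (z t))‖ * ‖Lc‖ :=
          (ContinuousLinearMap.opNorm_comp_le _ _).trans (by
            gcongr; exact ContinuousLinearMap.opNorm_comp_le _ _)
      _ ≤ ((∑ k, Ck k) * ‖z t‖ ^ (n + 1)) * (‖fderiv ℂ ψ 0‖ + 1) * ‖Lc‖ := by
          gcongr
          exact (norm_nonneg _).trans hF₀n
      _ = _ := by ring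
  obtain ⟨K, hK⟩ := hgrad
  obtain ⟨B, hB0, hB⟩ := hzζ.exists_pos
  rw [Asymptotics.isBigOWith_iff] at hB
  have hsmall : ∀ᶠ t in 𝓝 0, ‖ζ t‖ < 1 := by
    simpa using hζ.norm.eventually_lt_const (u := 1) (by simp)
  have hsmall2 : ∀ᶠ t in 𝓝 0, |C| * (|K| * B ^ (n + 1)) * ‖ζ t‖ < 1 := by
    have := (hζ.norm.const_mul (|C| * (|K| * B ^ (n + 1))))
    simp only [norm_zero, mul_zero] at this
    exact this.eventually_lt_const one_pos
  -- On `x₀ = x₁ = 0` the gradient of `x₀ x₁ + G` is that of `G`, of size `O(‖z‖ⁿ⁺¹) = O(‖ζ‖ⁿ⁺¹)`,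
  -- whereas the `Aₙ` bounds make it at least a multiple of `‖ζ‖ⁿ`. These are incompatible as `ζ →
  -- 0`.
  have hall : ∀ᶠ t in 𝓝[≠] (0 : ℂ), False := by
    filter_upwards [hK.filter_mono nhdsWithin_le_nhds, hB.filter_mono nhdsWithin_le_nhds,
      hsmall.filter_mono nhdsWithin_le_nhds, hsmall2.filter_mono nhdsWithin_le_nhds,
      hzne.filter_mono nhdsWithin_le_nhds, (hη.eventually hC).filter_mono nhdsWithin_le_nhds,
      self_mem_nhdsWithin] with t h1 h2 h3 h4 h5 h6 ht
    replace h1 := h1 ht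
    have hζ0 : 0 < ‖ζ t‖ := by
      by_contra hle
      have h0 : ‖ζ t‖ = 0 := le_antisymm (not_lt.mp hle) (norm_nonneg _)
      rw [h0, mul_zero] at h2
      exact h5 ht (norm_le_zero_iff.mp h2)
    have hD : C * ‖fderiv ℂ (fun y => value f (L y)) (η t)‖ ≤
        |C| * (|K| * B ^ (n + 1)) * ‖ζ t‖ ^ (n + 1) := by
      calc _ ≤ |C| * (|K| * ‖z t‖ ^ (n + 1)) := by
            gcongr
            · exact le_abs_self C
            · exact h1.trans (by gcongr; exact le_abs_self K)
        _ ≤ |C| * (|K| * (B * ‖ζ t‖) ^ (n + 1)) := by gcongr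
        _ = _ := by rw [mul_pow]; ring
    have hpow : ∀ k, ‖ζ t k‖ ^ n ≤ C * ‖fderiv ℂ (fun y => value f (L y)) (η t)‖ := by
      -- Here `n ≥ 1` puts the linear bounds on the first two coordinates on the same footing as the
      -- bound on the third.
      have hle : ∀ k, ‖ζ t k‖ ^ n ≤ ‖ζ t k‖ := fun k =>
        pow_le_of_le_one (norm_nonneg _) ((norm_le_pi_norm _ k).trans h3.le) (by omega)
      intro k
      fin_cases k
      · exact (hle 0).trans h6.1
      · exact (hle 1).trans h6.2.1
      · exact h6.2.2
    obtain ⟨k, hk⟩ : ∃ k, ‖ζ t k‖ = ‖ζ t‖ := by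
      obtain ⟨k, -, hk⟩ := Finset.exists_mem_eq_sup' (Finset.univ_nonempty (α := Fin 3))
        fun k => ‖ζ t k‖₊
      refine ⟨k, ?_⟩
      rw [Pi.norm_def, ← Finset.sup'_eq_sup Finset.univ_nonempty, hk]
      rfl
    have h7 := (hpow k).trans hD
    rw [hk, pow_succ ‖ζ t‖, mul_comm (‖ζ t‖ ^ n), ← mul_assoc] at h7
    have h8 : 0 < ‖ζ t‖ ^ n := by positivity
    exact absurd h7 (not_le.mpr (mul_lt_of_lt_one_left h8 h4))
  exact hall.exists.elim fun _ h => h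

/-! ### More on series -/

lemma isConvergent_sub {n : ℕ} {f g : MvPowerSeries (Fin n) ℂ} (hf : IsConvergent f)
    (hg : IsConvergent g) :
    IsConvergent (f - g) ∧ ∀ᶠ x in 𝓝 0, value (f - g) x = value f x - value g x := by
  have h : ∀ᶠ x in 𝓝 0, HasSum (term (f - g) x) (value f x - value g x) := by
    filter_upwards [hf.eventually_hasSum, hg.eventually_hasSum] with x h1 h2
    convert! h1.sub h2 using 2 with m
    simp [term, sub_mul]
  exact ⟨h.mono fun x hx => hx.summable, h.mono fun x hx => hx.tsum_eq⟩

lemma eq_of_value_eventuallyEq {n : ℕ} {f g : MvPowerSeries (Fin n) ℂ} (hf : IsConvergent f)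
    (hg : IsConvergent g) (h : value f =ᶠ[𝓝 0] value g) : f = g := by
  obtain ⟨h1, h2⟩ := isConvergent_sub hf hg
  refine sub_eq_zero.mp (eq_zero_of_value_eventuallyEq_zero h1 ?_)
  filter_upwards [h2, h] with x h3 h4
  rw [h3, h4, sub_self]; rfl

/-- The restriction of a series to the line spanned by `v`. -/
noncomputable def lineSeries {n : ℕ} (f : MvPowerSeries (Fin n) ℂ) (v : Fin n → ℂ) :
    MvPowerSeries (Fin 1) ℂ :=
  fun k => ∑ m ∈ exponents n (k 0), term f v m

lemma coeff_lineSeries {n : ℕ} (f : MvPowerSeries (Fin n) ℂ) (v : Fin n → ℂ) (k : Fin 1 →₀ ℕ) :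
    MvPowerSeries.coeff k (lineSeries f v) = ∑ m ∈ exponents n (k 0), term f v m := rfl

lemma eventually_hasSum_lineSeries {n : ℕ} {f : MvPowerSeries (Fin n) ℂ} (hf : IsConvergent f)
    (v : Fin n → ℂ) :
    ∀ᶠ x in 𝓝 0, HasSum (term (lineSeries f v) x) (value f (x 0 • v)) := by
  have hc : Tendsto (fun x : Fin 1 → ℂ => x 0 • v) (𝓝 0) (𝓝 0) := by
    have : Continuous fun x : Fin 1 → ℂ => x 0 • v := by fun_prop
    simpa using this.tendsto 0
  filter_upwards [hc.eventually hf.eventually_hasSum] with x hx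
  have h1 := hasSum_exponents hx
  have h2 : Function.Bijective fun k : Fin 1 →₀ ℕ => k 0 := by
    refine ⟨fun k l h => ?_, fun k => ⟨Finsupp.single 0 k, by simp⟩⟩
    exact Finsupp.ext fun i => by rw [Subsingleton.elim i 0]; exact h
  have h3 := (Equiv.ofBijective _ h2).hasSum_iff.mpr h1
  convert! h3 using 1
  refine funext fun k => ?_
  simp only [Function.comp_apply, Equiv.ofBijective_apply, term, coeff_lineSeries, Finset.sum_mul]
  refine Finset.sum_congr rfl fun m hm => ?_
  simp only [Pi.smul_apply, smul_eq_mul, mul_pow, Finset.prod_mul_distrib,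
    Finset.prod_pow_eq_pow_sum]
  rw [← Finsupp.degree_eq_sum, mem_exponents.mp hm]
  simp
  ring

/-- If two germs agree along two lines, so do the homogeneous parts of their series. -/
lemma sum_exponents_eq_of_line {n n' : ℕ} {f : MvPowerSeries (Fin n) ℂ}
    {g : MvPowerSeries (Fin n') ℂ} (hf : IsConvergent f) (hg : IsConvergent g)
    (v : Fin n → ℂ) (v' : Fin n' → ℂ)
    (h : ∀ᶠ t : ℂ in 𝓝 0, value f (t • v) = value g (t • v')) (k : ℕ) :
    ∑ m ∈ exponents n k, term f v m = ∑ m ∈ exponents n' k, term g v' m := by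
  have h1 := eventually_hasSum_lineSeries hf v
  have h2 := eventually_hasSum_lineSeries hg v'
  have h0 : Tendsto (fun x : Fin 1 → ℂ => x 0) (𝓝 0) (𝓝 0) :=
    (continuous_apply (0 : Fin 1)).tendsto (0 : Fin 1 → ℂ)
  have he : lineSeries f v = lineSeries g v' := by
    refine eq_of_value_eventuallyEq (h1.mono fun x hx => hx.summable)
      (h2.mono fun x hx => hx.summable) ?_
    filter_upwards [h1, h2, h0.eventually h] with x h3 h4 h5
    rw [value, value, h3.tsum_eq, h4.tsum_eq, h5]
  have := congrArg (MvPowerSeries.coeff (Finsupp.single 0 k)) he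
  simpa only [coeff_lineSeries, Finsupp.single_eq_same] using this

lemma sum_exponents_single {n : ℕ} (f : MvPowerSeries (Fin n) ℂ) (i : Fin n) (k : ℕ) :
    ∑ m ∈ exponents n k, term f (Pi.single i 1) m =
      MvPowerSeries.coeff (Finsupp.single i k) f := by
  rw [Finset.sum_eq_single (Finsupp.single i k)]
  · rw [term, prod_pow_single]; simp
  · intro m hm hne
    obtain ⟨l, hl, hml⟩ : ∃ l, l ≠ i ∧ m l ≠ 0 := by
      by_contra! h
      refine hne ?_
      have hs : m = Finsupp.single i (m i) := by
        ext l
        by_cases hl : l = i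
        · subst hl; simp
        · rw [h l hl]; simp [Ne.symm hl]
      have := mem_exponents.mp hm
      rw [hs, Finsupp.degree_single] at this
      rw [hs, this]
    rw [term, Finset.prod_eq_zero (Finset.mem_univ l), mul_zero]
    simp [hl, hml]
  · intro h
    exact absurd (mem_exponents.mpr (by simp)) h

/-- Discarding the monomials that contain `x₀` or `x₁` amounts to evaluating at `kill 0 1 x`, which
does not change `G`. -/
lemma exists_series_of_kill {G : (Fin 4 → ℂ) → ℂ} (hG : AnalyticAt ℂ G 0)
    (hGk : ∀ x, G (kill 0 1 x) = G x) :
    ∃ g : MvPowerSeries (Fin 4) ℂ, IsConvergent g ∧ OnlyLastTwo g ∧ value g =ᶠ[𝓝 0] G := by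
  obtain ⟨g, hg, hgG⟩ := exists_series hG
  refine ⟨part (fun m => m 0 = 0) (part (fun m => m 1 = 0) g),
    isConvergent_part _ (isConvergent_part _ hg), ?_, ?_⟩
  · intro m hm
    rw [coeff_part, coeff_part]
    rcases hm with hm | hm <;> simp [hm]
  · have hk := (tendsto_of_analyticAt (analyticAt_kill 0 1 0) (kill_zero 0 1)).eventually hgG
    filter_upwards [hk] with x hx
    rw [← value_update_zero, ← value_update_zero, ← hGk x, ← hx]
    rfl

lemma eventually_hasSum_quadric {g : MvPowerSeries (Fin 4) ℂ} (hg : IsConvergent g) :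
    ∀ᶠ x in 𝓝 0, HasSum (term (MvPowerSeries.X 0 * MvPowerSeries.X 1 + g) x)
      (x 0 * x 1 + value g x) := by
  classical
  filter_upwards [hg.eventually_hasSum] with x hx
  let e : Fin 4 →₀ ℕ := Finsupp.single 0 1 + Finsupp.single 1 1
  have hX : (MvPowerSeries.X 0 * MvPowerSeries.X 1 : MvPowerSeries (Fin 4) ℂ) =
      MvPowerSeries.monomial e 1 := by
    rw [MvPowerSeries.X, MvPowerSeries.X, MvPowerSeries.monomial_mul_monomial, one_mul]
  have h1 : HasSum (fun m => if m = e then x 0 * x 1 else 0) (x 0 * x 1) := hasSum_ite_eq e _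
  convert! h1.add hx using 2 with m
  rw [term, hX, map_add, MvPowerSeries.coeff_monomial, add_mul]
  congr 1
  split_ifs with h
  · rw [h, one_mul, prod_pow_add, prod_pow_single, prod_pow_single, pow_one, pow_one]
  · rw [zero_mul]

lemma convDomain_mem_nhds {n : ℕ} {f : MvPowerSeries (Fin n) ℂ} (hf : IsConvergent f) :
    convDomain f ∈ 𝓝 0 := interior_mem_nhds.mpr hf

/-! ### Second derivatives -/

lemma pderiv_comm {n : ℕ} {F : (Fin n → ℂ) → ℂ} {a : Fin n → ℂ} (hF : AnalyticAt ℂ F a)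
    (i j : Fin n) : pderiv i (pderiv j F) a = pderiv j (pderiv i F) a := by
  have h : ∀ i j, pderiv i (pderiv j F) a =
      fderiv ℂ (fderiv ℂ F) a (Pi.single i 1) (Pi.single j 1) := by
    intro i j
    have e : pderiv j F =ᶠ[𝓝 a] fun x => fderiv ℂ F x (Pi.single j 1) :=
      hF.eventually_analyticAt.mono fun x hx => pderiv_eq_fderiv j hx.differentiableAt
    have hd := hF.fderiv.differentiableAt.hasFDerivAt.clm_apply
      (hasFDerivAt_const (Pi.single j 1 : Fin n → ℂ) a)
    rw [(pderiv_congr i e).self_of_nhds, pderiv_eq_fderiv i hd.differentiableAt, hd.fderiv]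
    simp
  have hs : IsSymmSndFDerivAt ℂ F a := (hF.contDiffAt (n := 2)).isSymmSndFDerivAt (by simp)
  rw [h, h, hs]

lemma pderiv_value_zero {n : ℕ} {f : MvPowerSeries (Fin n) ℂ} (hf : IsConvergent f) (i : Fin n) :
    pderiv i (value f) 0 = MvPowerSeries.coeff (Finsupp.single i 1) f := by
  have := (pderiv_eq_of_division (analyticAt_value hf)
    (analyticAt_value (isConvergent_divCoord i hf)) (value_eq_add_coord_mul i hf)).self_of_nhds
  rw [this, value_zero, coeff_divCoord]
  simp

lemma pderiv_pderiv_value_zero {n : ℕ} {f : MvPowerSeries (Fin n) ℂ} (hf : IsConvergent f)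
    {i j : Fin n} (hij : i ≠ j) : pderiv i (pderiv j (value f)) 0 =
      MvPowerSeries.coeff (Finsupp.single i 1 + Finsupp.single j 1) f := by
  have hd := isConvergent_divCoord j hf
  have ha := analyticAt_value hd
  have ha' := analyticAt_pderiv j ha
  have h := pderiv_congr i
    (pderiv_eq_of_division (analyticAt_value hf) ha (value_eq_add_coord_mul j hf))
  rw [h.self_of_nhds, pderiv_add i
    ((analyticAt_coord j 0).differentiableAt.fun_mul ha'.differentiableAt) ha.differentiableAt,
    pderiv_coord_mul i j ha'.differentiableAt, if_neg hij.symm, pderiv_value_zero hd,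
    coeff_divCoord]
  simp

lemma HasWeight.pderiv_zero {n k : ℕ} {w : Fin n → ℕ} {F : (Fin n → ℂ) → ℂ}
    (hF : AnalyticAt ℂ F 0) (h : HasWeight w k F) {i : Fin n} (hi : w i < k) :
    Kawakita.pderiv i F 0 = 0 :=
  (h.pderiv hF i).apply_zero (by omega)

lemma HasWeight.pderiv_pderiv_zero {n k : ℕ} {w : Fin n → ℕ} {F : (Fin n → ℂ) → ℂ}
    (hF : AnalyticAt ℂ F 0) (h : HasWeight w k F) {i j : Fin n} (hij : w i + w j < k) :
    Kawakita.pderiv i (Kawakita.pderiv j F) 0 = 0 :=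
  (h.pderiv hF j).pderiv_zero (analyticAt_pderiv j hF) (by omega)

/-! ### Linear coordinate changes -/

/-- The permutation of coordinates by the transposition of `1` and `j`. -/
def swapCoord (j : Fin 4) (x : Fin 4 → ℂ) : Fin 4 → ℂ := fun k => x (Equiv.swap 1 j k)

lemma swapCoord_swapCoord (j : Fin 4) (x : Fin 4 → ℂ) : swapCoord j (swapCoord j x) = x := by
  ext k; simp [swapCoord]

lemma analyticAt_swapCoord (j : Fin 4) (a : Fin 4 → ℂ) : AnalyticAt ℂ (swapCoord j) a :=
  AnalyticAt.pi fun _ => analyticAt_coord _ a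

lemma biholGerm_swapCoord (j : Fin 4) : BiholGerm (swapCoord j) (swapCoord j) :=
  ⟨analyticAt_swapCoord j 0, analyticAt_swapCoord j 0, rfl, rfl,
    .of_forall (swapCoord_swapCoord j), .of_forall (swapCoord_swapCoord j)⟩

lemma isWeightMap_swapCoord {w : Fin 4 → ℕ} {j : Fin 4} (hj : w j = w 1) :
    IsWeightMap w (swapCoord j) := by
  intro k
  have : w (Equiv.swap 1 j k) = w k := by
    rw [Equiv.swap_apply_def]; split_ifs with h1 h2 <;> simp [*]
  rw [← this]
  exact hasWeight_coord _

lemma swapCoord_kill {j : Fin 4} (hj : j ≠ 0) (x : Fin 4 → ℂ) :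
    swapCoord j (kill 0 1 x) = kill 0 j (swapCoord j x) := by
  ext k
  revert hj
  fin_cases j <;> fin_cases k <;> simp [swapCoord, kill_apply, Equiv.swap_apply_def]

/-- `F = x₀ x₁ + G(x₂, x₃)` in the coordinates `ψ`. -/
structure IsSplit (F : (Fin 4 → ℂ) → ℂ) (ψ θ : (Fin 4 → ℂ) → Fin 4 → ℂ)
    (G : (Fin 4 → ℂ) → ℂ) : Prop where
  biholGerm : BiholGerm ψ θ
  analytic : AnalyticAt ℂ G 0
  kill : ∀ x, G (kill 0 1 x) = G x
  eq : ∀ᶠ x in 𝓝 0, F x = ψ x 0 * ψ x 1 + G (ψ x)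

lemma isSplit_swapCoord {F : (Fin 4 → ℂ) → ℂ} {ψ θ : (Fin 4 → ℂ) → Fin 4 → ℂ}
    {G : (Fin 4 → ℂ) → ℂ} {j : Fin 4} (hj : j ≠ 0) (hb : BiholGerm ψ θ) (hG : AnalyticAt ℂ G 0)
    (hGk : ∀ x, G (kill 0 j x) = G x) (h : ∀ᶠ x in 𝓝 0, F x = ψ x 0 * ψ x j + G (ψ x)) :
    IsSplit F (fun x => swapCoord j (ψ x)) (fun x => θ (swapCoord j x))
      fun x => G (swapCoord j x) where
  biholGerm := hb.trans (biholGerm_swapCoord j)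
  analytic := AnalyticAt.fun_comp hG (analyticAt_swapCoord j 0)
  kill x := by rw [swapCoord_kill hj, hGk]
  eq := by
    filter_upwards [h] with x hx
    rw [swapCoord_swapCoord, hx, swapCoord, swapCoord, Equiv.swap_apply_left,
      Equiv.swap_apply_of_ne_of_ne (by decide) hj.symm]

/-- The weights of coordinates on which `G` does not depend are irrelevant: the same coordinates can
be set to zero in the cofactor. -/
lemma HasWeight.of_kill {n k : ℕ} {i j : Fin n} {w w' : Fin n → ℕ} {G : (Fin n → ℂ) → ℂ}
    (h : HasWeight w k G) (hG : ∀ x, G (kill i j x) = G x)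
    (hw : ∀ l, l ≠ i → l ≠ j → w l = w' l) : HasWeight w' k G := by
  obtain ⟨H, hH, h1⟩ := h
  refine ⟨fun p => H (kill i.succ j.succ p),
    AnalyticAt.fun_comp (by rwa [kill_zero]) (analyticAt_kill _ _ 0), ?_⟩
  filter_upwards [(tendsto_of_analyticAt (analyticAt_kill i.succ j.succ 0)
    (kill_zero _ _)).eventually h1] with p hp
  have hp0 : kill i.succ j.succ p 0 = p 0 := by
    simp [kill_apply, (Fin.succ_ne_zero _).symm]
  have hps : ∀ l : Fin n, kill i.succ j.succ p l.succ = kill i j (fun l => p l.succ) l := by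
    intro l; simp [kill_apply]
  have e : kill i j (dilate w' p) = dilate w (kill i.succ j.succ p) := by
    ext l
    simp only [dilate, hp0, hps, kill_apply]
    split_ifs with h1 h2
    · simp
    · simp
    · rw [hw l (by assumption) (by assumption)]
  rw [← hG, e, hp, hp0]

/-- The linear map fixing `e₀, e₁, e₃` and taking `e₂` to `b e₂ + c e₃`. -/
def shear (b c : ℂ) (x : Fin 4 → ℂ) : Fin 4 → ℂ := ![x 0, x 1, b * x 2, x 3 + c * x 2]

lemma shear_shear {b : ℂ} (hb : b ≠ 0) (c : ℂ) (x : Fin 4 → ℂ) :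
    shear b c (shear b⁻¹ (-(c * b⁻¹)) x) = x ∧ shear b⁻¹ (-(c * b⁻¹)) (shear b c x) = x := by
  constructor <;> ext k <;> fin_cases k <;> simp [shear] <;> field_simp <;> ring

lemma analyticAt_shear (b c : ℂ) (a : Fin 4 → ℂ) : AnalyticAt ℂ (shear b c) a := by
  refine AnalyticAt.pi fun k => ?_
  fin_cases k
  · exact analyticAt_coord 0 a
  · exact analyticAt_coord 1 a
  · exact analyticAt_const.fun_mul (analyticAt_coord 2 a)
  · exact (analyticAt_coord 3 a).fun_add (analyticAt_const.fun_mul (analyticAt_coord 2 a))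

lemma shear_zero (b c : ℂ) : shear b c 0 = 0 := by
  ext k; fin_cases k <;> simp [shear]

lemma isWeightMap_shear {w : Fin 4 → ℕ} (hw : w 3 ≤ w 2) (b c : ℂ) :
    IsWeightMap w (shear b c) := by
  have h : ∀ c : ℂ, HasWeight w (w 2) fun x => c * x 2 := fun c =>
    ((hasWeight_of_analyticAt analyticAt_const).mul (hasWeight_coord 2)).mono (by omega)
  intro k
  fin_cases k
  · exact hasWeight_coord 0
  · exact hasWeight_coord 1
  · exact h b
  · exact (hasWeight_coord 3).add ((h c).mono hw)

lemma shear_kill (b c : ℂ) (x : Fin 4 → ℂ) :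
    shear b c (kill 0 1 x) = kill 0 1 (shear b c x) := by
  ext k; fin_cases k <;> simp [shear, kill_apply]

lemma weight_four (w : Fin 4 → ℕ) (m : Fin 4 →₀ ℕ) :
    Finsupp.weight w m = m 0 * w 0 + m 1 * w 1 + m 2 * w 2 + m 3 * w 3 := by
  rw [Finsupp.weight_apply, Finsupp.sum_fintype _ _ (by simp), Fin.sum_univ_four]
  simp only [smul_eq_mul]

/-! ### Splitting off a quadratic form -/

section Splitting

variable {r₁ r₂ a n : ℕ} {f : MvPowerSeries (Fin 4) ℂ}

/-- The pair `(0, j)` is split off and then `j` is exchanged with `1`, which preserves weights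
because `w j = w 1`. -/
lemma exists_isSplit {w : Fin 4 → ℕ} (hw : ∀ i, 0 < w i) (hw1 : w 1 ≤ w 0) {F : (Fin 4 → ℂ) → ℂ}
    (hF : AnalyticAt ℂ F 0) (hFw : HasWeight w (w 0 + w 1) F) {j : Fin 4} (hj : j ≠ 0)
    (hwj : w j = w 1)
    (hdet : pderiv 0 (pderiv j F) 0 * pderiv j (pderiv 0 F) 0 -
      pderiv 0 (pderiv 0 F) 0 * pderiv j (pderiv j F) 0 ≠ 0) :
    ∃ ψ θ G, IsSplit F ψ θ G ∧ IsWeightMap w ψ ∧ HasWeight w (w 0 + w 1) G := by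
  obtain ⟨ψ, θ, hb, hψ, G, hG, hGw, hGk, h⟩ :=
    exists_splitting hj.symm (hwj.trans_le hw1) (hw j) hF (hwj ▸ hFw) hdet
  refine ⟨_, _, _, isSplit_swapCoord hj hb hG hGk h,
    (isWeightMap_swapCoord hwj).comp hψ hb.map_zero, ?_⟩
  rw [← hwj]
  exact hGw.comp (isWeightMap_swapCoord hwj) rfl

/-- When `x₂` has smaller weight than `x₃`, the quadratic part of a `cAₙ` singularity of weight
`r₁ + r₂` cannot contain `x₁ x₃` without containing `x₁ x₂` or `x₁ x₄`. -/
lemma IsCA.false_of_lt (hn : n + 1 = (r₁ + r₂) / a) (hdvd : a ∣ r₁ + r₂) (hn2 : 2 ≤ n)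
    (hr₂ : 0 < r₂) (hlt : r₂ < a) (hf : IsConvergent f) (hcA : IsCA n f)
    (hFw : HasWeight ![r₁, r₂, a, 1] (r₁ + r₂) (value f))
    (h01 : MvPowerSeries.coeff (Finsupp.single 0 1 + Finsupp.single 1 1) f = 0)
    (h03 : MvPowerSeries.coeff (Finsupp.single 0 1 + Finsupp.single 3 1) f = 0)
    (h02 : pderiv 0 (pderiv 2 (value f)) 0 ≠ 0)
    (h22 : pderiv 2 (pderiv 2 (value f)) 0 = 0) : False := by
  have hd : (n + 1) * a = r₁ + r₂ := by rw [hn, Nat.div_mul_cancel hdvd]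
  have hFa := analyticAt_value hf
  -- These weights give `x₀ x₂` weight `n + 2` and `x₁`, `x₃` weight one. A monomial without `x₀` of
  -- old weight at least `(n + 1) a` has new weight at least `n + 2`, because `r₂ < a` and `1 < a`.
  -- With one `x₀` the only exceptions are `x₀`, `x₀ x₁` and `x₀ x₃`, which are absent. Two factors
  -- `x₀` give `2n ≥ n + 2`.
  have hF2 : HasWeight ![n, 1, 2, 1] (n + 2) (value f) := by
    rw [hasWeight_value_iff _ _ hf] at hFw ⊢
    intro m hm
    by_cases hlow : Finsupp.weight ![r₁, r₂, a, 1] m < r₁ + r₂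
    · exact hFw m hlow
    rw [weight_four] at hm hlow
    simp only [Matrix.cons_val] at hm hlow
    rcases Nat.lt_or_ge (m 0) 2 with h0 | h0
    · interval_cases h : m 0
      · exfalso
        have h1 : m 1 * r₂ + m 1 ≤ m 1 * a := by nlinarith
        have h3 : m 3 + m 3 ≤ m 3 * a := by nlinarith
        have h4 : (m 1 + 2 * m 2 + m 3) * a ≤ (n + 1) * a := Nat.mul_le_mul_right a (by omega)
        have h5 : m 2 ≤ m 2 * a := Nat.le_mul_of_pos_right _ (by omega)
        have h6 : (m 1 + 2 * m 2 + m 3) * a = m 1 * a + 2 * (m 2 * a) + m 3 * a := by ring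
        have h7 : m 1 = 0 ∧ m 2 = 0 ∧ m 3 = 0 := by omega
        obtain ⟨h8, h9, h10⟩ := h7
        simp only [h8, h9, h10] at hlow
        omega
      · have h2 : m 2 = 0 := by omega
        have h13 : (m 1 = 0 ∧ m 3 = 0) ∨ (m 1 = 1 ∧ m 3 = 0) ∨ (m 1 = 0 ∧ m 3 = 1) := by omega
        rcases h13 with ⟨h1, h3⟩ | ⟨h1, h3⟩ | ⟨h1, h3⟩
        · simp only [h1, h2, h3] at hlow
          omega
        · convert h01
          ext k; fin_cases k <;> simp [h, h1, h2, h3]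
        · convert h03
          ext k; fin_cases k <;> simp [h, h1, h2, h3]
    · nlinarith
  obtain ⟨ψ, θ, hb, -, G, hG, hGw, hGk, h⟩ :=
    exists_splitting (i := 0) (j := 2) (w := ![n, 1, 2, 1]) (by decide) hn2 two_pos hFa hF2 (by
      rw [h22, mul_zero, sub_zero, pderiv_comm hFa 2 0]
      exact mul_ne_zero h02 h02)
  -- `G` involves only the coordinates of index `1` and `3`, both of weight one, so its weight
  -- bounds its order.
  have hG1 : HasWeight (fun _ => 1) (n + 2) G := by
    refine HasWeight.of_kill hGw hGk fun l h0 h2 => ?_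
    fin_cases l <;> simp_all
  have hs := isSplit_swapCoord (by decide) hb hG hGk h
  exact hcA.not_order_ge (by omega) hs.biholGerm hs.analytic
    (hG1.comp (isWeightMap_swapCoord rfl) rfl) hs.eq

/-- By weight the Hessian lives in row `0`, column `0` and the entry `(1, 1)`. The cases look for an
index `j` of weight `r₂` with nonzero `(0, j)` minor, in the order `1`, `3`, `2`. -/
theorem IsCA.exists_isSplit (hr₂ : 0 < r₂) (ha : 0 < a) (hdvd : a ∣ r₁ + r₂) (hle : r₂ ≤ r₁)
    (hn : n + 1 = (r₁ + r₂) / a) (hn2 : 2 ≤ n) (hf : IsConvergent f) (hcA : IsCA n f)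
    (hFw : HasWeight ![r₁, r₂, a, 1] (r₁ + r₂) (value f)) :
    ∃ ψ θ G, IsSplit (value f) ψ θ G ∧ IsWeightMap ![r₁, r₂, a, 1] ψ ∧
      HasWeight ![r₁, r₂, a, 1] (r₁ + r₂) G := by
  have hd : (n + 1) * a = r₁ + r₂ := by rw [hn, Nat.div_mul_cancel hdvd]
  have hd3 : 3 * a ≤ r₁ + r₂ := hd ▸ Nat.mul_le_mul_right a (by omega)
  have hF := analyticAt_value hf
  have hw : ∀ i, 0 < ![r₁, r₂, a, 1] i := by
    intro i; fin_cases i <;> simp <;> omega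
  have key {j : Fin 4} (hj : j ≠ 0) (hwj : ![r₁, r₂, a, 1] j = r₂) :=
    Kawakita.exists_isSplit hw hle hF hFw hj hwj
  have hz {i j : Fin 4} (h : ![r₁, r₂, a, 1] i + ![r₁, r₂, a, 1] j < r₁ + r₂) :
      pderiv i (pderiv j (value f)) 0 = 0 := hFw.pderiv_pderiv_zero hF h
  have hd1 : ∀ i, pderiv i (value f) 0 = 0 := by
    refine fun i => hFw.pderiv_zero hF ?_
    fin_cases i <;> simp <;> omega
  have b12 := hz (i := 1) (j := 2) (by simp; omega)
  have b13 := hz (i := 1) (j := 3) (by simp; omega)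
  have b22 := hz (i := 2) (j := 2) (by simp; omega)
  have b23 := hz (i := 2) (j := 3) (by simp; omega)
  have b33 := hz (i := 3) (j := 3) (by simp; omega)
  have b10 := pderiv_comm hF 1 0
  have b20 := pderiv_comm hF 2 0
  have b30 := pderiv_comm hF 3 0
  have b21 := (pderiv_comm hF 2 1).trans b12
  have b31 := (pderiv_comm hF 3 1).trans b13
  have b32 := (pderiv_comm hF 3 2).trans b23
  by_cases hdet : pderiv 0 (pderiv 1 (value f)) 0 * pderiv 1 (pderiv 0 (value f)) 0 -
      pderiv 0 (pderiv 0 (value f)) 0 * pderiv 1 (pderiv 1 (value f)) 0 = 0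
  swap
  · exact key (by decide) rfl hdet
  by_cases h03 : pderiv 0 (pderiv 3 (value f)) 0 = 0
  swap
  -- The monomial `x₀ x₃` has weight `r₁ + 1`, so its presence forces `r₂ = 1`, and index `3` can
  -- play the role of index `1`.
  · have h1 : r₂ = 1 := by
      by_contra h
      exact h03 (hz (by simp; omega))
    refine key (j := 3) (by decide) h1.symm ?_
    rw [b33, b30, mul_zero, sub_zero]
    exact mul_ne_zero h03 h03
  rw [b10] at hdet
  by_cases h02 : pderiv 0 (pderiv 2 (value f)) 0 = 0
  · exfalso
    -- What remains of the Hessian is the block on the indices `0, 1`, with determinant zero. Its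
    -- kernel contains a hyperplane, contrary to `IsCA.not_degenerate`.
    by_cases h00 : pderiv 0 (pderiv 0 (value f)) 0 = 0
    · have h01 : pderiv 0 (pderiv 1 (value f)) 0 = 0 := by
        simpa [h00] using hdet
      refine hcA.not_degenerate hf hd1 (LinearMap.proj 1) fun x hx i => ?_
      have hx : x 1 = 0 := hx
      fin_cases i <;> simp [Fin.sum_univ_four, *]
    · refine hcA.not_degenerate hf hd1
        (pderiv 0 (pderiv 0 (value f)) 0 • LinearMap.proj 0 +
          pderiv 0 (pderiv 1 (value f)) 0 • LinearMap.proj 1) fun x hx i => ?_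
      simp only [LinearMap.add_apply, LinearMap.smul_apply, LinearMap.proj_apply,
        smul_eq_mul] at hx
      fin_cases i <;> simp only [Fin.sum_univ_four, Fin.zero_eta, Fin.mk_one, Fin.reduceFinMk, b10,
        b20, b30, b12, b21, b13, b31, b22, b23, b32, b33, h02, h03, mul_zero, add_zero]
      · linear_combination hx
      · refine (mul_eq_zero.mp ?_).resolve_left h00
        linear_combination pderiv 0 (pderiv 1 (value f)) 0 * hx - x 1 * hdet
  -- Now `x₀ x₂`, of weight `r₁ + a`, occurs. If `r₂ = a`, index `2` replaces index `1`; if `r₂ <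
  -- a`, the entry `(1, 1)` vanishes, the minor forces `x₀ x₁` to be absent, and `IsCA.false_of_lt`
  -- applies.
  have hle2 : r₂ ≤ a := by
    by_contra h
    exact h02 (hz (by simp; omega))
  rcases hle2.eq_or_lt with h1 | h1
  · refine key (j := 2) (by decide) h1.symm ?_
    rw [b22, b20, mul_zero, sub_zero]
    exact mul_ne_zero h02 h02
  · have b11 := hz (i := 1) (j := 1) (by simp; omega)
    have h01 : pderiv 0 (pderiv 1 (value f)) 0 = 0 := by
      simpa [b11] using hdet
    rw [pderiv_pderiv_value_zero hf (by decide)] at h01 h03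
    exact (hcA.false_of_lt hn hdvd hn2 hr₂ h1 hf hFw h01 h03 h02 b22).elim

end Splitting

/-! ### Making the power of `x₃` appear -/

/-- The degree `k` part times `X i` is a nonzero polynomial, hence nonzero at some point. The
condition `x i ≠ 0` later makes the shear invertible. -/
lemma exists_sum_exponents_ne_zero {n k : ℕ} {g : MvPowerSeries (Fin n) ℂ} {m : Fin n →₀ ℕ}
    (hm : m.degree = k) (hg : MvPowerSeries.coeff m g ≠ 0) (i : Fin n) :
    ∃ x : Fin n → ℂ, x i ≠ 0 ∧ ∑ m ∈ exponents n k, term g x m ≠ 0 := by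
  classical
  let P : MvPolynomial (Fin n) ℂ :=
    ∑ m ∈ exponents n k, MvPolynomial.monomial m (MvPowerSeries.coeff m g)
  have hP : P ≠ 0 := fun h => by
    have := congrArg (MvPolynomial.coeff m) h
    rw [MvPolynomial.coeff_sum, Finset.sum_eq_single m, MvPolynomial.coeff_monomial, if_pos rfl,
      MvPolynomial.coeff_zero] at this
    · exact hg this
    · intro m' _ hne
      rw [MvPolynomial.coeff_monomial, if_neg hne]
    · exact fun h => absurd (mem_exponents.mpr hm) h
  obtain ⟨x, hx⟩ := exists_eval_ne_zero (mul_ne_zero hP (MvPolynomial.X_ne_zero i))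
  rw [map_mul, MvPolynomial.eval_X, mul_ne_zero_iff] at hx
  refine ⟨x, hx.2, ?_⟩
  convert hx.1 using 1
  rw [map_sum]
  refine Finset.sum_congr rfl fun m _ => ?_
  rw [MvPolynomial.eval_monomial, Finsupp.prod_fintype _ _ (by simp), term]

lemma exists_normal_form {r₁ r₂ a n : ℕ} (ha : 0 < a) (hd : (n + 1) * a = r₁ + r₂)
    {F : (Fin 4 → ℂ) → ℂ} {ψ θ : (Fin 4 → ℂ) → Fin 4 → ℂ} {G : (Fin 4 → ℂ) → ℂ}
    (hs : IsSplit F ψ θ G) (hψ : IsWeightMap ![r₁, r₂, a, 1] ψ)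
    (hGw : HasWeight ![r₁, r₂, a, 1] (r₁ + r₂) G)
    (hG : ¬ HasWeight (fun _ => 1) (n + 2) G) :
    ∃ (ψ' θ' : (Fin 4 → ℂ) → Fin 4 → ℂ) (g : MvPowerSeries (Fin 4) ℂ), BiholGerm ψ' θ' ∧
      IsWeightMap ![r₁, r₂, a, 1] ψ' ∧ IsConvergent g ∧ OnlyLastTwo g ∧
      HasWeight ![r₁, r₂, a, 1] (r₁ + r₂) (value g) ∧
      MvPowerSeries.coeff (Finsupp.single 2 (n + 1)) g ≠ 0 ∧
      ∀ᶠ x in 𝓝 0, F x = ψ' x 0 * ψ' x 1 + value g (ψ' x) := by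
  obtain ⟨g₀, hg₀, ho, hgG⟩ := exists_series_of_kill hs.analytic hs.kill
  have hw₀ := (hasWeight_value_iff _ _ hg₀).mp (hGw.congr hgG.symm)
  -- A monomial of `g₀` satisfies `m₂ a + m₃ ≥ (n + 1) a`, so its degree is at least `n + 1`. Since
  -- the order is not `n + 2` or more, degree `n + 1` occurs.
  obtain ⟨m, hm, hm0⟩ : ∃ m : Fin 4 →₀ ℕ, m.degree = n + 1 ∧ MvPowerSeries.coeff m g₀ ≠ 0 := by
    by_contra! hc
    refine hG (HasWeight.congr ?_ hgG)
    rw [hasWeight_value_iff _ _ hg₀]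
    intro m hm
    by_contra hm0
    have h0 : m 0 = 0 := by by_contra h; exact hm0 (ho m (.inl h))
    have h1 : m 1 = 0 := by by_contra h; exact hm0 (ho m (.inr h))
    have h2 : r₁ + r₂ ≤ Finsupp.weight ![r₁, r₂, a, 1] m := by
      by_contra! h
      exact hm0 (hw₀ m h)
    rw [weight_four] at h2 hm
    simp only [Matrix.cons_val, h0, h1] at h2 hm
    refine hm0 (hc m ?_)
    rw [Finsupp.degree_eq_sum, Fin.sum_univ_four, h0, h1]
    have h3 : m 3 ≤ m 3 * a := Nat.le_mul_of_pos_right _ ha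
    have h4 : (n + 1) * a ≤ (m 2 + m 3) * a := by rw [add_mul (m 2)]; omega
    have := Nat.le_of_mul_le_mul_right h4 ha
    omega
  obtain ⟨x, hx2, hx⟩ := exists_sum_exponents_ne_zero hm hm0 2
  -- `T` sends the axis of index `2` to the line through `(x 2, x 3)`, where the leading form does
  -- not vanish. The coefficient of the pure power in `G ∘ T` is the value of that form.
  let T := shear (x 2) (x 3)
  let S := shear (x 2)⁻¹ (-(x 3 * (x 2)⁻¹))
  have hT (y) : T (S y) = y := (shear_shear hx2 _ y).1
  have hbS : BiholGerm S T := ⟨analyticAt_shear _ _ _, analyticAt_shear _ _ _, shear_zero _ _,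
    shear_zero _ _, .of_forall hT, .of_forall fun y => (shear_shear hx2 _ y).2⟩
  have hwT : IsWeightMap ![r₁, r₂, a, 1] T := isWeightMap_shear ha _ _
  have hwS : IsWeightMap ![r₁, r₂, a, 1] S := isWeightMap_shear ha _ _
  have hGT : AnalyticAt ℂ (fun y => G (T y)) 0 :=
    AnalyticAt.fun_comp (by rw [hbS.map_zero_inv]; exact hs.analytic) hbS.analytic_inv
  obtain ⟨g, hg, ho', hgGT⟩ := exists_series_of_kill hGT fun y =>
    (congrArg G (shear_kill _ _ y)).trans (hs.kill _)
  have hb := hs.biholGerm.trans hbS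
  refine ⟨_, _, g, hb, hwS.comp hψ hs.biholGerm.map_zero, hg, ho',
    (hGw.comp hwT hbS.map_zero_inv).congr hgGT.symm, ?_, ?_⟩
  · rw [← sum_exponents_single]
    convert hx using 1
    refine sum_exponents_eq_of_line hg hg₀ _ _ ?_ _
    have ht (v : Fin 4 → ℂ) : Tendsto (fun t : ℂ => t • v) (𝓝 0) (𝓝 0) := by
      have : Continuous fun t : ℂ => t • v := by fun_prop
      simpa using this.tendsto 0
    filter_upwards [(ht _).eventually hgGT, (ht _).eventually hgG] with t h1 h2
    rw [h1, h2, ← hs.kill (t • x)]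
    congr 1
    ext k
    fin_cases k <;> simp [T, shear, kill_apply, mul_comm]
  · filter_upwards [hs.eq, (tendsto_of_analyticAt hb.analytic hb.map_zero).eventually hgGT]
      with y h1 h2
    rw [h2, h1, hT]
    rfl

/-! ### Isolated singularities and zero loci -/

/-- By the chain rule a critical zero of `g` at `ψ y` is one of `f` at `y`, and `θ` preserves
punctured neighbourhoods. -/
lemma IsIsolated.of_comp {n : ℕ} {f g : MvPowerSeries (Fin n) ℂ} {ψ θ : (Fin n → ℂ) → Fin n → ℂ}
    (h : IsIsolated f) (hg : IsConvergent g) (hb : BiholGerm ψ θ)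
    (hfg : ∀ᶠ x in 𝓝 0, value f x = value g (ψ x)) : IsIsolated g := by
  have h1 : ∀ᶠ y in 𝓝[≠] 0, value g (ψ y) = 0 → fderiv ℂ (value g) (ψ y) ≠ 0 := by
    have hga := (tendsto_of_analyticAt hb.analytic hb.map_zero).eventually
      (analyticAt_value hg).eventually_analyticAt
    filter_upwards [h, (eventually_eventually_nhds.mpr hfg).filter_mono nhdsWithin_le_nhds,
      hga.filter_mono nhdsWithin_le_nhds,
      hb.analytic.eventually_analyticAt.filter_mono nhdsWithin_le_nhds] with y h1 h2 h3 h4 h5 h6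
    refine h1 (h2.self_of_nhds.trans h5) ?_
    rw [Filter.EventuallyEq.fderiv_eq h2, fderiv_fun_comp y h3.differentiableAt
      h4.differentiableAt, h6, ContinuousLinearMap.zero_comp]
  have ht : Tendsto θ (𝓝[≠] 0) (𝓝[≠] 0) := by
    refine tendsto_nhdsWithin_iff.mpr ⟨(tendsto_of_analyticAt hb.analytic_inv
      hb.map_zero_inv).mono_left nhdsWithin_le_nhds, ?_⟩
    filter_upwards [hb.right_inv.filter_mono nhdsWithin_le_nhds, self_mem_nhdsWithin] with x h2 h3 h4
    refine h3 ?_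
    rw [← h2, Set.mem_singleton_iff.mp h4, hb.map_zero]
    rfl
  filter_upwards [ht.eventually h1, hb.right_inv.filter_mono nhdsWithin_le_nhds] with x h2 h3
  rwa [h3] at h2

lemma eventually_mem_zeroLocus_iff {n : ℕ} {f g : MvPowerSeries (Fin n) ℂ}
    {ψ θ : (Fin n → ℂ) → Fin n → ℂ} (hf : IsConvergent f) (hg : IsConvergent g)
    (hb : BiholGerm ψ θ) (hfg : ∀ᶠ x in 𝓝 0, value f x = value g (ψ x)) :
    ∀ᶠ x in 𝓝 0, x ∈ zeroLocus f ↔ ψ x ∈ zeroLocus g := by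
  filter_upwards [hfg, convDomain_mem_nhds hf,
    (tendsto_of_analyticAt hb.analytic hb.map_zero).eventually (convDomain_mem_nhds hg)]
    with x h1 h2 h3
  exact ⟨fun h => ⟨h3, h1 ▸ h.2⟩, fun h => ⟨h2, h1.trans h.2⟩⟩

end Kawakita

/-! ### Assembly of the normal form and the local equivalence. -/

theorem mainTheorem4 (r₁ r₂ a n : ℕ) (hr₁ : 0 < r₁) (hr₂ : 0 < r₂) (ha : 0 < a)
    (hdvd : a ∣ r₁ + r₂) (hc₁ : Nat.Coprime a r₁) (hc₂ : Nat.Coprime a r₂) (hle : r₂ ≤ r₁)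
    (hn : n + 1 = (r₁ + r₂) / a) (hn2 : 2 ≤ n)
    (f : MvPowerSeries (Fin 4) ℂ) (hf : Kawakita.IsConvergent f)
    (hiso : Kawakita.IsIsolated f) (hcA : Kawakita.IsCA n f)
    (hwt : MvPowerSeries.weightedOrder ![r₁, r₂, a, 1] f = ((r₁ + r₂ : ℕ) : ℕ∞)) :
    Kawakita.IsKawakitaBlowup r₁ r₂ a ![r₁, r₂, a, 1] (Kawakita.zeroLocus f) := by
  have hd : (n + 1) * a = r₁ + r₂ := by rw [hn, Nat.div_mul_cancel hdvd]
  have hFw : Kawakita.HasWeight ![r₁, r₂, a, 1] (r₁ + r₂) (Kawakita.value f) := by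
    rw [Kawakita.hasWeight_value_iff _ _ hf]
    intro m hm
    refine MvPowerSeries.coeff_eq_zero_of_lt_weightedOrder ![r₁, r₂, a, 1] ?_
    rw [hwt]
    exact_mod_cast hm
  obtain ⟨ψ₀, θ₀, G, hs, hψ₀, hGw⟩ := hcA.exists_isSplit hr₂ ha hdvd hle hn hn2 hf hFw
  obtain ⟨ψ, θ, g, hb, hψ, hg, ho, hgw, hgn, hfg⟩ :=
    Kawakita.exists_normal_form ha hd hs hψ₀ hGw fun h =>
      hcA.not_order_ge (by omega) hs.biholGerm hs.analytic h hs.eq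
  have hQ := Kawakita.eventually_hasSum_quadric hg
  have hQc : Kawakita.IsConvergent (MvPowerSeries.X 0 * MvPowerSeries.X 1 + g) :=
    hQ.mono fun x hx => hx.summable
  have hfQ : ∀ᶠ x in 𝓝 0, Kawakita.value f x =
      Kawakita.value (MvPowerSeries.X 0 * MvPowerSeries.X 1 + g) (ψ x) := by
    filter_upwards [hfg, (Kawakita.tendsto_of_analyticAt hb.analytic hb.map_zero).eventually hQ]
      with x h1 h2
    rw [h1]
    exact h2.tsum_eq.symm
  refine ⟨hr₁, hr₂, ha, hdvd, hc₁, hc₂, by omega, g, hg, ho, ?_, hn ▸ hgn,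
    hiso.of_comp hQc hb hfQ, hb.locallyEquivalent ?_ hψ
      (Kawakita.eventually_mem_zeroLocus_iff hf hQc hb hfQ)⟩
  -- The weight is exactly `r₁ + r₂`, since the pure power of index `2` has weight `(n + 1) a`.
  · rw [MvPowerSeries.weightedOrder_eq_nat]
    refine ⟨⟨_, hgn, ?_⟩, (Kawakita.hasWeight_value_iff _ _ hg).mp hgw⟩
    rw [Finsupp.weight_single]
    exact hd
  · intro i
    fin_cases i
    exacts [hr₁, hr₂, ha, one_pos]
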